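/- \textbf{Lower bounded center clustering (LBC).} An instance consists of a set $P$ of $n$ distinct points in $\mathbb{R}^d$ (Euclidean distance) and an integer $1\le\lambda\le n$. A solution is a set $C\subseteq P$ of centers together with an assignment $f:P\to C$ such that every center of $C$ is assigned at least $\lambda$ points of $P$. Its price is $\max_{p\in P}\|p-f(p)\|$, and $r_{\mathrm{opt}}(P,\lambda)$ is the minimum price of a solution. The model of computation is the real RAM with unit-cost floor function: unbounded memory of integer cells and of real cells, initially $0$ apart from the input, addressed by (computed) integers; unit-cost arithmetic ($+,-,\times$ on integers; $+,-,\times,/$ on reals, with division by zero returning $0$; the conversion of integers to reals and the floor of a real) and comparisons. \textbf{Lemma.} For every fixed dimension $d$ there are a (deterministic) real RAM program and a constant $K$ such that, for every LBC instance $(P,\lambda)$ of $n$ points in $\mathbb{R}^d$ and every real $\varepsilon>0$, the program with input $(P,\lambda,\varepsilon)$ halts after at most $$K\Bigl(1+n\log\frac{n}{\min\{\varepsilon,1\}}\Bigr)$$ steps (that is, in $O(n\log(n/\varepsilon))$ time for $n\ge 2$ and $0<\varepsilon\le 1$) and outputs a $(4+\varepsilon)$-approximation: a solution $(C,f)$ and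 a number $\rho$ with $$\max_{p\in P}\|p-f(p)\|\;\le\;\rho\;\le\;(4+\varepsilon)\,r_{\mathrm{opt}}(P,\lambda).$$ -/

import Mathlib

/-! ### The real RAM with unit-cost floor

Memory consists of integer cells and real cells.  A cell is named by the (constant) number of an
array and by an integer address inside that array; addresses may be computed, so indirect
addressing is available, and the memory is unbounded.  A program is a fixed finite piece of code
that uses finitely many arrays.  There is no other storage: a scalar variable is a cell with a
constant address.  The machine has no square roots, no logarithms and no bit operations. -/

namespace RealRAM

/-- The contents of the memory: `ints a z` and `reals a z` are the contents of the cell with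
address `z` in the integer array, respectively the real array, number `a`. -/
structure State where
  ints : ℕ → ℤ → ℤ
  reals : ℕ → ℤ → ℝ

mutual
/-- Integer expressions. -/
inductive IExp : Type
  | const (k : ℤ) : IExp
  | load (a : ℕ) (addr : IExp) : IExp
  | add (e f : IExp) : IExp
  | sub (e f : IExp) : IExp
  | mul (e f : IExp) : IExp
  | floor (e : RExp) : IExp

/-- Real expressions. -/
inductive RExp : Type
  | ofInt (e : IExp) : RExp
  | load (a : ℕ) (addr : IExp) : RExp
  | add (e f : RExp) : RExp
  | sub (e f : RExp) : RExp
  | mul (e f : RExp) : RExp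
  | div (e f : RExp) : RExp
end

mutual
/-- The value of an integer expression. -/
noncomputable def IExp.eval (s : State) : IExp → ℤ
  | .const k => k
  | .load a addr => s.ints a (addr.eval s)
  | .add e f => e.eval s + f.eval s
  | .sub e f => e.eval s - f.eval s
  | .mul e f => e.eval s * f.eval s
  | .floor e => ⌊e.eval s⌋

/-- The value of a real expression (division by zero returns zero). -/
noncomputable def RExp.eval (s : State) : RExp → ℝ
  | .ofInt e => (e.eval s : ℝ)
  | .load a addr => s.reals a (addr.eval s)
  | .add e f => e.eval s + f.eval s
  | .sub e f => e.eval s - f.eval s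
  | .mul e f => e.eval s * f.eval s
  | .div e f => e.eval s / f.eval s
end

mutual
/-- The number of elementary operations (constants, memory accesses, arithmetic operations) in
the evaluation of an integer expression. -/
def IExp.cost : IExp → ℕ
  | .const _ => 1
  | .load _ addr => 1 + addr.cost
  | .add e f => 1 + e.cost + f.cost
  | .sub e f => 1 + e.cost + f.cost
  | .mul e f => 1 + e.cost + f.cost
  | .floor e => 1 + e.cost

/-- The number of elementary operations in the evaluation of a real expression. -/
def RExp.cost : RExp → ℕ
  | .ofInt e => 1 + e.cost
  | .load _ addr => 1 + addr.cost
  | .add e f => 1 + e.cost + f.cost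
  | .sub e f => 1 + e.cost + f.cost
  | .mul e f => 1 + e.cost + f.cost
  | .div e f => 1 + e.cost + f.cost
end

/-- Tests: comparisons of two integers or of two reals, and their Boolean combinations. -/
inductive Test : Type
  | ile (e f : IExp) : Test
  | rle (e f : RExp) : Test
  | not (b : Test) : Test
  | and (b c : Test) : Test

/-- A test succeeds in a state. -/
def Test.Holds (s : State) : Test → Prop
  | .ile e f => e.eval s ≤ f.eval s
  | .rle e f => e.eval s ≤ f.eval s
  | .not b => ¬ b.Holds s
  | .and b c => b.Holds s ∧ c.Holds s

/-- The number of elementary operations in a test. -/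
def Test.cost : Test → ℕ
  | .ile e f => 1 + e.cost + f.cost
  | .rle e f => 1 + e.cost + f.cost
  | .not b => 1 + b.cost
  | .and b c => 1 + b.cost + c.cost

/-- Programs. -/
inductive Cmd : Type
  | skip : Cmd
  | istore (a : ℕ) (addr : IExp) (e : IExp) : Cmd
  | rstore (a : ℕ) (addr : IExp) (e : RExp) : Cmd
  | seq (p q : Cmd) : Cmd
  | ite (b : Test) (p q : Cmd) : Cmd
  | while (b : Test) (p : Cmd) : Cmd

/-- The state after writing the integer `v` to a cell. -/
def State.setInt (s : State) (a : ℕ) (z v : ℤ) : State :=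
  { s with ints := Function.update s.ints a (Function.update (s.ints a) z v) }

/-- The state after writing the real `v` to a cell. -/
def State.setReal (s : State) (a : ℕ) (z : ℤ) (v : ℝ) : State :=
  { s with reals := Function.update s.reals a (Function.update (s.reals a) z v) }

/-- `Exec p s t s'`: started in state `s`, the program `p` halts in state `s'` after exactly `t`
elementary operations. -/
inductive Exec : Cmd → State → ℕ → State → Prop
  | skip (s : State) : Exec .skip s 1 s
  | istore (a : ℕ) (addr e : IExp) (s : State) :
      Exec (.istore a addr e) s (1 + addr.cost + e.cost) (s.setInt a (addr.eval s) (e.eval s))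
  | rstore (a : ℕ) (addr : IExp) (e : RExp) (s : State) :
      Exec (.rstore a addr e) s (1 + addr.cost + e.cost) (s.setReal a (addr.eval s) (e.eval s))
  | seq {p q : Cmd} {s₁ s₂ s₃ : State} {t u : ℕ} :
      Exec p s₁ t s₂ → Exec q s₂ u s₃ → Exec (.seq p q) s₁ (t + u) s₃
  | ite_true {b : Test} {p q : Cmd} {s s' : State} {t : ℕ} :
      b.Holds s → Exec p s t s' → Exec (.ite b p q) s (1 + b.cost + t) s'
  | ite_false {b : Test} {p q : Cmd} {s s' : State} {t : ℕ} :
      ¬ b.Holds s → Exec q s t s' → Exec (.ite b p q) s (1 + b.cost + t) s'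
  | while_true {b : Test} {p : Cmd} {s₁ s₂ s₃ : State} {t u : ℕ} :
      b.Holds s₁ → Exec p s₁ t s₂ → Exec (.while b p) s₂ u s₃ →
        Exec (.while b p) s₁ (1 + b.cost + t + u) s₃
  | while_false {b : Test} {p : Cmd} {s : State} :
      ¬ b.Holds s → Exec (.while b p) s (1 + b.cost) s

end RealRAM

/-! ### Lower bounded center clustering

The points of the instance are `P 0, …, P (n - 1)`; centers and assignments are given by the
indices of the points. -/

namespace LBC

/-- `C` is a set of centers and `f` an assignment of the points to the centers in `C` such that
every center is assigned at least `lam` points. -/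
def IsSolution {n : ℕ} (lam : ℕ) (C : Finset (Fin n)) (f : Fin n → Fin n) : Prop :=
  (∀ i, f i ∈ C) ∧ ∀ c ∈ C, lam ≤ (Finset.univ.filter (fun i => f i = c)).card

/-- The price of an assignment: the maximum distance of a point to its assigned center. -/
noncomputable def price {d n : ℕ} (P : Fin n → EuclideanSpace ℝ (Fin d))
    (f : Fin n → Fin n) : ℝ :=
  ⨆ i, dist (P i) (P (f i))

/-- The price of the optimal solution (a minimum over a finite set, which is nonempty whenever
`lam ≤ n`). -/
noncomputable def optPrice {d n : ℕ} (P : Fin n → EuclideanSpace ℝ (Fin d)) (lam : ℕ) : ℝ :=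
  sInf {r : ℝ | ∃ (C : Finset (Fin n)) (f : Fin n → Fin n), IsSolution lam C f ∧ r = price P f}

/-- The memory at the start of the computation: `n` and `lam` are in cell `0` of the integer
arrays `0` and `1`, `ε` is in cell `0` of the real array `0`, the `j`-th coordinate of the `i`-th
point is in cell `i` of the real array `j + 1`, and every other cell contains `0`. -/
noncomputable def input {d n : ℕ} (P : Fin n → EuclideanSpace ℝ (Fin d)) (lam : ℕ) (ε : ℝ) :
    RealRAM.State where
  ints a z := if a = 0 ∧ z = 0 then (n : ℤ) else if a = 1 ∧ z = 0 then (lam : ℤ) else 0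
  reals a z :=
    match a with
    | 0 => if z = 0 then ε else 0
    | j + 1 =>
      if h : j < d ∧ 0 ≤ z ∧ z.toNat < n then P ⟨z.toNat, h.2.2⟩ ⟨j, h.1⟩ else 0

/-- The memory presents, as the result of the computation, the center set `C`, the assignment `f`
and the real number `ρ`: cell `i` of the integer array `2` holds the index of the center of the
`i`-th point, cell `i` of the integer array `3` holds `1` or `0` according to whether the `i`-th
point is a center, and `ρ` is in cell `0` of the real array `d + 1`. -/
def IsOutput {n : ℕ} (d : ℕ) (s : RealRAM.State) (C : Finset (Fin n)) (f : Fin n → Fin n)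
    (ρ : ℝ) : Prop :=
  (∀ i : Fin n, s.ints 2 (i : ℕ) = ((f i : ℕ) : ℤ)) ∧
  (∀ i : Fin n, s.ints 3 (i : ℕ) = if i ∈ C then 1 else 0) ∧
  s.reals (d + 1) 0 = ρ

end LBC

/-!
The algorithm for `2 ≤ lam` rests on a test for a radius `r > 0`.  Select greedily a net of centers:
points with distances greater than `4 r` such that every point has distance at most `4 r` to a
center.  Assign every point to its nearest center, which gives price at most `4 r`.  All points at
distance at most `2 r` from a center are assigned to it.  Hence, if `r` is at least the optimal
price, then every cluster has at least `lam` points, because it contains the points that share with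
its center the center in an optimal solution (`LBC.card_cluster_ge`).  So the test either finds a
solution of price at most `4 r`, or shows that `r` is smaller than the optimal price
(`RealRAM.tryRadius_spec`).

The test takes linear time.  The centers are stored in a grid with cells of side length `4 r / d`:
a cell contains at most one center, and the centers at distance at most `4 r` from a point lie in a
constant number of neighboring cells.  The cell with the index vector `z` is stored at the address
`LBC.encode d z`, where `LBC.encode` is an injective polynomial, so that no hashing is necessary
(`RealRAM.scan_spec`).  The grid need not be cleared between two tests: the entries of a test are
larger than those of all earlier tests.

It remains to perform the test for few radii.  The optimal price is the distance of two points,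
hence it agrees up to the factor `d` with a difference of two coordinates on the same axis, and up
to another factor `N` with one of the gaps between neighbors in the sorted sequence of all
coordinates of all points, where `N` is the length of this sequence (`LBC.exists_gap_dist`).  The
gaps are sorted as well (`RealRAM.sortedGaps_spec`), and binary search among them finds a lower
bound `g` for the optimal price such that the radius `d * N * g` is successful
(`RealRAM.searchGap_spec`).  Bisection of the interval from `g` to `d * N * g` reduces the relative
error to `ε / 4` (`RealRAM.bisect_spec`).  As `N` is at most `2 * n * d`, both searches perform
`O(log (n / min ε 1))` tests (`RealRAM.exists_iterations`).

The sorting is by merge sort, for sequences whose length is a power of two.  The sequence of the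
coordinates is extended to such a length by the contents of the following cells, whatever they are:
additional elements and additional gaps do no harm, since it is only needed that all coordinates and
all gaps occur.

The programs are verified with the judgement `RealRAM.Runs`, which bounds the number of steps and
gives a postcondition.  Scalar variables are the cells with address `0`, and every scalar variable
has an array of its own.  What a program does not change is read off from the arrays to which it
contains assignments (`RealRAM.Exec.frame`).  The integer arrays are used as follows.
* `0`, `1`: `n` and `lam`;
* `2`, `3`: the assignment and the indicator function of the centers in the output;
* `4`, `5`, `6`: assignment, indicator function of the centers, and cluster sizes in the current
  test;
* `7`, `8`, `9`: the grid, the index vector of a cell, and a bound for the obsolete grid entries;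
* `10`, `11`, `12`, `13`: the current point, the candidate for its center, the outcome of the test,
  and the center under consideration;
* `14`, …, `20`: the variables of merge sort, where `14` is `N` and `16` the address of the result;
* `22`, `23`: the variables of the binary search.

The real arrays are used as follows.
* `0`, …, `d`: `ε` and the coordinates of the points;
* `d + 1`, `d + 2`: the sorted coordinates (later the output `ρ`) and the sorted gaps;
* `d + 3`, `d + 4`, `d + 5`: the radius `r` of the test, the reciprocal of the side length of the
  grid cells, and the square of `4 r`;
* `d + 6`, `d + 7`: the squared distances of the candidate and of the center under consideration;
* `d + 8`, `d + 9`: the bounds of the bisection.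
-/

namespace RealRAM

/-! ### Running programs: postconditions, costs and frames -/

@[simp] theorem State.setInt_ints (s : State) (a b : ℕ) (z y v : ℤ) :
    (s.setInt a z v).ints b y = if b = a ∧ y = z then v else s.ints b y := by
  by_cases h : b = a
  · subst h; by_cases h' : y = z <;> simp [State.setInt, h']
  · simp [State.setInt, h]

theorem State.setInt_ints_of_ne (s : State) {a b : ℕ} (z v : ℤ) (h : b ≠ a) :
    (s.setInt a z v).ints b = s.ints b := by
  simp [State.setInt, h]

@[simp] theorem State.setInt_reals (s : State) (a : ℕ) (z v : ℤ) :
    (s.setInt a z v).reals = s.reals := rfl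

@[simp] theorem State.setReal_reals (s : State) (a b : ℕ) (z y : ℤ) (v : ℝ) :
    (s.setReal a z v).reals b y = if b = a ∧ y = z then v else s.reals b y := by
  by_cases h : b = a
  · subst h; by_cases h' : y = z <;> simp [State.setReal, h']
  · simp [State.setReal, h]

theorem State.setReal_reals_of_ne (s : State) {a b : ℕ} (z : ℤ) (v : ℝ) (h : b ≠ a) :
    (s.setReal a z v).reals b = s.reals b := by
  simp [State.setReal, h]

@[simp] theorem State.setReal_ints (s : State) (a : ℕ) (z : ℤ) (v : ℝ) :
    (s.setReal a z v).ints = s.ints := rfl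

/-- The program contains an assignment to the integer array `b`. -/
def Cmd.WritesInt : Cmd → ℕ → Prop
  | .skip, _ => False
  | .istore a _ _, b => b = a
  | .rstore _ _ _, _ => False
  | .seq p q, b => p.WritesInt b ∨ q.WritesInt b
  | .ite _ p q, b => p.WritesInt b ∨ q.WritesInt b
  | .while _ p, b => p.WritesInt b

/-- The program contains an assignment to the real array `b`. -/
def Cmd.WritesReal : Cmd → ℕ → Prop
  | .skip, _ => False
  | .istore _ _ _, _ => False
  | .rstore a _ _, b => b = a
  | .seq p q, b => p.WritesReal b ∨ q.WritesReal b
  | .ite _ p q, b => p.WritesReal b ∨ q.WritesReal b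
  | .while _ p, b => p.WritesReal b

/-- The states `s` and `s'` agree on all arrays to which `p` does not contain an assignment. -/
structure Frame (p : Cmd) (s s' : State) : Prop where
  ints : ∀ a, ¬ p.WritesInt a → s'.ints a = s.ints a
  reals : ∀ a, ¬ p.WritesReal a → s'.reals a = s.reals a

theorem Frame.refl (p : Cmd) (s : State) : Frame p s s := ⟨fun _ _ => rfl, fun _ _ => rfl⟩

theorem Frame.trans {p : Cmd} {s₁ s₂ s₃ : State} (h : Frame p s₁ s₂) (h' : Frame p s₂ s₃) :
    Frame p s₁ s₃ :=
  ⟨fun a ha => (h'.ints a ha).trans (h.ints a ha),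
    fun a ha => (h'.reals a ha).trans (h.reals a ha)⟩

theorem Frame.mono {p q : Cmd} {s s' : State} (h : Frame p s s')
    (hi : ∀ a, p.WritesInt a → q.WritesInt a) (hr : ∀ a, p.WritesReal a → q.WritesReal a) :
    Frame q s s' :=
  ⟨fun a ha => h.ints a fun h' => ha (hi a h'), fun a ha => h.reals a fun h' => ha (hr a h')⟩

theorem Exec.frame {p : Cmd} {s s' : State} {t : ℕ} (h : Exec p s t s') : Frame p s s' := by
  induction h with
  | skip s => exact Frame.refl _ _
  | istore a addr e s => exact ⟨fun b hb => State.setInt_ints_of_ne _ _ _ hb, fun b _ => rfl⟩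
  | rstore a addr e s => exact ⟨fun b _ => rfl, fun b hb => State.setReal_reals_of_ne _ _ _ hb⟩
  | seq _ _ h₁ h₂ =>
    exact (h₁.mono (fun _ => Or.inl) (fun _ => Or.inl)).trans
      (h₂.mono (fun _ => Or.inr) (fun _ => Or.inr))
  | ite_true _ _ h => exact h.mono (fun _ => Or.inl) (fun _ => Or.inl)
  | ite_false _ _ h => exact h.mono (fun _ => Or.inr) (fun _ => Or.inr)
  | while_true _ _ _ h₁ h₂ =>
    exact Frame.trans (h₁.mono (fun _ => id) (fun _ => id)) h₂
  | while_false _ => exact Frame.refl _ _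

/-- Started in the state `s`, the program `p` halts after at most `B` elementary operations in a
state with the property `Q`. -/
def Runs (p : Cmd) (s : State) (B : ℕ) (Q : State → Prop) : Prop :=
  ∃ t s', Exec p s t s' ∧ t ≤ B ∧ Q s'

theorem Runs.mono {p : Cmd} {s : State} {B B' : ℕ} {Q Q' : State → Prop} (h : Runs p s B Q)
    (hB : B ≤ B') (hQ : ∀ s', Frame p s s' → Q s' → Q' s') : Runs p s B' Q' := by
  obtain ⟨t, s', he, ht, hq⟩ := h
  exact ⟨t, s', he, ht.trans hB, hQ s' he.frame hq⟩

theorem Runs.skip {s : State} {Q : State → Prop} (h : Q s) : Runs .skip s 1 Q :=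
  ⟨1, s, .skip s, le_rfl, h⟩

theorem Runs.istore {s : State} {a : ℕ} {addr e : IExp} {Q : State → Prop}
    (h : Q (s.setInt a (addr.eval s) (e.eval s))) :
    Runs (.istore a addr e) s (1 + addr.cost + e.cost) Q :=
  ⟨_, _, .istore a addr e s, le_rfl, h⟩

theorem Runs.rstore {s : State} {a : ℕ} {addr : IExp} {e : RExp} {Q : State → Prop}
    (h : Q (s.setReal a (addr.eval s) (e.eval s))) :
    Runs (.rstore a addr e) s (1 + addr.cost + e.cost) Q :=
  ⟨_, _, .rstore a addr e s, le_rfl, h⟩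

theorem Runs.seq {p q : Cmd} {s : State} {B₁ B₂ : ℕ} {R Q : State → Prop}
    (h : Runs p s B₁ R) (h' : ∀ s', Frame p s s' → R s' → Runs q s' B₂ Q) :
    Runs (.seq p q) s (B₁ + B₂) Q := by
  obtain ⟨t, s', he, ht, hr⟩ := h
  obtain ⟨u, s'', he', hu, hq⟩ := h' s' he.frame hr
  exact ⟨_, _, .seq he he', Nat.add_le_add ht hu, hq⟩

theorem Runs.ite {b : Test} {p q : Cmd} {s : State} {B : ℕ} {Q : State → Prop}
    (h : b.Holds s → Runs p s B Q) (h' : ¬ b.Holds s → Runs q s B Q) :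
    Runs (.ite b p q) s (1 + b.cost + B) Q := by
  by_cases hb : b.Holds s
  · obtain ⟨t, s', he, ht, hq⟩ := h hb
    exact ⟨_, _, .ite_true hb he, by omega, hq⟩
  · obtain ⟨t, s', he, ht, hq⟩ := h' hb
    exact ⟨_, _, .ite_false hb he, by omega, hq⟩

/-- The rule for loops.  The first argument of the invariant `I` bounds the number of the
remaining iterations. -/
theorem Runs.while {b : Test} {p : Cmd} {B : ℕ} (I : ℕ → State → Prop) {s : State} {N : ℕ}
    (h₀ : ∀ s', Frame p s s' → I 0 s' → ¬ b.Holds s')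
    (h₁ : ∀ k s', Frame p s s' → I (k + 1) s' → b.Holds s' → Runs p s' B (I k))
    (hs : I N s) :
    Runs (.while b p) s (N * (1 + b.cost + B) + (1 + b.cost))
      (fun s' => ¬ b.Holds s' ∧ ∃ k ≤ N, I k s') := by
  suffices H : ∀ N s', Frame p s s' → I N s' →
      Runs (.while b p) s' (N * (1 + b.cost + B) + (1 + b.cost))
      (fun s'' => ¬ b.Holds s'' ∧ ∃ k ≤ N, I k s'') from H N s (Frame.refl _ _) hs
  intro N
  induction N with
  | zero =>
    intro s' hf hI
    exact ⟨_, s', .while_false (h₀ s' hf hI), by omega, h₀ s' hf hI, 0, le_rfl, hI⟩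
  | succ N ih =>
    intro s' hf hI
    by_cases hb : b.Holds s'
    · obtain ⟨t, s₂, he, ht, hI₂⟩ := h₁ N s' hf hI hb
      obtain ⟨u, s₃, he', hu, hn, k, hk, hI₃⟩ := ih s₂ (hf.trans he.frame) hI₂
      refine ⟨_, s₃, .while_true hb he he', ?_, hn, k, by omega, hI₃⟩
      rw [Nat.succ_mul]; omega
    · exact ⟨_, s', .while_false hb, by omega, hb, N + 1, le_rfl, hI⟩

/-- The integer variable `a`: cell `0` of the integer array `a`. -/
abbrev ivar (a : ℕ) : IExp := .load a (.const 0)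

/-- The real variable `a`: cell `0` of the real array `a`. -/
abbrev rvar (a : ℕ) : RExp := .load a (.const 0)

/-- Assignment to an integer variable. -/
abbrev iset (a : ℕ) (e : IExp) : Cmd := .istore a (.const 0) e

/-- Assignment to a real variable. -/
abbrev rset (a : ℕ) (e : RExp) : Cmd := .rstore a (.const 0) e

/-- The strict comparison of two integers. -/
abbrev Test.ilt (e f : IExp) : Test := .not (.ile f e)

/-- Execute `p` for the values `0, 1, …, e - 1` of the variable `v`. -/
def Cmd.for (v : ℕ) (e : IExp) (p : Cmd) : Cmd :=
  .seq (iset v (.const 0))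
    (.while (.ilt (ivar v) e) (.seq p (iset v (.add (ivar v) (.const 1)))))

theorem Cmd.for_writesInt (v : ℕ) (e : IExp) (p : Cmd) (a : ℕ) :
    (Cmd.for v e p).WritesInt a ↔ a = v ∨ p.WritesInt a := by
  simp only [Cmd.for, Cmd.WritesInt]; tauto

theorem Cmd.for_writesReal (v : ℕ) (e : IExp) (p : Cmd) (a : ℕ) :
    (Cmd.for v e p).WritesReal a ↔ p.WritesReal a := by
  simp [Cmd.for, Cmd.WritesReal]

/-- The rule for counting loops: `I k` holds before the iteration with the value `k` of the loop
variable. -/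
theorem Runs.for {v : ℕ} {e : IExp} {p : Cmd} {B N : ℕ} (I : ℕ → State → Prop) {s : State}
    (hs : I 0 (s.setInt v 0 0))
    (he : ∀ s', Frame (Cmd.for v e p) s s' → e.eval s' = N)
    (hp : ∀ k s', k < N → Frame (Cmd.for v e p) s s' → s'.ints v 0 = k → I k s' →
      Runs p s' B (fun s'' => s''.ints v 0 = k ∧ I (k + 1) (s''.setInt v 0 (k + 1)))) :
    Runs (Cmd.for v e p) s (N * (11 + e.cost + B) + (11 + e.cost)) (I N) := by
  have hf₀ : Frame (Cmd.for v e p) s (s.setInt v 0 0) :=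
    ⟨fun a ha => State.setInt_ints_of_ne _ _ _ (fun h => ha (by simp [Cmd.for_writesInt, h])),
      fun a _ => rfl⟩
  have key : Runs (.while (.ilt (ivar v) e) (.seq p (iset v (.add (ivar v) (.const 1)))))
      (s.setInt v 0 0) (N * (1 + (Test.ilt (ivar v) e).cost + (B + 6)) +
        (1 + (Test.ilt (ivar v) e).cost))
      (fun s' => ¬ (Test.ilt (ivar v) e).Holds s' ∧
        ∃ k ≤ N, (k ≤ N ∧ s'.ints v 0 = (N : ℤ) - k ∧ I (N - k) s')) := by
    have hfr : ∀ s', Frame (.seq p (iset v (.add (ivar v) (.const 1)))) (s.setInt v 0 0) s' →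
        Frame (Cmd.for v e p) s s' := fun s' hf => hf₀.trans (hf.mono
        (fun a ha => by simp [Cmd.for, Cmd.WritesInt] at ha ⊢; tauto)
        (fun a ha => by simp [Cmd.for, Cmd.WritesReal] at ha ⊢; tauto))
    apply Runs.while (I := fun k s' => k ≤ N ∧ s'.ints v 0 = (N : ℤ) - k ∧ I (N - k) s')
    · rintro s' hf ⟨-, h1, h2⟩
      simp [Test.Holds, IExp.eval, he s' (hfr s' hf), h1]
    · rintro k s' hf ⟨hk, h1, h2⟩ hb
      have := hp (N - (k + 1)) s' (by omega) (hfr s' hf)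
        (by rw [h1]; push_cast [Nat.cast_sub hk]; ring) h2
      refine (this.seq (B₂ := 6) ?_)
      intro s'' _ ⟨h3, h4⟩
      refine Runs.istore (addr := .const 0) (e := .add (ivar v) (.const 1)) ?_ |>.mono
        (by simp [IExp.cost]) (fun _ _ h => h)
      simp only [IExp.eval, h3]
      rw [show N - (k + 1) + 1 = N - k by omega] at h4
      have hc : ((N - (k + 1) : ℕ) : ℤ) + 1 = (N : ℤ) - k := by
        rw [Nat.cast_sub hk]; push_cast; ring
      rw [hc] at h4 ⊢
      exact ⟨by omega, by simp, h4⟩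
    · simpa using hs
  have hB : (Test.ilt (ivar v) e).cost = e.cost + 4 := by
    simp only [Test.cost, IExp.cost]; omega
  rw [hB] at key
  refine (Runs.seq (Runs.istore (Q := fun s' => s' = s.setInt v 0 0) rfl) (R := fun s' => _)
    (fun s' _ h => h ▸ key)).mono ?_ ?_
  · have : N * (1 + (e.cost + 4) + (B + 6)) ≤ N * (11 + e.cost + B) :=
      Nat.mul_le_mul_left _ (by omega)
    simp only [IExp.cost]; omega
  · rintro s' hf ⟨hb, k, -, hk, h1, h2⟩
    simp only [Test.Holds, IExp.eval, he s' hf, h1] at hb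
    obtain rfl : k = 0 := by omega
    exact h2

/-! ### Loop-free programs -/

/-- The program contains no loop. -/
def Cmd.LoopFree : Cmd → Prop
  | .skip => True
  | .istore _ _ _ => True
  | .rstore _ _ _ => True
  | .seq p q => p.LoopFree ∧ q.LoopFree
  | .ite _ p q => p.LoopFree ∧ q.LoopFree
  | .while _ _ => False

open Classical in
/-- The effect of a loop-free program. -/
noncomputable def Cmd.effect : Cmd → State → State
  | .skip, s => s
  | .istore a addr e, s => s.setInt a (addr.eval s) (e.eval s)
  | .rstore a addr e, s => s.setReal a (addr.eval s) (e.eval s)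
  | .seq p q, s => q.effect (p.effect s)
  | .ite b p q, s => if b.Holds s then p.effect s else q.effect s
  | .while _ _, s => s

theorem Cmd.effect_istore (a : ℕ) (addr e : IExp) (s : State) :
    (Cmd.istore a addr e).effect s = s.setInt a (addr.eval s) (e.eval s) := rfl

theorem Cmd.effect_rstore (a : ℕ) (addr : IExp) (e : RExp) (s : State) :
    (Cmd.rstore a addr e).effect s = s.setReal a (addr.eval s) (e.eval s) := rfl

theorem Cmd.effect_seq (p q : Cmd) (s : State) : (Cmd.seq p q).effect s = q.effect (p.effect s) :=
  rfl

theorem Cmd.effect_ite_of_holds {b : Test} {p q : Cmd} {s : State} (h : b.Holds s) :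
    (Cmd.ite b p q).effect s = p.effect s := if_pos h

theorem Cmd.effect_ite_of_not_holds {b : Test} {p q : Cmd} {s : State} (h : ¬ b.Holds s) :
    (Cmd.ite b p q).effect s = q.effect s := if_neg h

/-- A bound for the number of steps of a loop-free program. -/
def Cmd.maxCost : Cmd → ℕ
  | .skip => 1
  | .istore _ addr e => 1 + addr.cost + e.cost
  | .rstore _ addr e => 1 + addr.cost + e.cost
  | .seq p q => p.maxCost + q.maxCost
  | .ite b p q => 1 + b.cost + max p.maxCost q.maxCost
  | .while _ _ => 0

theorem Runs.effect {p : Cmd} {s : State} {Q : State → Prop} (hp : p.LoopFree)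
    (hQ : Q (p.effect s)) : Runs p s p.maxCost Q := by
  induction p generalizing s Q with
  | skip => exact .skip hQ
  | istore a addr e => exact .istore hQ
  | rstore a addr e => exact .rstore hQ
  | seq p q ihp ihq =>
    exact (ihp (Q := fun s' => s' = p.effect s) hp.1 rfl).seq fun s' _ h => ihq hp.2 (h ▸ hQ)
  | ite b p q ihp ihq =>
    refine Runs.ite (fun h => (ihp hp.1 ?_).mono (le_max_left _ _) fun _ _ => id)
      (fun h => (ihq hp.2 ?_).mono (le_max_right _ _) fun _ _ => id)
    · simpa only [Cmd.effect, if_pos h] using hQ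
    · simpa only [Cmd.effect, if_neg h] using hQ
  | _ => exact hp.elim

/-- The sequential composition of the programs `f x` for the members `x` of a list. -/
def Cmd.each {α : Type*} (f : α → Cmd) : List α → Cmd
  | [] => .skip
  | x :: l => .seq (f x) (Cmd.each f l)

theorem Cmd.each_writesInt {α : Type*} (f : α → Cmd) (l : List α) (a : ℕ) :
    (Cmd.each f l).WritesInt a ↔ ∃ x ∈ l, (f x).WritesInt a := by
  induction l with
  | nil => simp [Cmd.each, Cmd.WritesInt]
  | cons x l ih => simp [Cmd.each, Cmd.WritesInt, ih]

theorem Cmd.each_writesReal {α : Type*} (f : α → Cmd) (l : List α) (a : ℕ) :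
    (Cmd.each f l).WritesReal a ↔ ∃ x ∈ l, (f x).WritesReal a := by
  induction l with
  | nil => simp [Cmd.each, Cmd.WritesReal]
  | cons x l ih => simp [Cmd.each, Cmd.WritesReal, ih]

/-- The rule for `Cmd.each`: the invariant `I D` holds when the set of the members of the list
that have been treated is `D`. -/
theorem Runs.each {α : Type*} {f : α → Cmd} {B : ℕ} (I : Set α → State → Prop) {l : List α}
    {s : State} (hs : I ∅ s)
    (hf : ∀ x ∈ l, ∀ D s', Frame (Cmd.each f l) s s' → I D s' →
      Runs (f x) s' B (I (insert x D))) :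
    Runs (Cmd.each f l) s (l.length * B + 1) (I {x | x ∈ l}) := by
  suffices H : ∀ (l' : List α) (D : Set α) (s' : State), l' ⊆ l → Frame (Cmd.each f l) s s' →
      I D s' → Runs (Cmd.each f l') s' (l'.length * B + 1) (I (D ∪ {x | x ∈ l'})) by
    simpa using H l ∅ s (List.Subset.refl _) (Frame.refl _ _) hs
  intro l'
  induction l' with
  | nil =>
    intro D s' _ _ hI
    refine (Runs.skip hI).mono (by simp) fun _ _ h => by simpa using h
  | cons x l' ih =>
    intro D s' hl hfr hI
    have hx : x ∈ l := hl (by simp)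
    refine ((hf x hx D s' hfr hI).seq fun s'' hfr' hI' =>
      ih (insert x D) s'' (fun y hy => hl (by simp [hy])) (hfr.trans (hfr'.mono ?_ ?_)) hI').mono
      ?_ ?_
    · intro a ha; exact (Cmd.each_writesInt _ _ _).2 ⟨x, hx, ha⟩
    · intro a ha; exact (Cmd.each_writesReal _ _ _).2 ⟨x, hx, ha⟩
    · rw [List.length_cons, Nat.succ_mul]; omega
    · intro s'' _ h
      convert h using 1
      ext y; simp only [List.mem_cons, Set.mem_union, Set.mem_insert_iff, Set.mem_ofPred_eq]; tauto

end RealRAM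

namespace LBC

/-! ### Optimal solutions -/

section Price

variable {d n : ℕ} (P : Fin n → EuclideanSpace ℝ (Fin d))

theorem dist_le_price (f : Fin n → Fin n) (i : Fin n) : dist (P i) (P (f i)) ≤ price P f :=
  le_ciSup (f := fun i => dist (P i) (P (f i))) (Set.finite_range _).bddAbove i

theorem exists_price_eq (f : Fin n → Fin n) (hn : 0 < n) :
    ∃ i, price P f = dist (P i) (P (f i)) := by
  have : Nonempty (Fin n) := ⟨⟨0, hn⟩⟩
  obtain ⟨i, hi⟩ := exists_eq_ciSup_of_finite (f := fun i => dist (P i) (P (f i)))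
  exact ⟨i, hi.symm⟩

theorem price_nonneg (f : Fin n → Fin n) : 0 ≤ price P f :=
  Real.iSup_nonneg fun _ => dist_nonneg

/-- The set of the prices of all solutions. -/
def prices (lam : ℕ) : Set ℝ :=
  {r | ∃ (C : Finset (Fin n)) (f : Fin n → Fin n), IsSolution lam C f ∧ r = price P f}

theorem optPrice_nonneg (lam : ℕ) : 0 ≤ optPrice P lam :=
  Real.sInf_nonneg fun _ ⟨_, f, _, hr⟩ => hr ▸ price_nonneg P f

theorem exists_price_eq_optPrice {lam : ℕ} (h₀ : 0 < n) (hn : lam ≤ n) :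
    ∃ (C : Finset (Fin n)) (f : Fin n → Fin n), IsSolution lam C f ∧ price P f = optPrice P lam := by
  have hfin : (prices P lam).Finite := by
    refine (Set.finite_range (price P)).subset ?_
    rintro r ⟨_, f, _, rfl⟩
    exact ⟨f, rfl⟩
  have hne : (prices P lam).Nonempty := by
    refine ⟨_, {⟨0, h₀⟩}, fun _ => ⟨0, h₀⟩, ⟨by simp, ?_⟩, rfl⟩
    simpa using hn
  obtain ⟨C, f, hs, hr⟩ := hne.csInf_mem hfin
  exact ⟨C, f, hs, hr.symm⟩

/-- If every center has to serve two points, then the optimal price is the distance of two distinct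
points. -/
theorem exists_optPrice_eq_dist {lam : ℕ} (hP : Function.Injective P) (h₂ : 2 ≤ lam)
    (hn : lam ≤ n) :
    0 < optPrice P lam ∧ ∃ p q, optPrice P lam = dist (P p) (P q) := by
  obtain ⟨C, f, ⟨hC, hl⟩, hr⟩ := exists_price_eq_optPrice P (lam := lam) (by omega) hn
  refine ⟨?_, ?_⟩
  · by_contra! h
    have hfix : ∀ i, f i = i := fun i => by
      have := (dist_le_price P f i).trans (hr.le.trans h)
      exact (hP (dist_le_zero.1 this)).symm
    have h1 := hl _ (hC ⟨0, by omega⟩)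
    simp only [hfix, Finset.filter_eq', Finset.mem_univ, if_true, Finset.card_singleton] at h1
    omega
  · obtain ⟨i, hi⟩ := exists_price_eq P f (by omega)
    exact ⟨i, f i, hr ▸ hi⟩

/-- If the points of `C` have distances greater than `4 r`, then in the assignment to nearest points
of `C` all points at distance at most `2 r` from `c` are assigned to `c`.  If `r` is at least the
optimal price, then there are at least `lam` of them: the points which share with `c` the center in
an optimal solution. -/
theorem card_cluster_ge {lam : ℕ} (hn : lam ≤ n) {r : ℝ} (hr : optPrice P lam ≤ r)
    {C : Finset (Fin n)} {f : Fin n → Fin n}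
    (hsep : ∀ c ∈ C, ∀ c' ∈ C, c ≠ c' → 4 * r < dist (P c) (P c'))
    (hf : ∀ i, f i ∈ C) (hnear : ∀ i, ∀ c ∈ C, dist (P i) (P (f i)) ≤ dist (P i) (P c))
    {c : Fin n} (hc : c ∈ C) : lam ≤ (Finset.univ.filter (fun i => f i = c)).card := by
  obtain ⟨C', g, ⟨hC', hl⟩, hg⟩ :=
    exists_price_eq_optPrice P (lam := lam) (c.pos) hn
  refine (hl (g c) (hC' c)).trans (Finset.card_le_card ?_)
  intro i hi
  simp only [Finset.mem_filter, Finset.mem_univ, true_and] at hi ⊢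
  by_contra hne
  have h1 := hsep _ (hf i) c hc hne
  have h2 := hnear i c hc
  have h3 : dist (P i) (P c) ≤ 2 * r := by
    have hi' := dist_le_price P g i
    have hc' := dist_le_price P g c
    rw [hi] at hi'
    have := dist_triangle_right (P i) (P c) (P (g c))
    linarith
  have := dist_triangle_left (P (f i)) (P c) (P i)
  linarith

end Price

/-! ### Candidates for the optimal price -/

/-- Two elements of a sorted list of length `N` differ by at most `N` times the largest gap between
them. -/
theorem exists_gap {N : ℕ} {S : ℕ → ℝ} {u v : ℕ} (huv : u < v) (hv : v < N)
    (hS : ∀ a b, a ≤ b → b < N → S a ≤ S b) :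
    ∃ t, t + 1 < N ∧ S (t + 1) - S t ≤ S v - S u ∧ S v - S u ≤ N * (S (t + 1) - S t) := by
  have hsum : ∑ t ∈ Finset.Ico u v, (S (t + 1) - S t) = S v - S u :=
    Finset.sum_Ico_sub _ huv.le
  obtain ⟨t, ht, hmax⟩ := Finset.exists_max_image (Finset.Ico u v) (fun t => S (t + 1) - S t)
    ⟨u, by simp [huv]⟩
  rw [Finset.mem_Ico] at ht
  refine ⟨t, by omega, ?_, ?_⟩
  · have h1 := hS u t ht.1 (by omega)
    have h2 := hS (t + 1) v ht.2 hv
    linarith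
  · have h1 := Finset.sum_le_card_nsmul _ _ _ hmax
    rw [hsum, Nat.card_Ico, nsmul_eq_mul] at h1
    refine h1.trans (mul_le_mul_of_nonneg_right ?_ ?_)
    · exact_mod_cast (by omega : v - u ≤ N)
    · have := hS t (t + 1) (by omega) (by omega); linarith

/-- The distance of two points is at most `d` times the largest difference of their coordinates,
and at least this difference. -/
theorem exists_coord_dist {d : ℕ} (x y : EuclideanSpace ℝ (Fin d)) (h : 0 < dist x y) :
    ∃ j, 0 < |x j - y j| ∧ |x j - y j| ≤ dist x y ∧ dist x y ≤ d * |x j - y j| := by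
  have hd : 0 < d := by
    rcases Nat.eq_zero_or_pos d with rfl | h'
    · simp [Subsingleton.elim x y] at h
    · exact h'
  obtain ⟨j, -, hj⟩ := Finset.exists_max_image Finset.univ (fun j => |x j - y j|)
    ⟨⟨0, hd⟩, Finset.mem_univ _⟩
  have h1 : dist x y ≤ d * |x j - y j| := by
    rw [EuclideanSpace.dist_eq]
    refine Real.sqrt_le_iff.2 ⟨by positivity, ?_⟩
    calc ∑ i, dist (x i) (y i) ^ 2 ≤ ∑ _i : Fin d, |x j - y j| ^ 2 :=
          Finset.sum_le_sum fun i hi => by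
            rw [Real.dist_eq]; exact pow_le_pow_left₀ (abs_nonneg _) (hj i hi) 2
      _ = d * |x j - y j| ^ 2 := by simp
      _ ≤ (d * |x j - y j|) ^ 2 := by
        rw [mul_pow]
        refine mul_le_mul_of_nonneg_right ?_ (sq_nonneg _)
        have : (1 : ℝ) ≤ d := by exact_mod_cast hd
        nlinarith
  refine ⟨j, ?_, ?_, h1⟩
  · by_contra! h'
    have : |x j - y j| = 0 := le_antisymm h' (abs_nonneg _)
    rw [this] at h1; linarith
  · rw [EuclideanSpace.dist_eq, ← Real.dist_eq]
    refine Real.le_sqrt_of_sq_le ?_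
    exact Finset.single_le_sum (f := fun i => dist (x i) (y i) ^ 2) (fun _ _ => sq_nonneg _)
      (Finset.mem_univ j)

/-- If a sorted list contains all coordinates of two points, then their distance is approximated up
to the factor `d * N` by a gap between neighbors in the list. -/
theorem exists_gap_dist {d N : ℕ} {S : ℕ → ℝ} (hS : ∀ a b, a ≤ b → b < N → S a ≤ S b)
    (x y : EuclideanSpace ℝ (Fin d)) (h : 0 < dist x y)
    (hx : ∀ j, ∃ u < N, S u = x j) (hy : ∀ j, ∃ u < N, S u = y j) :
    ∃ t, t + 1 < N ∧ 0 < S (t + 1) - S t ∧ S (t + 1) - S t ≤ dist x y ∧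
      dist x y ≤ d * N * (S (t + 1) - S t) := by
  obtain ⟨j, h0, h1, h2⟩ := exists_coord_dist x y h
  have key : ∃ t, t + 1 < N ∧ S (t + 1) - S t ≤ |x j - y j| ∧
      |x j - y j| ≤ N * (S (t + 1) - S t) := by
    obtain ⟨u, hu, hux⟩ := hx j
    obtain ⟨v, hv, hvy⟩ := hy j
    rcases lt_trichotomy u v with huv | rfl | huv
    · have h3 := hS u v huv.le hv
      rw [hux, hvy] at h3
      have h4 : |x j - y j| = S v - S u := by
        rw [hux, hvy, abs_of_nonpos (by linarith)]; ring
      rw [h4]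
      exact exists_gap huv hv hS
    · rw [← hux, ← hvy] at h0; simp at h0
    · have h3 := hS v u huv.le hu
      rw [hux, hvy] at h3
      have h4 : |x j - y j| = S u - S v := by
        rw [hux, hvy, abs_of_nonneg (by linarith)]
      rw [h4]
      exact exists_gap huv hu hS
  obtain ⟨t, ht, h3, h4⟩ := key
  refine ⟨t, ht, ?_, h3.trans h1, h2.trans ?_⟩
  · by_contra! h5
    have : (N : ℝ) * (S (t + 1) - S t) ≤ 0 := mul_nonpos_of_nonneg_of_nonpos (by positivity) h5
    linarith
  · rw [mul_assoc]
    exact mul_le_mul_of_nonneg_left h4 (by positivity)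

/-! ### Grid cells -/

/-- An injective polynomial encoding of the vectors `(z 0, …, z (m - 1))` of integers by
nonnegative integers.  It rests on the injections `z ↦ 2 z ^ 2 + z` of `ℤ` into `ℕ` and
`(a, b) ↦ (a + b) ^ 2 + b` of `ℕ × ℕ` into `ℕ`. -/
def encode : ℕ → (ℕ → ℤ) → ℤ
  | 0, _ => 0
  | m + 1, z => (encode m z + z m * (2 * z m + 1)) * (encode m z + z m * (2 * z m + 1)) +
      z m * (2 * z m + 1)

theorem mul_two_mul_add_one_nonneg (z : ℤ) : 0 ≤ z * (2 * z + 1) := by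
  rcases le_or_gt 0 z with h | h
  · positivity
  · exact mul_nonneg_of_nonpos_of_nonpos h.le (by omega)

theorem encode_nonneg (m : ℕ) (z : ℕ → ℤ) : 0 ≤ encode m z := by
  cases m with
  | zero => exact le_rfl
  | succ m => exact add_nonneg (mul_self_nonneg _) (mul_two_mul_add_one_nonneg _)

theorem encode_congr {m : ℕ} {z z' : ℕ → ℤ} (h : ∀ j < m, z j = z' j) :
    encode m z = encode m z' := by
  induction m with
  | zero => rfl
  | succ m ih => simp only [encode, ih fun j hj => h j (by omega), h m (by omega)]

theorem encode_inj {m : ℕ} {z z' : ℕ → ℤ} (h : encode m z = encode m z') :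
    ∀ j < m, z j = z' j := by
  induction m with
  | zero => intro j hj; omega
  | succ m ih =>
    simp only [encode] at h
    have ha := encode_nonneg m z
    have ha' := encode_nonneg m z'
    have hb := mul_two_mul_add_one_nonneg (z m)
    have hb' := mul_two_mul_add_one_nonneg (z' m)
    set a := encode m z
    set a' := encode m z'
    set b := z m * (2 * z m + 1) with hbdef
    set b' := z' m * (2 * z' m + 1) with hbdef'
    have hsum : a + b = a' + b' := by
      rcases lt_trichotomy (a + b) (a' + b') with hlt | heq | hlt
      · nlinarith
      · exact heq
      · nlinarith
    have hbb : b = b' := by rw [hsum] at h; linarith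
    have hz : z m = z' m := by
      have h1 : (z m - z' m) * (2 * (z m + z' m) + 1) = 0 := by
        have : z m * (2 * z m + 1) = z' m * (2 * z' m + 1) := hbb
        linear_combination this
      rcases mul_eq_zero.1 h1 with h2 | h2 <;> omega
    intro j hj
    rcases Nat.lt_succ_iff_lt_or_eq.1 hj with hj | rfl
    · exact ih (by omega) j hj
    · exact hz

/-- The squared distance of the points number `i` and `k`, if `X j i` is the `j`-th coordinate of
the `i`-th point. -/
def sqDist (d : ℕ) (X : ℕ → ℕ → ℝ) (i k : ℕ) : ℝ := ∑ j ∈ Finset.range d, (X j i - X j k) ^ 2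

/-- The index of the grid cell of the `i`-th point, for cells with sides of length `1 / W`. -/
noncomputable def cell (X : ℕ → ℕ → ℝ) (W : ℝ) (i j : ℕ) : ℤ := ⌊X j i * W⌋

theorem sqDist_comm (d : ℕ) (X : ℕ → ℕ → ℝ) (i k : ℕ) : sqDist d X i k = sqDist d X k i :=
  Finset.sum_congr rfl fun _ _ => by ring

theorem sqDist_self (d : ℕ) (X : ℕ → ℕ → ℝ) (i : ℕ) : sqDist d X i i = 0 := by
  simp [sqDist]

/-- Points of the same cell are close. -/
theorem sqDist_le_of_cell_eq {d : ℕ} (hd : 0 < d) {X : ℕ → ℕ → ℝ} {ρ : ℝ} (hρ : 0 < ρ) {i k : ℕ}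
    (h : ∀ j < d, cell X (d / ρ) i j = cell X (d / ρ) k j) : sqDist d X i k ≤ ρ ^ 2 := by
  have hd' : (1 : ℝ) ≤ d := by exact_mod_cast hd
  have h1 : ∀ j ∈ Finset.range d, (X j i - X j k) ^ 2 ≤ (ρ / d) ^ 2 := by
    intro j hj
    have h2 := Int.abs_sub_lt_one_of_floor_eq_floor (h j (Finset.mem_range.1 hj))
    rw [← sub_mul, abs_mul, abs_of_pos (by positivity : (0 : ℝ) < d / ρ)] at h2
    have h3 : |X j i - X j k| ≤ ρ / d := by
      rw [le_div_iff₀ (by positivity)]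
      rw [mul_div_assoc', div_lt_one hρ] at h2
      exact h2.le
    rw [← sq_abs]
    exact pow_le_pow_left₀ (abs_nonneg _) h3 2
  calc sqDist d X i k ≤ ∑ j ∈ Finset.range d, (ρ / d) ^ 2 := Finset.sum_le_sum h1
    _ = ρ ^ 2 / d := by
      rw [Finset.sum_const, Finset.card_range, nsmul_eq_mul]; field_simp
    _ ≤ ρ ^ 2 := div_le_self (sq_nonneg _) hd'

/-- The cells of close points are close. -/
theorem cell_sub_le {d : ℕ} {X : ℕ → ℕ → ℝ} {ρ : ℝ} (hρ : 0 < ρ) {i k : ℕ}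
    (h : sqDist d X i k ≤ ρ ^ 2) {j : ℕ} (hj : j < d) :
    cell X (d / ρ) k j - cell X (d / ρ) i j ≤ d := by
  have h1 : (X j k - X j i) ^ 2 ≤ ρ ^ 2 := by
    refine le_trans ?_ h
    rw [sqDist_comm]
    exact Finset.single_le_sum (f := fun j => (X j k - X j i) ^ 2) (fun _ _ => sq_nonneg _)
      (Finset.mem_range.2 hj)
  have h2 : X j k - X j i ≤ ρ := by
    have := abs_le_of_sq_le_sq h1 hρ.le
    exact (abs_le.1 this).2
  have h3 : X j k * (d / ρ) ≤ X j i * (d / ρ) + (d : ℤ) := by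
    have : (X j k - X j i) * (d / ρ) ≤ ρ * (d / ρ) :=
      mul_le_mul_of_nonneg_right h2 (by positivity)
    rw [mul_div_cancel₀ _ hρ.ne'] at this
    push_cast
    linarith
  have h4 := Int.floor_le_floor h3
  rw [Int.floor_add_intCast] at h4
  simp only [cell]
  omega

end LBC

namespace RealRAM

open LBC

/-! ### Merge sort -/

/-- The cells `x, …, x + m - 1` of an array hold a nondecreasing sequence. -/
def SortedOn (S : ℤ → ℝ) (x : ℤ) (m : ℕ) : Prop :=
  ∀ u v : ℕ, u ≤ v → v < m → S (x + u) ≤ S (x + v)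

/-- The state of the merging of the sorted blocks of length `w` at the addresses `x₁` and `x₂` into
the block at the address `y`: from these blocks the first `i`, respectively `j`, elements have been
moved.  The original contents of the array is `S`, the current contents is `S'`. -/
structure MergeInv (S : ℤ → ℝ) (x₁ x₂ y : ℤ) (w : ℕ) (S' : ℤ → ℝ) (i j : ℕ) : Prop where
  le₁ : i ≤ w
  le₂ : j ≤ w
  outside : ∀ z, z < y ∨ y + (i + j : ℕ) ≤ z → S' z = S z
  sorted : SortedOn S' y (i + j)
  bound₁ : i < w → ∀ u < i + j, S' (y + (u : ℕ)) ≤ S (x₁ + i)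
  bound₂ : j < w → ∀ u < i + j, S' (y + (u : ℕ)) ≤ S (x₂ + j)
  moved₁ : ∀ k < i, ∃ u < i + j, S' (y + (u : ℕ)) = S (x₁ + (k : ℕ))
  moved₂ : ∀ k < j, ∃ u < i + j, S' (y + (u : ℕ)) = S (x₂ + (k : ℕ))

section MergeInv

variable {S S' : ℤ → ℝ} {x₁ x₂ y : ℤ} {w i j : ℕ}

theorem MergeInv.start : MergeInv S x₁ x₂ y w S 0 0 :=
  ⟨by omega, by omega, fun _ _ => rfl, fun _ _ _ _ => by omega, fun _ _ _ => by omega,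
    fun _ _ _ => by omega, fun _ _ => by omega, fun _ _ => by omega⟩

theorem MergeInv.swap (h : MergeInv S x₁ x₂ y w S' i j) : MergeInv S x₂ x₁ y w S' j i := by
  obtain ⟨h1, h2, h3, h4, h5, h6, h7, h8⟩ := h
  rw [Nat.add_comm] at h3 h4
  rw [Nat.add_comm i j] at h5 h6 h7 h8
  exact ⟨h2, h1, h3, h4, h6, h5, h8, h7⟩

theorem MergeInv.step (h : MergeInv S x₁ x₂ y w S' i j) (hi : i < w)
    (hsort : SortedOn S x₁ w) (hle : j < w → S (x₁ + i) ≤ S (x₂ + j)) :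
    MergeInv S x₁ x₂ y w (Function.update S' (y + (i + j : ℕ)) (S (x₁ + i))) (i + 1) j := by
  have hlt : ∀ u : ℕ, u < i + j → Function.update S' (y + (i + j : ℕ)) (S (x₁ + i)) (y + (u : ℕ)) =
      S' (y + (u : ℕ)) := fun u hu => Function.update_of_ne (by omega) _ _
  have hlast : Function.update S' (y + (i + j : ℕ)) (S (x₁ + i)) (y + (i + j : ℕ)) = S (x₁ + i) :=
    Function.update_self _ _ _
  refine ⟨hi, h.le₂, ?_, ?_, ?_, ?_, ?_, ?_⟩
  · intro z hz
    rw [Function.update_of_ne (by omega)]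
    exact h.outside z (by omega)
  · intro u v huv hv
    rcases Nat.lt_or_ge v (i + j) with hv' | hv'
    · rw [hlt u (by omega), hlt v hv']; exact h.sorted u v huv hv'
    · obtain rfl : v = i + j := by omega
      rw [hlast]
      rcases Nat.lt_or_ge u (i + j) with hu' | hu'
      · rw [hlt u hu']; exact h.bound₁ hi u hu'
      · obtain rfl : u = i + j := by omega
        rw [hlast]
  · intro hi' u hu
    have hs := hsort i (i + 1) (by omega) hi'
    rcases Nat.lt_or_ge u (i + j) with hu' | hu'
    · rw [hlt u hu']; exact (h.bound₁ hi u hu').trans hs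
    · obtain rfl : u = i + j := by omega
      rw [hlast]; exact hs
  · intro hj u hu
    rcases Nat.lt_or_ge u (i + j) with hu' | hu'
    · rw [hlt u hu']; exact h.bound₂ hj u hu'
    · obtain rfl : u = i + j := by omega
      rw [hlast]; exact hle hj
  · intro k hk
    rcases Nat.lt_or_ge k i with hk' | hk'
    · obtain ⟨u, hu, he⟩ := h.moved₁ k hk'
      exact ⟨u, by omega, by rw [hlt u hu, he]⟩
    · obtain rfl : k = i := by omega
      exact ⟨k + j, by omega, hlast⟩
  · intro k hk
    obtain ⟨u, hu, he⟩ := h.moved₂ k hk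
    exact ⟨u, by omega, by rw [hlt u hu, he]⟩

end MergeInv

/-- One step of the merging: move the smaller one of the first elements of the two blocks.
The variables `14`, …, `20` hold the length of the array, the length of the blocks, the address of
the array, the offset of the first block, the number of the moved elements, and the numbers of the
elements moved from the first and from the second block. -/
def mergeStep (a : ℕ) : Cmd :=
  .ite
    (.and (.ilt (ivar 19) (ivar 15)) (.not (.and (.ilt (ivar 20) (ivar 15))
      (.not (.rle (.load a (.add (.add (ivar 16) (ivar 17)) (ivar 19)))
        (.load a (.add (.add (.add (ivar 16) (ivar 17)) (ivar 15)) (ivar 20))))))))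
    (.seq
      (.rstore a (.add (.add (.add (ivar 16) (ivar 17)) (ivar 14)) (ivar 18))
        (.load a (.add (.add (ivar 16) (ivar 17)) (ivar 19))))
      (iset 19 (.add (ivar 19) (.const 1))))
    (.seq
      (.rstore a (.add (.add (.add (ivar 16) (ivar 17)) (ivar 14)) (ivar 18))
        (.load a (.add (.add (.add (ivar 16) (ivar 17)) (ivar 15)) (ivar 20))))
      (iset 20 (.add (ivar 20) (.const 1))))

/-- Merge two blocks. -/
def mergeBlocks (a : ℕ) : Cmd :=
  .seq (iset 19 (.const 0)) (.seq (iset 20 (.const 0))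
    (.for 18 (.add (ivar 15) (ivar 15)) (mergeStep a)))

/-- Merge all pairs of neighboring blocks. -/
def mergePass (a : ℕ) : Cmd :=
  .seq (iset 17 (.const 0)) (.while (.ilt (ivar 17) (ivar 14))
    (.seq (mergeBlocks a) (iset 17 (.add (ivar 17) (.add (ivar 15) (ivar 15))))))

/-- Merge sort for the cells `0, …, N - 1` of the real array `a`, where `N`, the value of the
variable `14`, is a power of two.  Every pass moves the elements by `N` cells.  At the end the
sorted sequence starts at the address in the variable `16`. -/
def mergeSort (a : ℕ) : Cmd :=
  .seq (iset 15 (.const 1)) (.seq (iset 16 (.const 0)) (.while (.ilt (ivar 15) (ivar 14))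
    (.seq (mergePass a) (.seq (iset 16 (.add (ivar 16) (ivar 14)))
      (iset 15 (.add (ivar 15) (ivar 15)))))))

theorem mergeBlocks_spec (a : ℕ) : ∃ c, ∀ (s : State) (w : ℕ) (b lo N : ℤ), 0 < w →
    s.ints 14 0 = N → s.ints 15 0 = w → s.ints 16 0 = b → s.ints 17 0 = lo →
    0 ≤ lo → lo + 2 * w ≤ N →
    SortedOn (s.reals a) (b + lo) w → SortedOn (s.reals a) (b + lo + w) w →
    Runs (mergeBlocks a) s (c * w) (fun s' =>
      SortedOn (s'.reals a) (b + lo + N) (2 * w) ∧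
      (∀ u < 2 * w, ∃ v < 2 * w,
        s'.reals a (b + lo + N + (v : ℕ)) = s.reals a (b + lo + (u : ℕ))) ∧
      ∀ z, z < b + lo + N ∨ b + lo + N + 2 * w ≤ z → s'.reals a z = s.reals a z) := by
  refine ⟨2 * (11 + 5 + (mergeStep a).maxCost) + (11 + 5) + 3 + 3, ?_⟩
  intro s w b lo N hw h14 h15 h16 h17 hlo hN hs1 hs2
  set x := b + lo with hx
  set S := s.reals a with hS
  have key : Runs (.for 18 (.add (ivar 15) (ivar 15)) (mergeStep a))
      ((s.setInt 19 0 0).setInt 20 0 0)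
      (2 * w * (11 + 5 + (mergeStep a).maxCost) + (11 + 5))
      (fun s' => ∃ i j, i + j = 2 * w ∧ s'.ints 19 0 = (i : ℕ) ∧ s'.ints 20 0 = (j : ℕ) ∧
        MergeInv S x (x + w) (x + N) w (s'.reals a) i j) := by
    refine Runs.for (N := 2 * w) (fun t s' => ∃ i j, i + j = t ∧ s'.ints 19 0 = (i : ℕ) ∧
      s'.ints 20 0 = (j : ℕ) ∧ MergeInv S x (x + w) (x + N) w (s'.reals a) i j) ?_ ?_ ?_
    · exact ⟨0, 0, rfl, by simp, by simp, by simpa using MergeInv.start⟩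
    · intro s' hf
      have h : s'.ints 15 = s.ints 15 := by
        rw [hf.ints 15 (by simp [Cmd.for_writesInt, mergeStep, Cmd.WritesInt])]
        funext z; simp
      simp [IExp.eval, h, h15]; ring
    · rintro t s' ht hf h18 ⟨i, j, hij, h19, h20, hI⟩
      have hv : ∀ v ∈ [14, 15, 16, 17], s'.ints v = s.ints v := by
        intro v hv
        rw [hf.ints v (by
          simp only [List.mem_cons, List.not_mem_nil, or_false] at hv
          rcases hv with rfl | rfl | rfl | rfl <;>
            simp [Cmd.for_writesInt, mergeStep, Cmd.WritesInt])]
        simp only [List.mem_cons, List.not_mem_nil, or_false] at hv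
        funext z
        rcases hv with rfl | rfl | rfl | rfl <;> simp
      have g14 : s'.ints 14 0 = N := by rw [hv 14 (by simp), h14]
      have g15 : s'.ints 15 0 = w := by rw [hv 15 (by simp), h15]
      have g16 : s'.ints 16 0 = b := by rw [hv 16 (by simp), h16]
      have g17 : s'.ints 17 0 = lo := by rw [hv 17 (by simp), h17]
      have e1 : i < w → s'.reals a (b + lo + i) = S (x + i) := fun h =>
        hI.outside _ (by left; omega)
      have e2 : j < w → s'.reals a (b + lo + w + j) = S (x + w + j) := fun h =>
        hI.outside _ (by left; omega)
      refine Runs.effect (by simp [mergeStep, Cmd.LoopFree]) ?_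
      by_cases hT : i < w ∧ (j < w → S (x + i) ≤ S (x + w + j))
      · have hst := hI.step hT.1 hs1 hT.2
        have hcond : i < w ∧ (j < w →
            s'.reals a (b + lo + i) ≤ s'.reals a (b + lo + w + j)) :=
          ⟨hT.1, fun h => by rw [e1 hT.1, e2 h]; exact hT.2 h⟩
        have hcond' : Test.Holds s' (.and (.ilt (ivar 19) (ivar 15)) (.not (.and
            (.ilt (ivar 20) (ivar 15))
            (.not (.rle (.load a (.add (.add (ivar 16) (ivar 17)) (ivar 19)))
            (.load a (.add (.add (.add (ivar 16) (ivar 17)) (ivar 15)) (ivar 20)))))))) := by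
          simpa [Test.Holds, IExp.eval, RExp.eval, g14, g15, g16, g17, h18, h19, h20] using hcond
        simp only [mergeStep, Cmd.effect, if_pos hcond']
        refine ⟨by simpa using h18, i + 1, j, by omega, ?_, ?_, ?_⟩
        · simp [IExp.eval, h19]
        · simp [h20]
        · convert hst using 1
          funext z
          simp [IExp.eval, RExp.eval, g14, g16, g17, h18, h19, Function.update_apply,
            e1 hT.1, ← hij, hx]
      · have hcond' : ¬ Test.Holds s' (.and (.ilt (ivar 19) (ivar 15)) (.not (.and
            (.ilt (ivar 20) (ivar 15))
            (.not (.rle (.load a (.add (.add (ivar 16) (ivar 17)) (ivar 19)))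
            (.load a (.add (.add (.add (ivar 16) (ivar 17)) (ivar 15)) (ivar 20)))))))) := by
          intro hh
          have hcond : i < w ∧ (j < w →
              s'.reals a (b + lo + i) ≤ s'.reals a (b + lo + w + j)) := by
            simpa [Test.Holds, IExp.eval, RExp.eval, g14, g15, g16, g17, h18, h19, h20] using hh
          exact hT ⟨hcond.1, fun h => by rw [← e1 hcond.1, ← e2 h]; exact hcond.2 h⟩
        have hjw : j < w := by
          by_contra hjw
          have := hI.le₁
          exact hT ⟨by omega, fun h => by omega⟩
        have hle : i < w → S (x + w + j) ≤ S (x + i) := by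
          intro hi
          by_contra hh
          exact hT ⟨hi, fun _ => (not_le.1 hh).le⟩
        have hst := (hI.swap.step hjw hs2 hle).swap
        simp only [mergeStep, Cmd.effect, if_neg hcond']
        refine ⟨by simpa using h18, i, j + 1, by omega, ?_, ?_, ?_⟩
        · simp [h19]
        · simp [IExp.eval, h20]
        · convert hst using 1
          funext z
          simp [IExp.eval, RExp.eval, g14, g15, g16, g17, h18, h20, Function.update_apply,
            e2 hjw, ← hij, hx, add_comm (j : ℤ)]
  refine (Runs.seq (R := fun s' => s' = s.setInt 19 0 0)
    (Runs.istore rfl) fun s' _ h => Runs.seq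
    (R := fun s' => s' = (s.setInt 19 0 0).setInt 20 0 0) (Runs.istore (by rw [h]; rfl))
    fun s' _ h => h ▸ key).mono ?_ ?_
  · simp only [IExp.cost]
    nlinarith
  · rintro s' - ⟨i, j, hij, -, -, hI⟩
    have hi : i = w := by have := hI.le₁; have := hI.le₂; omega
    have hj : j = w := by have := hI.le₁; have := hI.le₂; omega
    subst hi hj
    refine ⟨by rw [← hij]; exact hI.sorted, ?_, ?_⟩
    · intro u hu
      rcases Nat.lt_or_ge u j with h | h
      · obtain ⟨v, hv, he⟩ := hI.moved₁ u h
        exact ⟨v, by omega, he⟩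
      · obtain ⟨v, hv, he⟩ := hI.moved₂ (u - j) (by omega)
        refine ⟨v, by omega, he.trans ?_⟩
        congr 1; omega
    · intro z hz
      exact hI.outside z (by push_cast; omega)

theorem mergeBlocks_writesInt (a v : ℕ) :
    (mergeBlocks a).WritesInt v ↔ v = 18 ∨ v = 19 ∨ v = 20 := by
  simp only [mergeBlocks, Cmd.WritesInt, Cmd.for_writesInt, mergeStep]; tauto

theorem mergeBlocks_writesReal (a v : ℕ) : (mergeBlocks a).WritesReal v ↔ v = a := by
  simp only [mergeBlocks, Cmd.WritesReal, Cmd.for_writesReal, mergeStep]; tauto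

theorem mergePass_writesInt (a v : ℕ) :
    (mergePass a).WritesInt v ↔ v = 17 ∨ v = 18 ∨ v = 19 ∨ v = 20 := by
  simp only [mergePass, Cmd.WritesInt, mergeBlocks_writesInt]; tauto

theorem mergePass_writesReal (a v : ℕ) : (mergePass a).WritesReal v ↔ v = a := by
  simp only [mergePass, Cmd.WritesReal, mergeBlocks_writesReal]; tauto

theorem mergeSort_writesInt (a v : ℕ) :
    (mergeSort a).WritesInt v ↔ v = 15 ∨ v = 16 ∨ v = 17 ∨ v = 18 ∨ v = 19 ∨ v = 20 := by
  simp only [mergeSort, Cmd.WritesInt, mergePass_writesInt]; tauto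

theorem mergeSort_writesReal (a v : ℕ) : (mergeSort a).WritesReal v ↔ v = a := by
  simp only [mergeSort, Cmd.WritesReal, mergePass_writesReal]; tauto

theorem mergePass_spec (a : ℕ) : ∃ c, ∀ (s : State) (w K : ℕ) (b : ℤ), 0 < w → 0 < K →
    s.ints 14 0 = (2 * w * K : ℕ) → s.ints 15 0 = w → s.ints 16 0 = b →
    (∀ m < 2 * K, SortedOn (s.reals a) (b + (w * m : ℕ)) w) →
    Runs (mergePass a) s (c * (2 * w * K)) (fun s' =>
      (∀ m < K, SortedOn (s'.reals a) (b + (2 * w * K : ℕ) + (2 * w * m : ℕ)) (2 * w)) ∧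
      ∀ u < 2 * w * K, ∃ v < 2 * w * K,
        s'.reals a (b + (2 * w * K : ℕ) + (v : ℕ)) = s.reals a (b + (u : ℕ))) := by
  obtain ⟨c, hc⟩ := mergeBlocks_spec a
  refine ⟨3 + (7 + (c + 10)) + 7, ?_⟩
  intro s w K b hw hK h14 h15 h16 hsort
  set N := 2 * w * K with hN
  set S := s.reals a with hS
  have key : Runs (.while (.ilt (ivar 17) (ivar 14))
      (.seq (mergeBlocks a) (iset 17 (.add (ivar 17) (.add (ivar 15) (ivar 15))))))
      (s.setInt 17 0 0) (K * (7 + (c * w + 10)) + 7)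
      (fun s' => ¬ (Test.ilt (ivar 17) (ivar 14)).Holds s' ∧ ∃ k ≤ K, (k ≤ K ∧
        s'.ints 17 0 = (2 * w * (K - k) : ℕ) ∧
        (∀ z < b + N, s'.reals a z = S z) ∧
        (∀ m < K - k, SortedOn (s'.reals a) (b + N + (2 * w * m : ℕ)) (2 * w)) ∧
        ∀ u < 2 * w * (K - k), ∃ v < 2 * w * (K - k),
          s'.reals a (b + N + (v : ℕ)) = S (b + (u : ℕ)))) := by
    have hv : ∀ s', Frame (.seq (mergeBlocks a)
        (iset 17 (.add (ivar 17) (.add (ivar 15) (ivar 15))))) (s.setInt 17 0 0) s' →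
        s'.ints 14 0 = N ∧ s'.ints 15 0 = w ∧ s'.ints 16 0 = b := by
      intro s' hf
      rw [hf.ints 14 (by simp [Cmd.WritesInt, mergeBlocks_writesInt]),
        hf.ints 15 (by simp [Cmd.WritesInt, mergeBlocks_writesInt]),
        hf.ints 16 (by simp [Cmd.WritesInt, mergeBlocks_writesInt])]
      simp [h14, h15, h16]
    refine Runs.while (N := K) (fun k s' => k ≤ K ∧ s'.ints 17 0 = (2 * w * (K - k) : ℕ) ∧
        (∀ z < b + N, s'.reals a z = S z) ∧
        (∀ m < K - k, SortedOn (s'.reals a) (b + N + (2 * w * m : ℕ)) (2 * w)) ∧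
        ∀ u < 2 * w * (K - k), ∃ v < 2 * w * (K - k),
          s'.reals a (b + N + (v : ℕ)) = S (b + (u : ℕ))) ?_ ?_ ?_
    · rintro s' hf ⟨-, h17, -⟩
      simp [Test.Holds, IExp.eval, h17, (hv s' hf).1, hN]
    · rintro k s' hf ⟨hk, h17, hold, hsrt, hcov⟩ -
      obtain ⟨g14, g15, g16⟩ := hv s' hf
      obtain ⟨q, hq⟩ : ∃ q, K = q + (k + 1) := ⟨K - (k + 1), by omega⟩
      have hq1 : K - (k + 1) = q := by omega
      have hq2 : K - k = q + 1 := by omega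
      rw [hq1] at h17 hsrt hcov
      rw [hq2]
      have hmul : 2 * w * (q + 1) = 2 * w * q + 2 * w := by ring
      have hqN : 2 * w * q + 2 * w ≤ N := by
        rw [← hmul, hN]; exact Nat.mul_le_mul_left _ (by omega)
      have hsrc : ∀ m < 2 * K, SortedOn (s'.reals a) (b + (w * m : ℕ)) w := by
        intro m hm u v huv hv'
        have : w * m + w ≤ N := by
          calc w * m + w = w * (m + 1) := by ring
            _ ≤ w * (2 * K) := Nat.mul_le_mul_left _ hm
            _ = N := by rw [hN]; ring
        rw [hold _ (by omega), hold _ (by omega)]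
        exact hsort m hm u v huv hv'
      have hrun := hc s' w b (2 * w * q : ℕ) N hw g14 g15 g16 h17 (by positivity) (by omega)
        (by convert hsrc (2 * q) (by omega) using 3; ring)
        (by convert hsrc (2 * q + 1) (by omega) using 1; push_cast; ring)
      refine (hrun.seq (B₂ := 10) (Q := fun s' => _) fun s₂ hf₂ ⟨p1, p2, p3⟩ =>
        (Runs.istore (a := 17) ?_).mono (by simp [IExp.cost]) fun _ _ h => h).mono
        le_rfl fun _ _ h => h
      have hval : (IExp.add (ivar 17) (.add (ivar 15) (ivar 15))).eval s₂ =
          (2 * w * q + 2 * w : ℕ) := by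
        simp only [IExp.eval]
        rw [hf₂.ints 17 (by simp [mergeBlocks_writesInt]),
          hf₂.ints 15 (by simp [mergeBlocks_writesInt]), h17, g15]
        push_cast; ring
      have hxy : b + (2 * w * q : ℕ) + (N : ℤ) = b + N + (2 * w * q : ℕ) := by ring
      rw [hxy] at p1 p2 p3
      refine ⟨by omega, ?_, ?_, ?_, ?_⟩
      · rw [hval, hmul]; simp [IExp.eval]
      · intro z hz
        have h := p3 z (Or.inl (by omega))
        rw [State.setInt_reals, h]
        exact hold z hz
      · intro m hm
        rcases Nat.lt_succ_iff_lt_or_eq.1 hm with hm | rfl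
        · intro u v huv hv'
          have : 2 * w * m + 2 * w ≤ 2 * w * q := by
            calc 2 * w * m + 2 * w = 2 * w * (m + 1) := by ring
              _ ≤ 2 * w * q := Nat.mul_le_mul_left _ hm
          rw [State.setInt_reals, p3 _ (Or.inl (by omega)), p3 _ (Or.inl (by omega))]
          exact hsrt m hm u v huv hv'
        · exact p1
      · intro u hu
        rw [State.setInt_reals, hmul]
        rcases Nat.lt_or_ge u (2 * w * q) with hu' | hu'
        · obtain ⟨v, hv', he⟩ := hcov u hu'
          exact ⟨v, by omega, by rw [p3 _ (Or.inl (by omega)), he]⟩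
        · obtain ⟨v, hv', he⟩ := p2 (u - 2 * w * q) (by omega)
          refine ⟨2 * w * q + v, by omega, ?_⟩
          rw [hold _ (by omega)] at he
          convert he using 2
          · push_cast; ring
          · push_cast [Nat.cast_sub hu']; ring
    · refine ⟨le_rfl, by simp, fun z _ => rfl, ?_, ?_⟩ <;> intro m hm <;> simp at hm
  refine (Runs.seq (R := fun s' => s' = s.setInt 17 0 0)
    (Runs.istore rfl) fun s' _ h => h ▸ key).mono ?_ ?_
  · have h1 : K ≤ N := by rw [hN]; nlinarith
    have h2 : K * (c * w) ≤ c * N := by rw [hN]; nlinarith [Nat.zero_le (c * w * K)]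
    simp only [IExp.cost]
    nlinarith
  · rintro s' hf ⟨hb, k, -, hk, h17, -, hsrt, hcov⟩
    have g14 : s'.ints 14 0 = N := by
      rw [Frame.ints (p := mergePass a) hf 14 (by simp [mergePass_writesInt]), h14]
    simp only [Test.Holds, IExp.eval, h17, g14, not_not] at hb
    have hk0 : k = 0 := by
      by_contra hk0
      have h1 : 2 * w * (K - k) < 2 * w * K := Nat.mul_lt_mul_of_pos_left (by omega) (by omega)
      omega
    subst hk0
    exact ⟨by simpa using hsrt, by simpa using hcov⟩

theorem mergeSort_spec (a : ℕ) : ∃ c, ∀ (s : State) (k : ℕ), s.ints 14 0 = (2 ^ k : ℕ) →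
    Runs (mergeSort a) s (c * (2 ^ k * (k + 1))) (fun s' => ∃ b : ℤ, s'.ints 16 0 = b ∧
      SortedOn (s'.reals a) b (2 ^ k) ∧
      ∀ u < 2 ^ k, ∃ v < 2 ^ k, s'.reals a (b + (v : ℕ)) = s.reals a (u : ℕ)) := by
  obtain ⟨c, hc⟩ := mergePass_spec a
  refine ⟨c + 30, ?_⟩
  intro s k h14
  set S := s.reals a with hS
  set N := 2 ^ k with hN
  let I : ℕ → State → Prop := fun r s' => r ≤ k ∧ s'.ints 15 0 = (2 ^ (k - r) : ℕ) ∧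
    (∀ m < 2 ^ r, SortedOn (s'.reals a) (s'.ints 16 0 + (2 ^ (k - r) * m : ℕ)) (2 ^ (k - r))) ∧
    ∀ u < N, ∃ v < N, s'.reals a (s'.ints 16 0 + (v : ℕ)) = S (u : ℕ)
  have key : Runs (.while (.ilt (ivar 15) (ivar 14))
      (.seq (mergePass a) (.seq (iset 16 (.add (ivar 16) (ivar 14)))
      (iset 15 (.add (ivar 15) (ivar 15))))))
      ((s.setInt 15 0 1).setInt 16 0 0) (k * (7 + (c * N + 14)) + 7)
      (fun s' => ¬ (Test.ilt (ivar 15) (ivar 14)).Holds s' ∧ ∃ r ≤ k, I r s') := by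
    have hv : ∀ s', Frame (.seq (mergePass a) (.seq (iset 16 (.add (ivar 16) (ivar 14)))
        (iset 15 (.add (ivar 15) (ivar 15))))) ((s.setInt 15 0 1).setInt 16 0 0) s' →
        s'.ints 14 0 = N := by
      intro s' hf
      rw [hf.ints 14 (by simp [Cmd.WritesInt, mergePass_writesInt])]
      simp [h14]
    refine Runs.while (N := k) I ?_ ?_ ?_
    · rintro s' hf ⟨-, h15, -⟩
      simp [Test.Holds, IExp.eval, h15, hv s' hf, hN]
    · rintro r s' hf ⟨hr, h15, hsrt, hcov⟩ -
      have g14 := hv s' hf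
      obtain ⟨l, hl⟩ : ∃ l, k = l + (r + 1) := ⟨k - (r + 1), by omega⟩
      have hl1 : k - (r + 1) = l := by omega
      have hl2 : k - r = l + 1 := by omega
      rw [hl1] at h15 hsrt
      have hNe : 2 * 2 ^ l * 2 ^ r = N := by rw [hN, hl]; ring
      have hrun := hc s' (2 ^ l) (2 ^ r) (s'.ints 16 0) (by positivity) (by positivity)
        (by rw [g14, hNe]) h15 rfl (by rwa [pow_succ'] at hsrt)
      rw [hNe] at hrun
      refine (hrun.seq (B₂ := 14) (Q := I r) fun s₂ hf₂ ⟨p1, p2⟩ =>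
        (Runs.effect (by simp [Cmd.LoopFree]) ?_).mono (by simp [Cmd.maxCost, IExp.cost])
        fun _ _ h => h).mono le_rfl fun _ _ h => h
      have k14 : s₂.ints 14 0 = N := by
        rw [hf₂.ints 14 (by simp [mergePass_writesInt]), g14]
      have k15 : s₂.ints 15 0 = (2 ^ l : ℕ) := by
        rw [hf₂.ints 15 (by simp [mergePass_writesInt]), h15]
      have k16 : s₂.ints 16 0 = s'.ints 16 0 := by
        rw [hf₂.ints 16 (by simp [mergePass_writesInt])]
      refine ⟨by omega, ?_, ?_, ?_⟩
      · simp [Cmd.effect, IExp.eval, k15, hl2, pow_succ']; ring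
      · rw [hl2, pow_succ']
        simpa [Cmd.effect, IExp.eval, k14, k16] using p1
      · intro u hu
        obtain ⟨v, hv', he⟩ := hcov u hu
        obtain ⟨v₂, hv₂, he₂⟩ := p2 v hv'
        refine ⟨v₂, hv₂, ?_⟩
        simpa [Cmd.effect, IExp.eval, k14, k16] using he₂.trans he
    · refine ⟨le_rfl, by simp, ?_, ?_⟩
      · intro m _ u v huv hv'
        have h1 : v = 0 := by simpa using hv'
        have h2 : u = 0 := by omega
        subst h1 h2
        exact le_rfl
      · intro u hu
        exact ⟨u, hu, by simp [hS]⟩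
  refine (Runs.seq (R := fun s' => s' = s.setInt 15 0 1) (Runs.istore rfl) fun s' _ h =>
    Runs.seq (R := fun s' => s' = (s.setInt 15 0 1).setInt 16 0 0)
    (Runs.istore (by rw [h]; rfl)) fun s' _ h => h ▸ key).mono ?_ ?_
  · have h1 : 1 ≤ N := Nat.one_le_two_pow
    have h2 : k ≤ N * k := Nat.le_mul_of_pos_left _ h1
    simp only [IExp.cost]
    nlinarith
  · rintro s' hf ⟨hb, r, -, hr, h15, hsrt, hcov⟩
    have g14 : s'.ints 14 0 = N := by
      rw [Frame.ints (p := mergeSort a) hf 14 (by simp [mergeSort_writesInt]), h14]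
    simp only [Test.Holds, IExp.eval, h15, g14, not_not] at hb
    have hr0 : r = 0 := by
      by_contra hr0
      have h1 : 2 ^ (k - r) < 2 ^ k := Nat.pow_lt_pow_right (by omega) (by omega)
      omega
    subst hr0
    refine ⟨s'.ints 16 0, rfl, ?_, hcov⟩
    simpa using hsrt 0 (by simp)

/-! ### Searching the grid -/

/-- The expression for `LBC.encode`. -/
def encodeExp : ℕ → (ℕ → IExp) → IExp
  | 0, _ => .const 0
  | m + 1, e =>
    .add (.mul (.add (encodeExp m e) (.mul (e m) (.add (.mul (.const 2) (e m)) (.const 1))))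
        (.add (encodeExp m e) (.mul (e m) (.add (.mul (.const 2) (e m)) (.const 1)))))
      (.mul (e m) (.add (.mul (.const 2) (e m)) (.const 1)))

theorem encodeExp_eval (s : State) (m : ℕ) (e : ℕ → IExp) :
    (encodeExp m e).eval s = encode m fun j => (e j).eval s := by
  induction m with
  | zero => simp [encodeExp, encode, IExp.eval]
  | succ m ih => simp [encodeExp, encode, IExp.eval, ih]

/-- The expression for the squared distance of two points, given by their numbers. -/
def sqDistExp : ℕ → IExp → IExp → RExp
  | 0, _, _ => .ofInt (.const 0)
  | m + 1, e, f => .add (sqDistExp m e f)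
      (.mul (.sub (.load (m + 1) e) (.load (m + 1) f)) (.sub (.load (m + 1) e) (.load (m + 1) f)))

/-- The coordinates of the points are stored in the real arrays `1, …, d`. -/
def Stores (d : ℕ) (X : ℕ → ℕ → ℝ) (s : State) : Prop :=
  ∀ j < d, ∀ i : ℕ, s.reals (j + 1) i = X j i

theorem sqDistExp_eval {d : ℕ} {X : ℕ → ℕ → ℝ} {s : State} (hX : Stores d X s) {e f : IExp}
    {i k : ℕ} (he : e.eval s = i) (hf : f.eval s = k) :
    (sqDistExp d e f).eval s = sqDist d X i k := by
  induction d with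
  | zero => simp [sqDistExp, sqDist, RExp.eval, IExp.eval]
  | succ d ih =>
    have h := ih fun j hj => hX j (by omega)
    rw [sqDist] at h ⊢
    rw [Finset.sum_range_succ, ← h]
    simp [sqDistExp, RExp.eval, he, hf, hX d (by omega)]
    ring

/-- The integer array `7` with contents `g` stores the set `C` of centers: the cell of the center
`c` contains `base + c + 1`, and the grid cells without centers contain numbers that are at most
`base`. -/
structure GridStores (d : ℕ) (X : ℕ → ℕ → ℝ) (W : ℝ) (C : Set ℕ) (base : ℤ) (g : ℤ → ℤ) :
    Prop where
  center : ∀ c ∈ C, g (encode d (cell X W c)) = base + c + 1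
  empty : ∀ a, base < g a → ∃ c ∈ C, a = encode d (cell X W c)

/-- All vectors of integers between `-d` and `d`: the offsets of the grid cells to be searched. -/
noncomputable def offsets (d : ℕ) : List (Fin d → ℤ) :=
  (Fintype.piFinset fun _ : Fin d => Finset.Icc (-(d : ℤ)) d).toList

/-- The address in the grid of the cell with the offset `o`. -/
def probeAddr (d : ℕ) (o : Fin d → ℤ) : IExp :=
  encodeExp d fun j => if h : j < d then .add (.load 8 (.const j)) (.const (o ⟨j, h⟩)) else .const 0

/-- Inspect the cell with the offset `o`: if it contains a center that is not farther from the
point number `ivar 10` than the distance stored in `rvar (d + 6)`, then this center becomes the new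
candidate `ivar 11`. -/
def probe (d : ℕ) (o : Fin d → ℤ) : Cmd :=
  .ite (.ile (.load 7 (probeAddr d o)) (ivar 9)) .skip
    (.seq (iset 13 (.sub (.sub (.load 7 (probeAddr d o)) (ivar 9)) (.const 1)))
      (.seq (rset (d + 7) (sqDistExp d (ivar 10) (ivar 13)))
        (.ite (.rle (rvar (d + 7)) (rvar (d + 6)))
          (.seq (iset 11 (ivar 13)) (rset (d + 6) (rvar (d + 7)))) .skip)))

/-- Compute the cell of the point number `ivar 10`. -/
def locate (d : ℕ) : Cmd :=
  .each (fun j => .istore 8 (.const (j : ℕ))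
    (.floor (.mul (.load (j + 1) (ivar 10)) (rvar (d + 4))))) (List.range d)

/-- Find the center nearest to the point number `ivar 10`, if there is one whose squared distance is
at most `rvar (d + 5)`.  Its number, or `-1`, becomes the value of `ivar 11`. -/
noncomputable def scan (d : ℕ) : Cmd :=
  .seq (iset 11 (.const (-1))) (.seq (rset (d + 6) (rvar (d + 5)))
    (.seq (locate d) (.each (probe d) (offsets d))))

theorem probe_writesInt (d : ℕ) (o : Fin d → ℤ) (a : ℕ) :
    (probe d o).WritesInt a ↔ a = 11 ∨ a = 13 := by
  simp only [probe, Cmd.WritesInt]; tauto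

theorem probe_writesReal (d : ℕ) (o : Fin d → ℤ) (a : ℕ) :
    (probe d o).WritesReal a ↔ a = d + 6 ∨ a = d + 7 := by
  simp only [probe, Cmd.WritesReal]; tauto

theorem scan_writesInt {d : ℕ} {a : ℕ} (h : (scan d).WritesInt a) : a = 8 ∨ a = 11 ∨ a = 13 := by
  simp only [scan, locate, Cmd.WritesInt, Cmd.each_writesInt, probe_writesInt] at h
  rcases h with h | h | ⟨j, _, h⟩ | ⟨o, _, h⟩ <;> tauto

theorem scan_writesReal {d : ℕ} {a : ℕ} (h : (scan d).WritesReal a) : a = d + 6 ∨ a = d + 7 := by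
  simp only [scan, locate, Cmd.WritesReal, Cmd.each_writesReal, probe_writesReal] at h
  rcases h with h | h | ⟨j, _, h⟩ | ⟨o, _, h⟩ <;> tauto

/-- What is known about the candidate after the cells with the offsets in `D` have been inspected:
`b` is the number and `q` the squared distance of the candidate. -/
structure ScanInv (d : ℕ) (X : ℕ → ℕ → ℝ) (W R : ℝ) (C : Set ℕ) (i : ℕ) (D : Set (Fin d → ℤ))
    (b : ℤ) (q : ℝ) : Prop where
  least : ∀ o ∈ D, ∀ c ∈ C, sqDist d X i c ≤ R →
    (∀ j : Fin d, cell X W c j = cell X W i j + o j) → b ≠ -1 ∧ q ≤ sqDist d X i c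
  cand : b = -1 ∧ q = R ∨ ∃ c ∈ C, b = (c : ℤ) ∧ q = sqDist d X i c ∧ sqDist d X i c ≤ R

theorem probe_spec {d : ℕ} {X : ℕ → ℕ → ℝ} {W R : ℝ} {C : Set ℕ} {i : ℕ} {D : Set (Fin d → ℤ)}
    (o : Fin d → ℤ) {s : State} (hX : Stores d X s) (h10 : s.ints 10 0 = i)
    (hloc : ∀ j < d, s.ints 8 (j : ℕ) = cell X W i j)
    (hG : GridStores d X W C (s.ints 9 0) (s.ints 7))
    (hI : ScanInv d X W R C i D (s.ints 11 0) (s.reals (d + 6) 0)) :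
    Runs (probe d o) s (probe d o).maxCost (fun s' =>
      ScanInv d X W R C i (insert o D) (s'.ints 11 0) (s'.reals (d + 6) 0)) := by
  refine Runs.effect (by simp [probe, Cmd.LoopFree]) ?_
  have haddr : ∀ c, (∀ j : Fin d, cell X W c j = cell X W i j + o j) →
      (probeAddr d o).eval s = encode d (cell X W c) := by
    intro c hc
    rw [probeAddr, encodeExp_eval]
    refine encode_congr fun j hj => ?_
    simp [hj, IExp.eval, hloc j hj, hc ⟨j, hj⟩]
  by_cases h1 : s.ints 7 ((probeAddr d o).eval s) ≤ s.ints 9 0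
  · have h1' : (Test.ile (.load 7 (probeAddr d o)) (ivar 9)).Holds s := by
      simpa [Test.Holds, IExp.eval] using h1
    rw [probe, Cmd.effect_ite_of_holds h1', Cmd.effect]
    refine ⟨?_, hI.cand⟩
    rintro o' (rfl | ho') c hc hR hcell
    · rw [haddr c hcell, hG.center c hc] at h1
      omega
    · exact hI.least o' ho' c hc hR hcell
  · have h1' : ¬ (Test.ile (.load 7 (probeAddr d o)) (ivar 9)).Holds s := by
      simpa [Test.Holds, IExp.eval] using h1
    obtain ⟨c, hc, hca⟩ := hG.empty _ (not_le.1 h1)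
    have hgc := hG.center c hc
    rw [← hca] at hgc
    rw [probe, Cmd.effect_ite_of_not_holds h1', Cmd.effect_seq, Cmd.effect_seq, Cmd.effect_istore,
      Cmd.effect_rstore]
    set s₁ := s.setInt 13 ((IExp.const 0).eval s)
      ((IExp.sub (.sub (.load 7 (probeAddr d o)) (ivar 9)) (.const 1)).eval s) with hs₁
    have k13 : s₁.ints 13 0 = c := by
      simp [hs₁, IExp.eval, hgc]; ring
    have k10 : s₁.ints 10 0 = i := by simp [hs₁, h10]
    have k11 : s₁.ints 11 0 = s.ints 11 0 := by simp [hs₁]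
    have kX : Stores d X s₁ := hX
    set s₂ := s₁.setReal (d + 7) ((IExp.const 0).eval s₁)
      ((sqDistExp d (ivar 10) (ivar 13)).eval s₁) with hs₂
    have l7 : s₂.reals (d + 7) 0 = sqDist d X i c := by
      simp [hs₂, IExp.eval, sqDistExp_eval kX (e := ivar 10) (f := ivar 13) (i := i) (k := c)
        (by simp [IExp.eval, k10]) (by simp [IExp.eval, k13])]
    have l6 : s₂.reals (d + 6) 0 = s.reals (d + 6) 0 := by simp [hs₂, hs₁]
    have l13 : s₂.ints 13 0 = c := by simp [hs₂, k13]
    have l11 : s₂.ints 11 0 = s.ints 11 0 := by simp [hs₂, k11]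
    -- a center in the inspected cell is the center `c`
    have huniq : ∀ c' ∈ C, (∀ j : Fin d, cell X W c' j = cell X W i j + o j) → c' = c := by
      intro c' hc' hcell
      have := hG.center c' hc'
      rw [← haddr c' hcell, hgc] at this
      omega
    by_cases h2 : sqDist d X i c ≤ s.reals (d + 6) 0
    · have h2' : (Test.rle (rvar (d + 7)) (rvar (d + 6))).Holds s₂ := by
        simpa [Test.Holds, RExp.eval, IExp.eval, l6, l7] using h2
      rw [Cmd.effect_ite_of_holds h2', Cmd.effect_seq, Cmd.effect_istore, Cmd.effect_rstore]
      have hR : sqDist d X i c ≤ R := by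
        rcases hI.cand with ⟨-, h⟩ | ⟨c', -, -, h, h'⟩ <;> linarith
      simp only [IExp.eval, RExp.eval, State.setReal_ints, State.setInt_ints, State.setInt_reals,
        State.setReal_reals, and_self, if_true, l13, l7]
      refine ⟨?_, Or.inr ⟨c, hc, rfl, rfl, hR⟩⟩
      rintro o' (rfl | ho') c' hc' hR' hcell
      · rw [huniq c' hc' hcell]
        exact ⟨by omega, le_rfl⟩
      · exact ⟨by omega, h2.trans (hI.least o' ho' c' hc' hR' hcell).2⟩
    · have h2' : ¬ (Test.rle (rvar (d + 7)) (rvar (d + 6))).Holds s₂ := by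
        simpa [Test.Holds, RExp.eval, IExp.eval, l6, l7] using h2
      rw [Cmd.effect_ite_of_not_holds h2', Cmd.effect, l11, l6]
      refine ⟨?_, hI.cand⟩
      rintro o' (rfl | ho') c' hc' hR' hcell
      · obtain rfl := huniq c' hc' hcell
        rcases hI.cand with ⟨-, h⟩ | ⟨c'', -, h, -⟩
        · exact absurd (hR'.trans h.ge) h2
        · exact ⟨by omega, (not_le.1 h2).le⟩
      · exact hI.least o' ho' c' hc' hR' hcell

theorem locate_spec {d : ℕ} {X : ℕ → ℕ → ℝ} {W : ℝ} {i : ℕ} {s : State} (hX : Stores d X s)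
    (h10 : s.ints 10 0 = i) (hW : s.reals (d + 4) 0 = W) :
    Runs (locate d) s (d * 9 + 1) (fun s' => ∀ j < d, s'.ints 8 (j : ℕ) = cell X W i j) := by
  refine (Runs.each (B := 9) (fun D s' => ∀ j ∈ D, s'.ints 8 (j : ℕ) = cell X W i j) (by simp)
    ?_).mono (by simp) fun s' _ h j hj => h j (by simpa using hj)
  intro j hj D s' hf hD
  have hr : s'.reals = s.reals := by
    funext a
    exact hf.reals a (by simp [Cmd.each_writesReal, Cmd.WritesReal])
  have g10 : s'.ints 10 0 = i := by
    rw [hf.ints 10 (by simp [Cmd.each_writesInt, Cmd.WritesInt]), h10]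
  refine (Runs.istore ?_).mono (by simp [IExp.cost, RExp.cost]) fun _ _ h => h
  rintro j' (rfl | hj')
  · simp [IExp.eval, RExp.eval, g10, hr, hW, hX j' (List.mem_range.1 hj), cell]
  · by_cases hjj : j' = j
    · subst hjj
      simp [IExp.eval, RExp.eval, g10, hr, hW, hX j' (List.mem_range.1 hj), cell]
    · simp [IExp.eval, hjj, hD j' hj']

theorem scan_spec (d : ℕ) : ∃ c, ∀ (s : State) (X : ℕ → ℕ → ℝ) (ρ : ℝ) (C : Set ℕ) (i : ℕ),
    0 < ρ → Stores d X s → s.ints 10 0 = i → s.reals (d + 4) 0 = d / ρ →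
    s.reals (d + 5) 0 = ρ ^ 2 → GridStores d X (d / ρ) C (s.ints 9 0) (s.ints 7) →
    Runs (scan d) s c (fun s' =>
      (∀ j < d, s'.ints 8 (j : ℕ) = cell X (d / ρ) i j) ∧
      ((s'.ints 11 0 = -1 ∧ ∀ c ∈ C, ρ ^ 2 < sqDist d X i c) ∨
        ∃ c ∈ C, s'.ints 11 0 = (c : ℤ) ∧ sqDist d X i c ≤ ρ ^ 2 ∧
          ∀ c' ∈ C, sqDist d X i c ≤ sqDist d X i c')) := by
  obtain ⟨B, hB⟩ : ∃ B, ∀ o ∈ offsets d, (probe d o).maxCost ≤ B :=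
    ⟨((offsets d).map fun o => (probe d o).maxCost).sum, fun o ho =>
      List.single_le_sum (fun _ _ => Nat.zero_le _) _ (List.mem_map_of_mem ho)⟩
  refine ⟨3 + (4 + ((d * 9 + 1) + ((offsets d).length * B + 1))), ?_⟩
  intro s X ρ C i hρ hX h10 hW hR hG
  set W := (d : ℝ) / ρ with hWdef
  set s₂ := (s.setInt 11 0 (-1)).setReal (d + 6) 0 (ρ ^ 2) with hs₂
  have hX₂ : Stores d X s₂ := by
    intro j hj i
    rw [hs₂, State.setReal_reals, if_neg (by omega)]
    exact hX j hj i
  have h10₂ : s₂.ints 10 0 = i := by simp [hs₂, h10]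
  have hW₂ : s₂.reals (d + 4) 0 = W := by simp [hs₂, hW]
  have key : Runs (.seq (locate d) (.each (probe d) (offsets d))) s₂
      ((d * 9 + 1) + ((offsets d).length * B + 1)) (fun s' =>
      (∀ j < d, s'.ints 8 (j : ℕ) = cell X W i j) ∧
      ScanInv d X W (ρ ^ 2) C i {o | o ∈ offsets d} (s'.ints 11 0) (s'.reals (d + 6) 0)) := by
    refine (locate_spec hX₂ h10₂ hW₂).seq ?_
    intro s₃ hf₃ hloc
    refine (Runs.each (fun D s' => ScanInv d X W (ρ ^ 2) C i D (s'.ints 11 0) (s'.reals (d + 6) 0))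
      (B := B) ?_ ?_).mono le_rfl ?_
    · rw [hf₃.ints 11 (by simp [locate, Cmd.each_writesInt, Cmd.WritesInt]),
        hf₃.reals (d + 6) (by simp [locate, Cmd.each_writesReal, Cmd.WritesReal])]
      exact ⟨by simp, Or.inl (by simp [hs₂])⟩
    · intro o ho D s₄ hf₄ hI
      have hf : ∀ v, v ≠ 8 → v ≠ 11 → v ≠ 13 → s₄.ints v = s.ints v := by
        intro v h8 h11 h13
        rw [hf₄.ints v (by simp [Cmd.each_writesInt, probe_writesInt, h11, h13]),
          hf₃.ints v (by simp [locate, Cmd.each_writesInt, Cmd.WritesInt, h8])]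
        exact State.setInt_ints_of_ne _ _ _ h11
      refine (probe_spec o ?_ ?_ ?_ ?_ hI).mono (hB o ho) fun _ _ h => h
      · intro j hj i
        rw [hf₄.reals (j + 1) (by simp [Cmd.each_writesReal, probe_writesReal]; omega),
          hf₃.reals (j + 1) (by simp [locate, Cmd.each_writesReal, Cmd.WritesReal])]
        exact hX₂ j hj i
      · rw [hf 10 (by decide) (by decide) (by decide), h10]
      · intro j hj
        rw [hf₄.ints 8 (by simp [Cmd.each_writesInt, probe_writesInt])]
        exact hloc j hj
      · rw [hf 9 (by decide) (by decide) (by decide), hf 7 (by decide) (by decide) (by decide)]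
        exact hG
    · intro s₄ hf₄ hI
      refine ⟨fun j hj => ?_, hI⟩
      rw [hf₄.ints 8 (by simp [Cmd.each_writesInt, probe_writesInt])]
      exact hloc j hj
  refine (Runs.seq (R := fun s' => s' = s.setInt 11 0 (-1)) (Runs.istore rfl) fun s' _ h =>
    Runs.seq (R := fun s' => s' = s₂)
    (Runs.rstore ?_) fun s' _ h => h ▸ key).mono ?_ ?_
  · rw [h]; simp [hs₂, IExp.eval, RExp.eval, hR]
  · simp [IExp.cost, RExp.cost]
  · rintro s' - ⟨hloc, hI⟩
    refine ⟨hloc, ?_⟩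
    -- the cells of all centers at distance at most `ρ` have been inspected
    have hall : ∀ c ∈ C, sqDist d X i c ≤ ρ ^ 2 →
        s'.ints 11 0 ≠ -1 ∧ s'.reals (d + 6) 0 ≤ sqDist d X i c := by
      intro c hc hle
      refine hI.least (fun j => cell X W c j - cell X W i j) ?_ c hc hle (fun j => by ring)
      simp only [offsets, Set.mem_ofPred_eq, Finset.mem_toList, Fintype.mem_piFinset,
        Finset.mem_Icc]
      intro j
      have h1 := cell_sub_le hρ hle j.2
      have h2 := cell_sub_le hρ (sqDist_comm d X i c ▸ hle) j.2
      simp only [← hWdef] at h1 h2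
      omega
    rcases hI.cand with ⟨h, -⟩ | ⟨c, hc, h, hq, hle⟩
    · refine Or.inl ⟨h, fun c hc => ?_⟩
      by_contra hle
      exact (hall c hc (not_lt.1 hle)).1 h
    · refine Or.inr ⟨c, hc, h, hle, fun c' hc' => ?_⟩
      rcases le_or_gt (sqDist d X i c') (ρ ^ 2) with h' | h'
      · exact hq ▸ (hall c' hc' h').2
      · exact hle.trans h'.le

/-! ### Clustering with a given radius -/

/-- Greedily select centers: a point becomes a center if there is no earlier center whose squared
distance is at most `rvar (d + 5)`.  The integer array `5` holds the indicator function of the set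
of the centers, and the integer array `6` is set to zero. -/
noncomputable def placeCenters (d : ℕ) : Cmd :=
  .for 10 (ivar 0) (.seq (scan d) (.seq (.istore 6 (ivar 10) (.const 0))
    (.ite (.ile (.const 0) (ivar 11)) (.istore 5 (ivar 10) (.const 0))
      (.seq (.istore 5 (ivar 10) (.const 1))
        (.istore 7 (encodeExp d fun j => .load 8 (.const j))
          (.add (.add (ivar 9) (ivar 10)) (.const 1)))))))

/-- Assign every point to its nearest center.  The integer array `4` holds the assignment, and the
integer array `6` the sizes of the clusters. -/
noncomputable def assignPoints (d : ℕ) : Cmd :=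
  .for 10 (ivar 0) (.seq (scan d) (.seq (.istore 4 (ivar 10) (ivar 11))
    (.istore 6 (ivar 11) (.add (.load 6 (ivar 11)) (.const 1)))))

/-- The variable `12` becomes `1` if every center has been assigned at least `ivar 1` points, and
`0` otherwise. -/
def checkSizes : Cmd :=
  .seq (iset 12 (.const 1)) (.for 10 (ivar 0)
    (.ite (.and (.ile (.const 1) (.load 5 (ivar 10)))
      (.not (.ile (ivar 1) (.load 6 (ivar 10))))) (iset 12 (.const 0)) .skip))

/-- Copy the centers and the assignment to the output. -/
def copyResult : Cmd :=
  .for 10 (ivar 0) (.seq (.istore 2 (ivar 10) (.load 4 (ivar 10)))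
    (.istore 3 (ivar 10) (.load 5 (ivar 10))))

theorem placeCenters_writesInt {d a : ℕ} (h : (placeCenters d).WritesInt a) :
    a ∈ [5, 6, 7, 8, 10, 11, 13] := by
  simp only [placeCenters, Cmd.for_writesInt, Cmd.WritesInt] at h
  have := @scan_writesInt d a
  simp only [List.mem_cons, List.not_mem_nil]; tauto

theorem placeCenters_writesReal {d a : ℕ} (h : (placeCenters d).WritesReal a) :
    a = d + 6 ∨ a = d + 7 := by
  simp only [placeCenters, Cmd.for_writesReal, Cmd.WritesReal] at h
  have := @scan_writesReal d a
  tauto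

theorem assignPoints_writesInt {d a : ℕ} (h : (assignPoints d).WritesInt a) :
    a ∈ [4, 6, 8, 10, 11, 13] := by
  simp only [assignPoints, Cmd.for_writesInt, Cmd.WritesInt] at h
  have := @scan_writesInt d a
  simp only [List.mem_cons, List.not_mem_nil]; tauto

theorem assignPoints_writesReal {d a : ℕ} (h : (assignPoints d).WritesReal a) :
    a = d + 6 ∨ a = d + 7 := by
  simp only [assignPoints, Cmd.for_writesReal, Cmd.WritesReal] at h
  have := @scan_writesReal d a
  tauto

theorem checkSizes_writesInt {a : ℕ} (h : checkSizes.WritesInt a) : a = 10 ∨ a = 12 := by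
  simp only [checkSizes, Cmd.for_writesInt, Cmd.WritesInt] at h
  tauto

theorem checkSizes_writesReal (a : ℕ) : ¬ checkSizes.WritesReal a := by
  simp [checkSizes, Cmd.for_writesReal, Cmd.WritesReal]

theorem copyResult_writesInt {a : ℕ} (h : copyResult.WritesInt a) : a = 2 ∨ a = 3 ∨ a = 10 := by
  simp only [copyResult, Cmd.for_writesInt, Cmd.WritesInt] at h
  tauto

theorem copyResult_writesReal (a : ℕ) : ¬ copyResult.WritesReal a := by
  simp [copyResult, Cmd.for_writesReal, Cmd.WritesReal]

/-- The input of the clustering with separation `ρ`: the number `n` and the coordinates of the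
points, and the parameters of the grid. -/
structure Ready (d n : ℕ) (X : ℕ → ℕ → ℝ) (ρ : ℝ) (s : State) : Prop where
  size : s.ints 0 0 = n
  coords : Stores d X s
  scale : s.reals (d + 4) 0 = d / ρ
  radius : s.reals (d + 5) 0 = ρ ^ 2

theorem Ready.of_frame {d n : ℕ} {X : ℕ → ℕ → ℝ} {ρ : ℝ} {p : Cmd} {s s' : State}
    (h : Ready d n X ρ s) (hf : Frame p s s') (hi : ¬ p.WritesInt 0)
    (hr : ∀ a, p.WritesReal a → a = d + 6 ∨ a = d + 7) : Ready d n X ρ s' := by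
  refine ⟨?_, fun j hj i => ?_, ?_, ?_⟩
  · rw [hf.ints 0 hi, h.size]
  · rw [hf.reals (j + 1) fun h => by have := hr _ h; omega, h.coords j hj]
  · rw [hf.reals (d + 4) fun h => by have := hr _ h; omega, h.scale]
  · rw [hf.reals (d + 5) fun h => by have := hr _ h; omega, h.radius]

/-- `C` is a set of points with squared distances greater than `ρ ^ 2` such that all of the first
`m` points have squared distance at most `ρ ^ 2` to `C`. -/
structure IsNet (d : ℕ) (X : ℕ → ℕ → ℝ) (ρ : ℝ) (C : Set ℕ) (m : ℕ) : Prop where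
  lt : ∀ c ∈ C, c < m
  sep : ∀ c ∈ C, ∀ c' ∈ C, c ≠ c' → ρ ^ 2 < sqDist d X c c'
  cover : ∀ i < m, ∃ c ∈ C, sqDist d X i c ≤ ρ ^ 2

/-- The centers and their indicator function are stored, and the counters are zero. -/
structure PlaceInv (d : ℕ) (X : ℕ → ℕ → ℝ) (ρ : ℝ) (base : ℤ) (C : Set ℕ) (m : ℕ) (s : State) :
    Prop where
  net : IsNet d X ρ C m
  grid : GridStores d X (d / ρ) C base (s.ints 7)
  one : ∀ i < m, i ∈ C → s.ints 5 (i : ℕ) = 1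
  zero : ∀ i < m, i ∉ C → s.ints 5 (i : ℕ) = 0
  count : ∀ i < m, s.ints 6 (i : ℕ) = 0

theorem placeCenters_spec (d : ℕ) : ∃ c, ∀ (s : State) (n : ℕ) (X : ℕ → ℕ → ℝ) (ρ : ℝ),
    0 < d → 0 < ρ → Ready d n X ρ s → (∀ a, s.ints 7 a ≤ s.ints 9 0) →
    Runs (placeCenters d) s (c * (n + 1)) (fun s' => ∃ C,
      PlaceInv d X ρ (s.ints 9 0) C n s') := by
  obtain ⟨c, hc⟩ := scan_spec d
  let q : Cmd := .seq (.istore 6 (ivar 10) (.const 0))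
    (.ite (.ile (.const 0) (ivar 11)) (.istore 5 (ivar 10) (.const 0))
      (.seq (.istore 5 (ivar 10) (.const 1))
        (.istore 7 (encodeExp d fun j => .load 8 (.const j))
          (.add (.add (ivar 9) (ivar 10)) (.const 1)))))
  refine ⟨13 + (c + q.maxCost), ?_⟩
  intro s n X ρ hd hρ hs hg
  set base := s.ints 9 0 with hbase
  refine (Runs.for (N := n) (B := c + q.maxCost) (fun m s' => ∃ C, PlaceInv d X ρ base C m s')
    ?_ ?_ ?_).mono (by simp only [IExp.cost]; linarith) fun _ _ h => h
  · refine ⟨∅, ⟨?_, ?_, ?_⟩, ⟨?_, ?_⟩, ?_, ?_, ?_⟩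
    · simp
    · simp
    · intro i hi; omega
    · simp
    · intro a ha
      rw [State.setInt_ints_of_ne _ _ _ (by decide)] at ha
      exact absurd (hg a) (not_le.2 ha)
    all_goals intro i hi; omega
  · intro s' hf
    exact (hs.of_frame hf (fun h => by have := placeCenters_writesInt h; simp at this)
      fun a h => placeCenters_writesReal h).size
  · rintro m s₁ hm hf h10 ⟨C, hI⟩
    have hs₁ := hs.of_frame hf (fun h => by have := placeCenters_writesInt h; simp at this)
      fun a h => placeCenters_writesReal h
    have h9 : s₁.ints 9 0 = base := by
      rw [hf.ints 9 fun h => by have := placeCenters_writesInt h; simp at this]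
    refine (hc s₁ X ρ C m hρ hs₁.coords h10 hs₁.scale hs₁.radius (h9 ▸ hI.grid)).seq ?_
    rintro s₂ hf₂ ⟨hloc, hbest⟩
    refine Runs.effect (by simp [Cmd.LoopFree]) ?_
    have hv : ∀ v, v ≠ 8 → v ≠ 11 → v ≠ 13 → s₂.ints v = s₁.ints v := by
      intro v h8 h11 h13
      exact hf₂.ints v fun h => by have := scan_writesInt h; omega
    have g5 := hv 5 (by decide) (by decide) (by decide)
    have g6 := hv 6 (by decide) (by decide) (by decide)
    have g7 := hv 7 (by decide) (by decide) (by decide)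
    have g9 : s₂.ints 9 0 = base := by rw [hv 9 (by decide) (by decide) (by decide), h9]
    have g10 : s₂.ints 10 0 = m := by rw [hv 10 (by decide) (by decide) (by decide), h10]
    rw [Cmd.effect_seq, Cmd.effect_istore]
    rcases hbest with ⟨h11, hfar⟩ | ⟨c, hcC, h11, hle, -⟩
    · -- the point is far from all centers and becomes a center
      rw [Cmd.effect_ite_of_not_holds (by simp [Test.Holds, IExp.eval, h11]), Cmd.effect_seq,
        Cmd.effect_istore, Cmd.effect_istore, encodeExp_eval]
      have haddr : encode d (fun j => (IExp.load 8 (.const (j : ℕ))).eval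
          ((s₂.setInt 6 ((ivar 10).eval s₂) ((IExp.const 0).eval s₂)).setInt 5
          ((ivar 10).eval (s₂.setInt 6 ((ivar 10).eval s₂) ((IExp.const 0).eval s₂)))
          ((IExp.const 1).eval (s₂.setInt 6 ((ivar 10).eval s₂) ((IExp.const 0).eval s₂))))) =
          encode d (cell X (d / ρ) m) := by
        refine encode_congr fun j hj => ?_
        simp [IExp.eval, hloc j hj]
      rw [haddr]
      have hne : ∀ c ∈ C, encode d (cell X (d / ρ) c) ≠ encode d (cell X (d / ρ) m) := by
        intro c hcC he
        have h1 := sqDist_le_of_cell_eq hd hρ (encode_inj he)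
        rw [sqDist_comm] at h1
        exact absurd (hfar c hcC) (not_lt.2 h1)
      refine ⟨by simp [g10], insert m C, ⟨?_, ?_, ?_⟩, ⟨?_, ?_⟩, ?_, ?_, ?_⟩
      · rintro c (rfl | hcC)
        · omega
        · exact (hI.net.lt c hcC).trans (Nat.lt_succ_self m)
      · rintro c (rfl | hcC) c' (rfl | hcC') hcc
        · exact absurd rfl hcc
        · exact hfar c' hcC'
        · exact sqDist_comm d X c c' ▸ hfar c hcC
        · exact hI.net.sep c hcC c' hcC' hcc
      · intro i hi
        rcases Nat.lt_succ_iff_lt_or_eq.1 hi with hi | rfl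
        · obtain ⟨c, hcC, h⟩ := hI.net.cover i hi
          exact ⟨c, Or.inr hcC, h⟩
        · exact ⟨i, Or.inl rfl, by rw [sqDist_self]; positivity⟩
      · rintro c (rfl | hcC)
        · simp [IExp.eval, g9, g10]
        · simp [IExp.eval, hne c hcC, g7, hI.grid.center c hcC]
      · intro a ha
        by_cases ham : a = encode d (cell X (d / ρ) m)
        · exact ⟨m, Or.inl rfl, ham⟩
        · simp [IExp.eval, ham, g7] at ha
          obtain ⟨c, hcC, h⟩ := hI.grid.empty a ha
          exact ⟨c, Or.inr hcC, h⟩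
      · intro i hi hiC
        by_cases him : i = m
        · simp [IExp.eval, g10, him]
        · simpa [IExp.eval, g10, him, g5] using hI.one i (by omega) (hiC.resolve_left him)
      · intro i hi hiC
        have him : i ≠ m := fun h => hiC (Or.inl h)
        simpa [IExp.eval, g10, him, g5] using hI.zero i (by omega) fun h => hiC (Or.inr h)
      · intro i hi
        by_cases him : i = m
        · simp [IExp.eval, g10, him]
        · simpa [IExp.eval, g10, him, g6] using hI.count i (by omega)
    · rw [Cmd.effect_ite_of_holds (by simp [Test.Holds, IExp.eval, h11]), Cmd.effect_istore]
      refine ⟨by simp [g10], C, ⟨?_, hI.net.sep, ?_⟩, ⟨?_, ?_⟩, ?_, ?_, ?_⟩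
      · intro c hcC
        exact (hI.net.lt c hcC).trans (Nat.lt_succ_self m)
      · intro i hi
        rcases Nat.lt_succ_iff_lt_or_eq.1 hi with hi | rfl
        · exact hI.net.cover i hi
        · exact ⟨c, hcC, hle⟩
      · intro c hcC
        simpa [g7] using hI.grid.center c hcC
      · intro a ha
        simp [g7] at ha
        exact hI.grid.empty a ha
      · intro i hi hiC
        have him := hI.net.lt i hiC
        simpa [IExp.eval, g10, him.ne, g5] using hI.one i him hiC
      · intro i hi hiC
        by_cases him : i = m
        · simp [IExp.eval, g10, him]
        · simpa [IExp.eval, g10, him, g5] using hI.zero i (by omega) hiC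
      · intro i hi
        by_cases him : i = m
        · simp [IExp.eval, g10, him]
        · simpa [IExp.eval, g10, him, g6] using hI.count i (by omega)

/-- The first `m` points have been assigned to their nearest centers, and the sizes of the clusters
are stored. -/
structure AssignInv (d n : ℕ) (X : ℕ → ℕ → ℝ) (ρ : ℝ) (C : Set ℕ) (m : ℕ) (s : State) : Prop where
  nearest : ∀ i < m, ∃ c ∈ C, s.ints 4 (i : ℕ) = (c : ℤ) ∧ sqDist d X i c ≤ ρ ^ 2 ∧
    ∀ c' ∈ C, sqDist d X i c ≤ sqDist d X i c'
  count : ∀ c < n, s.ints 6 (c : ℕ) =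
    (((Finset.range m).filter fun i : ℕ => s.ints 4 (i : ℤ) = (c : ℤ)).card : ℤ)

theorem assignPoints_spec (d : ℕ) : ∃ c, ∀ (s : State) (n : ℕ) (X : ℕ → ℕ → ℝ) (ρ : ℝ)
    (C : Set ℕ), 0 < ρ → Ready d n X ρ s → PlaceInv d X ρ (s.ints 9 0) C n s →
    Runs (assignPoints d) s (c * (n + 1)) (AssignInv d n X ρ C n) := by
  obtain ⟨c, hc⟩ := scan_spec d
  let q : Cmd := .seq (.istore 4 (ivar 10) (ivar 11))
    (.istore 6 (ivar 11) (.add (.load 6 (ivar 11)) (.const 1)))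
  refine ⟨13 + (c + q.maxCost), ?_⟩
  intro s n X ρ C hρ hs hP
  refine (Runs.for (N := n) (B := c + q.maxCost) (fun m s' => AssignInv d n X ρ C m s')
    ?_ ?_ ?_).mono (by simp only [IExp.cost]; linarith) fun _ _ h => h
  · refine ⟨fun i hi => by omega, fun c hc => ?_⟩
    simpa using hP.count c hc
  · intro s' hf
    exact (hs.of_frame hf (fun h => by have := assignPoints_writesInt h; simp at this)
      fun a h => assignPoints_writesReal h).size
  · rintro m s₁ hm hf h10 hI
    have hs₁ := hs.of_frame hf (fun h => by have := assignPoints_writesInt h; simp at this)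
      fun a h => assignPoints_writesReal h
    have h9 : s₁.ints 9 = s.ints 9 :=
      hf.ints 9 fun h => by have := assignPoints_writesInt h; simp at this
    have h7 : s₁.ints 7 = s.ints 7 :=
      hf.ints 7 fun h => by have := assignPoints_writesInt h; simp at this
    refine (hc s₁ X ρ C m hρ hs₁.coords h10 hs₁.scale hs₁.radius
      (by rw [h9, h7]; exact hP.grid)).seq ?_
    rintro s₂ hf₂ ⟨-, hbest⟩
    refine Runs.effect (by simp [Cmd.LoopFree]) ?_
    have hv : ∀ v, v ≠ 8 → v ≠ 11 → v ≠ 13 → s₂.ints v = s₁.ints v := by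
      intro v h8 h11 h13
      exact hf₂.ints v fun h => by have := scan_writesInt h; omega
    have g4 := hv 4 (by decide) (by decide) (by decide)
    have g6 := hv 6 (by decide) (by decide) (by decide)
    have g10 : s₂.ints 10 0 = m := by rw [hv 10 (by decide) (by decide) (by decide), h10]
    obtain ⟨c, hcC, h11, hle, hmin⟩ : ∃ c ∈ C, s₂.ints 11 0 = (c : ℤ) ∧
        sqDist d X m c ≤ ρ ^ 2 ∧ ∀ c' ∈ C, sqDist d X m c ≤ sqDist d X m c' := by
      rcases hbest with ⟨-, hfar⟩ | h
      · obtain ⟨c, hcC, hle⟩ := hP.net.cover m hm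
        exact absurd (hfar c hcC) (not_lt.2 hle)
      · exact h
    rw [Cmd.effect_seq, Cmd.effect_istore, Cmd.effect_istore]
    refine ⟨by simp [g10], ?_, ?_⟩
    · intro i hi
      by_cases him : i = m
      · subst him
        exact ⟨c, hcC, by simp [IExp.eval, g10, h11], hle, hmin⟩
      · simpa [IExp.eval, g10, h11, him, g4] using hI.nearest i (by omega)
    · intro c' hc'
      have hold := hI.count c' hc'
      have hfil : (Finset.range m).filter (fun i : ℕ => (if i = m then (c : ℤ) else
          s₁.ints 4 (i : ℤ)) = (c' : ℤ)) =
          (Finset.range m).filter fun i : ℕ => s₁.ints 4 (i : ℤ) = (c' : ℤ) := by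
        refine Finset.filter_congr fun i hi => ?_
        rw [if_neg (Finset.mem_range.1 hi).ne]
      simp only [IExp.eval, g10, h11, State.setInt_ints, true_and, Nat.cast_inj, g4, g6,
        Finset.range_add_one, Finset.filter_insert]
      by_cases hcc : c' = c
      · subst hcc
        simp [hold]
        refine congrArg _ (Finset.filter_congr fun i hi => ?_)
        simp [(Finset.mem_range.1 hi).ne]
      · simp [hfil, hold, hcc, Ne.symm hcc]

theorem checkSizes_spec : ∃ c, ∀ (s : State) (n lam : ℕ), s.ints 0 0 = n → s.ints 1 0 = lam →
    Runs checkSizes s (c * (n + 1)) (fun s' =>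
      (s'.ints 12 0 = 1 ∧ ∀ i < n, 1 ≤ s.ints 5 (i : ℕ) → (lam : ℤ) ≤ s.ints 6 (i : ℕ)) ∨
      (s'.ints 12 0 = 0 ∧ ∃ i < n, 1 ≤ s.ints 5 (i : ℕ) ∧ s.ints 6 (i : ℕ) < lam)) := by
  let q : Cmd := .ite (.and (.ile (.const 1) (.load 5 (ivar 10)))
      (.not (.ile (ivar 1) (.load 6 (ivar 10))))) (iset 12 (.const 0)) .skip
  refine ⟨13 + q.maxCost + 3, ?_⟩
  intro s n lam hn hlam
  have key : Runs (.for 10 (ivar 0) q) (s.setInt 12 0 1) (n * (13 + q.maxCost) + 13) (fun s' =>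
      (s'.ints 12 0 = 1 ∧ ∀ i < n, 1 ≤ s.ints 5 (i : ℕ) → (lam : ℤ) ≤ s.ints 6 (i : ℕ)) ∨
      (s'.ints 12 0 = 0 ∧ ∃ i < n, 1 ≤ s.ints 5 (i : ℕ) ∧ s.ints 6 (i : ℕ) < lam)) := by
    refine Runs.for (N := n) (B := q.maxCost) (fun m s' =>
      (s'.ints 12 0 = 1 ∧ ∀ i < m, 1 ≤ s.ints 5 (i : ℕ) → (lam : ℤ) ≤ s.ints 6 (i : ℕ)) ∨
      (s'.ints 12 0 = 0 ∧ ∃ i < m, 1 ≤ s.ints 5 (i : ℕ) ∧ s.ints 6 (i : ℕ) < lam))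
      ?_ ?_ ?_
    · exact Or.inl ⟨by simp, fun i hi => by omega⟩
    · intro s' hf
      simp only [IExp.eval]
      rw [hf.ints 0 (by simp [Cmd.for_writesInt, q, Cmd.WritesInt])]
      simpa using hn
    · intro m s₁ hm hf h10 hI
      have hv : ∀ v, v ≠ 10 → v ≠ 12 → s₁.ints v = s.ints v := by
        intro v h10 h12
        rw [hf.ints v (by simp [Cmd.for_writesInt, q, Cmd.WritesInt, h10, h12])]
        exact State.setInt_ints_of_ne _ _ _ h12
      have g1 : s₁.ints 1 0 = lam := by rw [hv 1 (by decide) (by decide), hlam]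
      have g5 := hv 5 (by decide) (by decide)
      have g6 := hv 6 (by decide) (by decide)
      refine Runs.effect (by simp [q, Cmd.LoopFree]) ?_
      by_cases hb : 1 ≤ s.ints 5 (m : ℕ) ∧ s.ints 6 (m : ℕ) < lam
      · rw [Cmd.effect_ite_of_holds (by simpa [Test.Holds, IExp.eval, h10, g1, g5, g6] using hb),
          Cmd.effect_istore]
        exact ⟨by simpa using h10, Or.inr ⟨by simp [IExp.eval], m, by omega, hb⟩⟩
      · rw [Cmd.effect_ite_of_not_holds
          (by simpa [Test.Holds, IExp.eval, h10, g1, g5, g6] using hb), Cmd.effect]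
        refine ⟨h10, ?_⟩
        rcases hI with ⟨h, hall⟩ | ⟨h, i, hi, hbad⟩
        · refine Or.inl ⟨by simpa using h, fun i hi h5 => ?_⟩
          rcases Nat.lt_succ_iff_lt_or_eq.1 hi with hi | rfl
          · exact hall i hi h5
          · by_contra h6
            exact hb ⟨h5, not_le.1 h6⟩
        · exact Or.inr ⟨by simpa using h, i, by omega, hbad⟩
  refine (Runs.seq (R := fun s' => s' = s.setInt 12 0 1) (Runs.istore rfl)
    fun s' _ h => h ▸ key).mono ?_ fun _ _ h => h
  simp only [IExp.cost]; linarith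

theorem copyResult_spec : ∃ c, ∀ (s : State) (n : ℕ), s.ints 0 0 = n →
    Runs copyResult s (c * (n + 1)) (fun s' => ∀ i < n,
      s'.ints 2 (i : ℕ) = s.ints 4 (i : ℕ) ∧ s'.ints 3 (i : ℕ) = s.ints 5 (i : ℕ)) := by
  let q : Cmd := .seq (.istore 2 (ivar 10) (.load 4 (ivar 10)))
    (.istore 3 (ivar 10) (.load 5 (ivar 10)))
  refine ⟨13 + q.maxCost, ?_⟩
  intro s n hn
  refine (Runs.for (N := n) (B := q.maxCost) (fun m s' => ∀ i < m,
      s'.ints 2 (i : ℕ) = s.ints 4 (i : ℕ) ∧ s'.ints 3 (i : ℕ) = s.ints 5 (i : ℕ))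
    ?_ ?_ ?_).mono (by simp only [IExp.cost]; linarith) fun _ _ h => h
  · intro i hi; omega
  · intro s' hf
    simp only [IExp.eval]
    rw [hf.ints 0 (by simp [Cmd.for_writesInt, Cmd.WritesInt]), hn]
  · intro m s₁ hm hf h10 hI
    have g4 := hf.ints 4 (by simp [Cmd.for_writesInt, Cmd.WritesInt])
    have g5 := hf.ints 5 (by simp [Cmd.for_writesInt, Cmd.WritesInt])
    refine Runs.effect (by simp [Cmd.LoopFree]) ?_
    rw [Cmd.effect_seq, Cmd.effect_istore, Cmd.effect_istore]
    refine ⟨by simpa using h10, fun i hi => ?_⟩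
    by_cases him : i = m
    · simp [IExp.eval, h10, him, g4, g5]
    · simpa [IExp.eval, h10, him] using hI i (by omega)

end RealRAM

namespace LBC

/-- The `j`-th coordinate of the `i`-th point. -/
noncomputable def coord {d n : ℕ} (P : Fin n → EuclideanSpace ℝ (Fin d)) (j i : ℕ) : ℝ :=
  if h : j < d ∧ i < n then P ⟨i, h.2⟩ ⟨j, h.1⟩ else 0

theorem coord_eq {d n : ℕ} (P : Fin n → EuclideanSpace ℝ (Fin d)) (j : Fin d) (i : Fin n) :
    coord P j i = P i j := by
  simp [coord]

theorem sqDist_coord {d n : ℕ} (P : Fin n → EuclideanSpace ℝ (Fin d)) (i k : Fin n) :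
    sqDist d (coord P) i k = dist (P i) (P k) ^ 2 := by
  rw [EuclideanSpace.dist_sq_eq, sqDist, Finset.sum_range]
  refine Finset.sum_congr rfl fun j _ => ?_
  rw [coord_eq, coord_eq, Real.dist_eq, sq_abs]

theorem card_filter_range (n : ℕ) (p : ℕ → Prop) [DecidablePred p] :
    ((Finset.range n).filter p).card = (Finset.univ.filter fun i : Fin n => p i).card := by
  rw [← Finset.card_map Fin.valEmbedding]
  congr 1
  ext i
  simp only [Finset.mem_filter, Finset.mem_range, Finset.mem_map, Finset.mem_univ, true_and,
    Fin.valEmbedding_apply]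
  constructor
  · rintro ⟨h, hp⟩
    exact ⟨⟨i, h⟩, hp, rfl⟩
  · rintro ⟨j, hp, rfl⟩
    exact ⟨j.2, hp⟩

end LBC

namespace RealRAM

open LBC

section Radius

variable {d n : ℕ}

/-- The invariant of the whole computation: the instance is stored, and all cells of the grid count
as empty. -/
structure HasInstance (P : Fin n → EuclideanSpace ℝ (Fin d)) (lam : ℕ) (s : State) : Prop where
  size : s.ints 0 0 = n
  bound : s.ints 1 0 = lam
  coords : Stores d (coord P) s
  fresh : ∀ a, s.ints 7 a ≤ s.ints 9 0

/-- The output arrays contain a solution of price at most `4 r`. -/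
def HasSolution (P : Fin n → EuclideanSpace ℝ (Fin d)) (lam : ℕ) (r : ℝ) (s : State) : Prop :=
  ∃ (C : Finset (Fin n)) (f : Fin n → Fin n),
    (∀ i : Fin n, s.ints 2 (i : ℕ) = ((f i : ℕ) : ℤ)) ∧
    (∀ i : Fin n, s.ints 3 (i : ℕ) = if i ∈ C then 1 else 0) ∧
    IsSolution lam C f ∧ price P f ≤ 4 * r

/-- The meaning of the memory contents after the assignment of the points to the centers. -/
theorem exists_clustering {P : Fin n → EuclideanSpace ℝ (Fin d)} {ρ : ℝ} (hρ : 0 < ρ) {base : ℤ}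
    {C : Set ℕ} {s s' : State} (h : PlaceInv d (coord P) ρ base C n s)
    (h' : AssignInv d n (coord P) ρ C n s') (h5 : s'.ints 5 = s.ints 5) :
    ∃ (C : Finset (Fin n)) (f : Fin n → Fin n),
      (∀ i : Fin n, s'.ints 4 (i : ℕ) = ((f i : ℕ) : ℤ)) ∧
      (∀ i : Fin n, s'.ints 5 (i : ℕ) = if i ∈ C then 1 else 0) ∧
      (∀ i : Fin n, s'.ints 6 (i : ℕ) =
        ((Finset.univ.filter fun k => f k = i).card : ℤ)) ∧
      (∀ i, f i ∈ C) ∧ (∀ i, dist (P i) (P (f i)) ≤ ρ) ∧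
      (∀ i, ∀ c ∈ C, dist (P i) (P (f i)) ≤ dist (P i) (P c)) ∧
      ∀ c ∈ C, ∀ c' ∈ C, c ≠ c' → ρ < dist (P c) (P c') := by
  classical
  have hch : ∀ i : Fin n, ∃ c : Fin n, (c : ℕ) ∈ C ∧ s'.ints 4 (i : ℕ) = ((c : ℕ) : ℤ) ∧
      sqDist d (coord P) i c ≤ ρ ^ 2 ∧
      ∀ c' ∈ C, sqDist d (coord P) i c ≤ sqDist d (coord P) i c' := by
    intro i
    obtain ⟨c, hc, hcn⟩ := h'.nearest i i.2
    exact ⟨⟨c, h.net.lt c hc⟩, hc, hcn⟩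
  choose f hfC hf4 hfρ hfn using hch
  refine ⟨Finset.univ.filter fun i => (i : ℕ) ∈ C, f, hf4, ?_, ?_, ?_, ?_, ?_, ?_⟩
  · intro i
    rw [h5]
    by_cases hi : (i : ℕ) ∈ C
    · simp [hi, h.one i i.2 hi]
    · simp [hi, h.zero i i.2 hi]
  · intro i
    rw [h'.count i i.2, card_filter_range]
    congr 2
    ext k
    simp only [Finset.mem_filter, Finset.mem_univ, true_and, hf4, Nat.cast_inj, Fin.val_inj]
  · intro i
    simpa using hfC i
  · intro i
    have := hfρ i
    rw [sqDist_coord] at this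
    exact (pow_le_pow_iff_left₀ dist_nonneg hρ.le two_ne_zero).1 this
  · intro i c hc
    have := hfn i c (by simpa using hc)
    rw [sqDist_coord, sqDist_coord] at this
    exact (pow_le_pow_iff_left₀ dist_nonneg dist_nonneg two_ne_zero).1 this
  · intro c hc c' hc' hne
    have := h.net.sep c (by simpa using hc) c' (by simpa using hc') fun h => hne (Fin.ext h)
    rw [sqDist_coord] at this
    exact (pow_lt_pow_iff_left₀ hρ.le dist_nonneg two_ne_zero).1 this

/-- Run the clustering with separation `4 r`, where `r` is the value of `rvar (d + 3)`.  If all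
clusters are large enough, then the solution is copied to the output and the variable `12` becomes
`1`, otherwise it becomes `0`. -/
noncomputable def tryRadius (d : ℕ) : Cmd :=
  .ite (.rle (rvar (d + 3)) (.ofInt (.const 0))) (iset 12 (.const 0))
    (.seq (.seq
      (rset (d + 4) (.div (.ofInt (.const d)) (.mul (.ofInt (.const 4)) (rvar (d + 3)))))
      (rset (d + 5) (.mul (.mul (.ofInt (.const 4)) (rvar (d + 3)))
        (.mul (.ofInt (.const 4)) (rvar (d + 3))))))
    (.seq (placeCenters d) (.seq (assignPoints d) (.seq checkSizes
      (.seq (iset 9 (.add (ivar 9) (ivar 0)))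
        (.ite (.ile (.const 1) (ivar 12)) copyResult .skip))))))

theorem tryRadius_writesInt {d a : ℕ} (h : (tryRadius d).WritesInt a) :
    a ∈ [2, 3, 4, 5, 6, 7, 8, 9, 10, 11, 12, 13] := by
  simp only [tryRadius, Cmd.WritesInt] at h
  rcases h with h | (h | h) | h | h | h | h | h | h
  · simp [h]
  · exact h.elim
  · exact h.elim
  · have := placeCenters_writesInt h
    simp only [List.mem_cons, List.not_mem_nil, or_false] at this ⊢; omega
  · have := assignPoints_writesInt h
    simp only [List.mem_cons, List.not_mem_nil, or_false] at this ⊢; omega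
  · rcases checkSizes_writesInt h with h | h <;> simp [h]
  · simp [h]
  · rcases copyResult_writesInt h with h | h | h <;> simp [h]
  · exact h.elim

theorem tryRadius_writesReal {d a : ℕ} (h : (tryRadius d).WritesReal a) :
    a = d + 4 ∨ a = d + 5 ∨ a = d + 6 ∨ a = d + 7 := by
  simp only [tryRadius, Cmd.WritesReal] at h
  have h1 := @placeCenters_writesReal d a
  have h2 := @assignPoints_writesReal d a
  have h3 := checkSizes_writesReal a
  have h4 := copyResult_writesReal a
  tauto

/-- The result of `tryRadius`. -/
def TryPost (P : Fin n → EuclideanSpace ℝ (Fin d)) (lam : ℕ) (r : ℝ) (s s' : State) : Prop :=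
  HasInstance P lam s' ∧
    ((s'.ints 12 0 = 1 ∧ 0 < r ∧ HasSolution P lam r s') ∨
      (s'.ints 12 0 = 0 ∧ r < optPrice P lam ∧ s'.ints 2 = s.ints 2 ∧ s'.ints 3 = s.ints 3))

theorem tryRadius_spec (d : ℕ) (hd : 0 < d) : ∃ c, ∀ (n : ℕ)
    (P : Fin n → EuclideanSpace ℝ (Fin d)) (lam : ℕ) (r : ℝ) (s : State), lam ≤ n →
    0 < optPrice P lam → HasInstance P lam s → s.reals (d + 3) 0 = r →
    Runs (tryRadius d) s (c * (n + 1)) (TryPost P lam r s) := by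
  obtain ⟨c₁, hc₁⟩ := placeCenters_spec d
  obtain ⟨c₂, hc₂⟩ := assignPoints_spec d
  obtain ⟨c₃, hc₃⟩ := checkSizes_spec
  obtain ⟨c₄, hc₄⟩ := copyResult_spec
  let setup : Cmd := .seq
      (rset (d + 4) (.div (.ofInt (.const d)) (.mul (.ofInt (.const 4)) (rvar (d + 3)))))
      (rset (d + 5) (.mul (.mul (.ofInt (.const 4)) (rvar (d + 3)))
        (.mul (.ofInt (.const 4)) (rvar (d + 3)))))
  refine ⟨20 + setup.maxCost + c₁ + c₂ + c₃ + c₄, ?_⟩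
  intro n P lam r s hlam hopt hs hr
  have hB : 1 + (Test.rle (rvar (d + 3)) (.ofInt (.const 0))).cost + (setup.maxCost +
      (c₁ * (n + 1) + (c₂ * (n + 1) + (c₃ * (n + 1) + (7 + (5 + (c₄ * (n + 1) + 1))))))) ≤
      (20 + setup.maxCost + c₁ + c₂ + c₃ + c₄) * (n + 1) := by
    simp only [Test.cost, RExp.cost, IExp.cost]
    nlinarith [Nat.zero_le (setup.maxCost * n)]
  refine (Runs.ite (fun hb => ?_) fun hb => ?_).mono hB fun _ _ h => h
  · have hr0 : r ≤ 0 := by simpa [Test.Holds, RExp.eval, IExp.eval, hr] using hb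
    refine (Runs.istore ?_).mono (by simp only [IExp.cost]; omega) fun _ _ h => h
    refine ⟨⟨by simpa using hs.size, by simpa using hs.bound, hs.coords, ?_⟩, Or.inr
      ⟨by simp [IExp.eval], by linarith, ?_, ?_⟩⟩
    · intro a; simpa using hs.fresh a
    all_goals exact State.setInt_ints_of_ne _ _ _ (by decide)
  have hr0 : 0 < r := by simpa [Test.Holds, RExp.eval, IExp.eval, hr] using hb
  have hρ : 0 < 4 * r := by linarith
  -- the parameters of the grid
  refine (Runs.effect (p := setup) (Q := fun s₁ => s₁.ints = s.ints ∧
    Ready d n (coord P) (4 * r) s₁) (by simp [setup, Cmd.LoopFree]) ?_).seq ?_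
  · refine ⟨rfl, hs.size, fun j hj i => ?_, ?_, ?_⟩
    · have h1 : ¬ j = d + 4 := by omega
      have h2 : ¬ j = d + 3 := by omega
      simpa [setup, Cmd.effect, h1, h2] using hs.coords j hj i
    · simp [setup, Cmd.effect, RExp.eval, IExp.eval, hr]
    · simp [setup, Cmd.effect, RExp.eval, IExp.eval, hr]; ring
  rintro s₁ hf₁ ⟨hi₁, hready⟩
  -- the centers
  refine (hc₁ s₁ n (coord P) (4 * r) hd hρ hready (by rw [hi₁]; exact hs.fresh)).seq ?_
  rintro s₂ hf₂ ⟨C, hplace⟩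
  have hready₂ := hready.of_frame hf₂ (fun h => by have := placeCenters_writesInt h; simp at this)
    fun a h => placeCenters_writesReal h
  have h9₂ : s₂.ints 9 = s₁.ints 9 :=
    hf₂.ints 9 fun h => by have := placeCenters_writesInt h; simp at this
  -- the assignment
  refine (hc₂ s₂ n (coord P) (4 * r) C hρ hready₂ (h9₂ ▸ hplace)).seq ?_
  intro s₃ hf₃ hassign
  have hready₃ := hready₂.of_frame hf₃ (fun h => by have := assignPoints_writesInt h; simp at this)
    fun a h => assignPoints_writesReal h
  have hv₃ : ∀ v ∈ [0, 1, 2, 3, 9], s₃.ints v = s.ints v := by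
    intro v hv
    rw [hf₃.ints v fun h => by
        have := assignPoints_writesInt h
        simp only [List.mem_cons, List.not_mem_nil, or_false] at hv this; omega,
      hf₂.ints v fun h => by
        have := placeCenters_writesInt h
        simp only [List.mem_cons, List.not_mem_nil, or_false] at hv this; omega, hi₁]
  have h7₃ : s₃.ints 7 = s₂.ints 7 :=
    hf₃.ints 7 fun h => by have := assignPoints_writesInt h; simp at this
  obtain ⟨C', f, hf4, hC5, hcnt, hfC, hdist, hnear, hsep⟩ := exists_clustering hρ hplace hassign
    (hf₃.ints 5 fun h => by have := assignPoints_writesInt h; simp at this)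
  -- the sizes of the clusters
  refine (hc₃ s₃ n lam hready₃.size (by rw [hv₃ 1 (by simp), hs.bound])).seq ?_
  intro s₄ hf₄ hok
  have hv₄ : ∀ v, v ≠ 10 → v ≠ 12 → s₄.ints v = s₃.ints v := fun v h10 h12 =>
    hf₄.ints v fun h => by have := checkSizes_writesInt h; omega
  refine (Runs.istore (a := 9) (addr := .const 0) (e := .add (ivar 9) (ivar 0))
    (Q := fun s₅ => s₅ = s₄.setInt 9 0 (s.ints 9 0 + n)) ?_).seq (B₁ := 1 + 1 + 5) ?_
  · simp only [IExp.eval, hv₄ 9 (by decide) (by decide), hv₄ 0 (by decide) (by decide),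
      hv₃ 9 (by simp), hready₃.size]
  intro s₅ hf₅ hs₅
  have hv₅ : ∀ v, v ≠ 9 → v ≠ 10 → v ≠ 12 → s₅.ints v = s₃.ints v := by
    intro v h9 h10 h12
    rw [hs₅, State.setInt_ints_of_ne _ _ _ h9, hv₄ v h10 h12]
  have hinst : HasInstance P lam s₅ := by
    refine ⟨?_, ?_, ?_, ?_⟩
    · rw [hv₅ 0 (by decide) (by decide) (by decide), hready₃.size]
    · rw [hv₅ 1 (by decide) (by decide) (by decide), hv₃ 1 (by simp), hs.bound]
    · intro j hj i
      rw [hs₅, State.setInt_reals, hf₄.reals _ (checkSizes_writesReal _)]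
      exact hready₃.coords j hj i
    · intro a
      rw [hv₅ 7 (by decide) (by decide) (by decide), h7₃]
      have h9 : s₅.ints 9 0 = s.ints 9 0 + n := by simp [hs₅]
      rw [h9]
      by_contra! hlt
      have hlt' : s₁.ints 9 0 < s₂.ints 7 a := by rw [hi₁]; omega
      obtain ⟨c, hc, rfl⟩ := hplace.grid.empty a hlt'
      rw [hplace.grid.center c hc, hi₁] at hlt
      have := hplace.net.lt c hc
      omega
  have h12 : s₅.ints 12 0 = s₄.ints 12 0 := by simp [hs₅]
  refine (Runs.ite (B := c₄ * (n + 1) + 1) (fun hb => ?_) fun hb => ?_).mono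
    (by simp only [Test.cost, IExp.cost]; omega) fun _ _ h => h
  · -- the solution is copied
    have hb' : 1 ≤ s₄.ints 12 0 := by simpa [Test.Holds, IExp.eval, h12] using hb
    refine (hc₄ s₅ n hinst.size).mono (by omega) ?_
    intro s₆ hf₆ hcopy
    have hv₆ : ∀ v, v ≠ 2 → v ≠ 3 → v ≠ 10 → s₆.ints v = s₅.ints v := fun v h2 h3 h10 =>
      hf₆.ints v fun h => by have := copyResult_writesInt h; omega
    have hsizes : ∀ i < n, 1 ≤ s₃.ints 5 (i : ℕ) → (lam : ℤ) ≤ s₃.ints 6 (i : ℕ) := by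
      rcases hok with ⟨-, h⟩ | ⟨h, -⟩
      · exact h
      · omega
    have h121 : s₄.ints 12 0 = 1 := by
      rcases hok with ⟨h, -⟩ | ⟨h, -⟩
      · exact h
      · omega
    refine ⟨⟨?_, ?_, ?_, ?_⟩, Or.inl ⟨?_, hr0, C', f, ?_, ?_, ⟨hfC, ?_⟩, ?_⟩⟩
    · rw [hv₆ 0 (by decide) (by decide) (by decide), hinst.size]
    · rw [hv₆ 1 (by decide) (by decide) (by decide), hinst.bound]
    · intro j hj i
      rw [hf₆.reals _ (copyResult_writesReal _)]
      exact hinst.coords j hj i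
    · rw [hv₆ 7 (by decide) (by decide) (by decide), hv₆ 9 (by decide) (by decide) (by decide)]
      exact hinst.fresh
    · rw [hv₆ 12 (by decide) (by decide) (by decide), h12, h121]
    · intro i
      rw [(hcopy i i.2).1, hv₅ 4 (by decide) (by decide) (by decide), hf4]
    · intro i
      rw [(hcopy i i.2).2, hv₅ 5 (by decide) (by decide) (by decide), hC5]
    · intro c hc
      have := hsizes c c.2 (by rw [hC5, if_pos hc])
      rw [hcnt] at this
      exact_mod_cast this
    · exact Real.iSup_le hdist hρ.le
  · have hb' : s₄.ints 12 0 < 1 := by simpa [Test.Holds, IExp.eval, h12] using hb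
    refine (Runs.skip ?_).mono (by omega) fun _ _ h => h
    rcases hok with ⟨h, -⟩ | ⟨h, i, hi, h5, h6⟩
    · omega
    refine ⟨hinst, Or.inr ⟨by rw [h12, h], ?_, ?_, ?_⟩⟩
    · by_contra! hle
      have hiC : (⟨i, hi⟩ : Fin n) ∈ C' := by
        by_contra hiC
        have := hC5 ⟨i, hi⟩
        rw [if_neg hiC] at this
        simp only at this
        omega
      have h1 := card_cluster_ge P hlam hle hsep hfC hnear hiC
      have h2 := hcnt ⟨i, hi⟩
      simp only at h2
      rw [h2] at h6
      omega
    · rw [hv₅ 2 (by decide) (by decide) (by decide), hv₃ 2 (by simp)]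
    · rw [hv₅ 3 (by decide) (by decide) (by decide), hv₃ 3 (by simp)]

end Radius

/-! ### The candidate radii -/

theorem HasInstance.of_frame {d n : ℕ} {P : Fin n → EuclideanSpace ℝ (Fin d)} {lam : ℕ} {p : Cmd}
    {s s' : State} (h : HasInstance P lam s) (hf : Frame p s s')
    (hi : ∀ a, p.WritesInt a → a ∉ [0, 1, 7, 9]) (hr : ∀ a, p.WritesReal a → d < a) :
    HasInstance P lam s' := by
  refine ⟨?_, ?_, fun j hj i => ?_, fun a => ?_⟩
  · rw [hf.ints 0 fun h => hi _ h (by simp), h.size]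
  · rw [hf.ints 1 fun h => hi _ h (by simp), h.bound]
  · rw [hf.reals (j + 1) fun h => by have := hr _ h; omega, h.coords j hj]
  · rw [hf.ints 7 fun h => hi _ h (by simp), hf.ints 9 fun h => hi _ h (by simp)]
    exact h.fresh a

/-- Copy all coordinates of all points to the real array `d + 1`. -/
def loadCoords (d : ℕ) : Cmd :=
  .for 10 (ivar 0) (.each (fun j => .rstore (d + 1)
    (.add (.mul (ivar 10) (.const d)) (.const (j : ℕ))) (.load (j + 1) (ivar 10))) (List.range d))

theorem loadCoords_writesInt {d a : ℕ} (h : (loadCoords d).WritesInt a) : a = 10 := by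
  simpa [loadCoords, Cmd.for_writesInt, Cmd.each_writesInt, Cmd.WritesInt] using h

theorem loadCoords_writesReal {d a : ℕ} (h : (loadCoords d).WritesReal a) : a = d + 1 := by
  simp only [loadCoords, Cmd.for_writesReal, Cmd.each_writesReal, Cmd.WritesReal] at h
  obtain ⟨_, _, h⟩ := h
  exact h

theorem loadCoords_spec (d : ℕ) : ∃ c, ∀ (s : State) (n : ℕ) (X : ℕ → ℕ → ℝ),
    s.ints 0 0 = n → Stores d X s →
    Runs (loadCoords d) s (c * (n + 1)) (fun s' => ∀ i < n, ∀ j < d,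
      s'.reals (d + 1) (i * d + j : ℕ) = X j i) := by
  refine ⟨13 + (d * 20 + 1), ?_⟩
  intro s n X hn hX
  refine (Runs.for (N := n) (B := d * 20 + 1) (fun m s' => ∀ i < m, ∀ j < d,
      s'.reals (d + 1) (i * d + j : ℕ) = X j i) ?_ ?_ ?_).mono
      (by simp only [IExp.cost]; linarith) fun _ _ h => h
  · intro i hi; omega
  · intro s' hf
    simp only [IExp.eval]
    rw [hf.ints 0 fun h => by have := loadCoords_writesInt h; omega, hn]
  · intro m s₁ hm hf h10 hI
    refine (Runs.each (B := 20) (fun D s' => (∀ i < m, ∀ j < d,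
      s'.reals (d + 1) (i * d + j : ℕ) = X j i) ∧ ∀ j ∈ D, j < d →
      s'.reals (d + 1) (m * d + j : ℕ) = X j m) ?_ ?_).mono (by simp) ?_
    · exact ⟨hI, by simp⟩
    · rintro j hj D s₂ hf₂ ⟨h1, h2⟩
      have hjd := List.mem_range.1 hj
      have g10 : s₂.ints 10 0 = m := by
        rw [hf₂.ints 10 (by simp [Cmd.each_writesInt, Cmd.WritesInt]), h10]
      have gX : s₂.reals (j + 1) m = X j m := by
        rw [hf₂.reals (j + 1) (by simp [Cmd.each_writesReal, Cmd.WritesReal]; omega),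
          hf.reals (j + 1) (fun h => by have := loadCoords_writesReal h; omega), hX j hjd]
      refine (Runs.rstore ?_).mono (by simp [IExp.cost, RExp.cost]) fun _ _ h => h
      have haddr : (IExp.add (.mul (ivar 10) (.const d)) (.const (j : ℕ))).eval s₂ =
          ((m * d + j : ℕ) : ℤ) := by
        simp [IExp.eval, g10]
      rw [haddr]
      simp only [State.setReal_reals, true_and, RExp.eval, IExp.eval, g10, gX, Nat.cast_inj]
      refine ⟨fun i hi j' hj' => ?_, fun j' hj' hjd' => ?_⟩
      · have : i * d + d ≤ m * d := by
          calc i * d + d = (i + 1) * d := by ring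
            _ ≤ m * d := Nat.mul_le_mul_right _ hi
        rw [if_neg (by omega)]
        exact h1 i hi j' hj'
      · by_cases hjj : j' = j
        · simp [hjj]
        · rw [if_neg (by omega)]
          exact h2 j' (hj'.resolve_left hjj) hjd'
    · rintro s₂ hf₂ ⟨h1, h2⟩
      refine ⟨?_, ?_⟩
      · rw [hf₂.ints 10 (by simp [Cmd.each_writesInt, Cmd.WritesInt]), h10]
      · intro i hi j hj
        rcases Nat.lt_succ_iff_lt_or_eq.1 hi with hi | rfl
        · exact h1 i hi j hj
        · exact h2 j (by simpa using hj) hj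

theorem two_pow_clog_le {m : ℕ} (hm : 0 < m) : 2 ^ Nat.clog 2 m ≤ 2 * m := by
  rcases Nat.lt_or_ge 1 m with h | h
  · have h1 := Nat.pow_pred_clog_lt_self (b := 2) (by norm_num) h
    have h2 : 0 < Nat.clog 2 m := Nat.clog_pos (by norm_num) h
    have h3 : Nat.clog 2 m = (Nat.clog 2 m).pred + 1 := by rw [Nat.pred_eq_sub_one]; omega
    rw [h3, pow_succ]
    omega
  · obtain rfl : m = 1 := by omega
    simp

/-- The variable `14` becomes the least power of two that is at least `n * d`. -/
def roundSize (d : ℕ) : Cmd :=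
  .seq (iset 14 (.const 1)) (.while (.ilt (ivar 14) (.mul (ivar 0) (.const d)))
    (iset 14 (.add (ivar 14) (ivar 14))))

theorem roundSize_spec (d n : ℕ) (s : State) (hn : s.ints 0 0 = n) :
    Runs (roundSize d) s (20 * (Nat.clog 2 (n * d) + 1)) (fun s' =>
      s'.ints 14 0 = (2 ^ Nat.clog 2 (n * d) : ℕ)) := by
  set k := Nat.clog 2 (n * d) with hk
  have hkey : Runs (.while (.ilt (ivar 14) (.mul (ivar 0) (.const d)))
      (iset 14 (.add (ivar 14) (ivar 14)))) (s.setInt 14 0 1) (k * (9 + 7) + 9)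
      (fun s' => ¬ (Test.ilt (ivar 14) (.mul (ivar 0) (.const d))).Holds s' ∧
        ∃ r ≤ k, (r ≤ k ∧ s'.ints 14 0 = (2 ^ (k - r) : ℕ) ∧ s'.ints 0 0 = n)) := by
    refine Runs.while (N := k) (fun r s' => r ≤ k ∧ s'.ints 14 0 = (2 ^ (k - r) : ℕ) ∧
      s'.ints 0 0 = n) ?_ ?_ ?_
    · rintro s' - ⟨-, h14, h0⟩
      have := Nat.le_pow_clog (b := 2) (by norm_num) (n * d)
      have : ((n * d : ℕ) : ℤ) ≤ (2 ^ k : ℕ) := by exact_mod_cast this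
      simp only [Test.Holds, IExp.eval, h14, h0, not_not]
      simpa using this
    · rintro r s' - ⟨hr, h14, h0⟩ -
      refine Runs.istore ⟨by omega, ?_, by simpa using h0⟩
      have : k - r = (k - (r + 1)) + 1 := by omega
      rw [this, pow_succ]
      simp [IExp.eval, h14]; ring
    · exact ⟨le_rfl, by simp, by simpa using hn⟩
  refine (Runs.seq (R := fun s' => s' = s.setInt 14 0 1) (Runs.istore rfl)
    fun s' _ h => h ▸ hkey).mono (by simp only [IExp.cost]; omega) ?_
  rintro s' - ⟨hb, r, -, hr, h14, h0⟩
  simp only [Test.Holds, IExp.eval, h14, h0, not_not] at hb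
  have hb' : n * d ≤ 2 ^ (k - r) := by exact_mod_cast hb
  have := Nat.clog_le_of_le_pow hb'
  have hr0 : r = 0 := by omega
  subst hr0
  simpa using h14

/-- Write the differences of neighbors of the sorted sequence in the real array `d + 1` to the real
array `d + 2`. -/
def computeGaps (d : ℕ) : Cmd :=
  .for 10 (ivar 14) (.rstore (d + 2) (ivar 10)
    (.sub (.load (d + 1) (.add (ivar 16) (.add (ivar 10) (.const 1))))
      (.load (d + 1) (.add (ivar 16) (ivar 10)))))

theorem computeGaps_spec (d N : ℕ) (s : State) (hN : s.ints 14 0 = N) :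
    Runs (computeGaps d) s (40 * (N + 1)) (fun s' => ∀ t < N, s'.reals (d + 2) (t : ℕ) =
      s.reals (d + 1) (s.ints 16 0 + ((t + 1 : ℕ) : ℤ)) -
        s.reals (d + 1) (s.ints 16 0 + (t : ℕ))) := by
  refine (Runs.for (N := N) (B := 20) (fun m s' => ∀ t < m, s'.reals (d + 2) (t : ℕ) =
      s.reals (d + 1) (s.ints 16 0 + ((t + 1 : ℕ) : ℤ)) -
        s.reals (d + 1) (s.ints 16 0 + (t : ℕ))) ?_ ?_ ?_).mono
      (by simp only [IExp.cost]; omega) fun _ _ h => h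
  · intro t ht; omega
  · intro s' hf
    simp only [IExp.eval]
    rw [hf.ints 14 (by simp [Cmd.for_writesInt, Cmd.WritesInt]), hN]
  · intro m s₁ hm hf h10 hI
    have g16 : s₁.ints 16 = s.ints 16 := hf.ints 16 (by simp [Cmd.for_writesInt, Cmd.WritesInt])
    have gr : s₁.reals (d + 1) = s.reals (d + 1) :=
      hf.reals (d + 1) (by simp [Cmd.for_writesReal, Cmd.WritesReal])
    refine (Runs.rstore ?_).mono (by simp [IExp.cost, RExp.cost]) fun _ _ h => h
    refine ⟨by simpa using h10, fun t ht => ?_⟩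
    by_cases htm : t = m
    · subst htm
      simp [IExp.eval, RExp.eval, h10, g16, gr]
    · simpa [IExp.eval, h10, htm] using hI t (by omega)

/-- Compute the sorted sequence of the gaps between neighbors in the sorted sequence of all
coordinates. -/
def sortedGaps (d : ℕ) : Cmd :=
  .seq (loadCoords d) (.seq (roundSize d) (.seq (mergeSort (d + 1)) (.seq (computeGaps d)
    (mergeSort (d + 2)))))

theorem sortedGaps_writesInt {d a : ℕ} (h : (sortedGaps d).WritesInt a) :
    a = 10 ∨ 14 ≤ a ∧ a ≤ 20 := by
  simp only [sortedGaps, roundSize, computeGaps, Cmd.WritesInt, Cmd.for_writesInt,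
    mergeSort_writesInt, or_false, or_self] at h
  rcases h with h | h | h | h | h
  · exact Or.inl (loadCoords_writesInt h)
  all_goals omega

theorem sortedGaps_writesReal {d a : ℕ} (h : (sortedGaps d).WritesReal a) :
    a = d + 1 ∨ a = d + 2 := by
  simp only [sortedGaps, roundSize, computeGaps, Cmd.WritesReal, Cmd.for_writesReal,
    mergeSort_writesReal, or_self, false_or] at h
  rcases h with h | h | h | h
  · exact Or.inl (loadCoords_writesReal h)
  all_goals omega

/-- The cells `b, …, b + N - 1` of the real array `d + 2` hold a sorted sequence of candidates, one
of which approximates `opt` up to the factor `d * N`. -/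
structure HasCandidates (d N : ℕ) (opt : ℝ) (b : ℤ) (s : State) : Prop where
  size : s.ints 14 0 = N
  sorted : SortedOn (s.reals (d + 2)) b N
  good : ∃ v < N, 0 < s.reals (d + 2) (b + (v : ℕ)) ∧ s.reals (d + 2) (b + (v : ℕ)) ≤ opt ∧
    opt ≤ d * N * s.reals (d + 2) (b + (v : ℕ))

theorem sortedGaps_spec (d : ℕ) (hd : 0 < d) : ∃ c, ∀ (n : ℕ)
    (P : Fin n → EuclideanSpace ℝ (Fin d)) (lam : ℕ) (s : State), 0 < n → HasInstance P lam s →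
    (0 < optPrice P lam ∧ ∃ p q, optPrice P lam = dist (P p) (P q)) →
    Runs (sortedGaps d) s (c * (n * (Nat.clog 2 (n * d) + 1))) (fun s' =>
      HasInstance P lam s' ∧
      ∃ b, s'.ints 16 0 = b ∧
        HasCandidates d (2 ^ Nat.clog 2 (n * d)) (optPrice P lam) b s') := by
  obtain ⟨c₁, hc₁⟩ := loadCoords_spec d
  obtain ⟨c₂, hc₂⟩ := mergeSort_spec (d + 1)
  obtain ⟨c₃, hc₃⟩ := mergeSort_spec (d + 2)
  refine ⟨2 * c₁ + 20 + 2 * d * c₂ + 40 * (2 * d + 1) + 2 * d * c₃, ?_⟩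
  rintro n P lam s hn hs ⟨hopt, p, q, hpq⟩
  set k := Nat.clog 2 (n * d) with hk
  have hnd : n * d ≤ 2 ^ k := Nat.le_pow_clog (by norm_num) _
  have hN2 : 2 ^ k ≤ 2 * (n * d) := two_pow_clog_le (Nat.mul_pos hn hd)
  set N := 2 ^ k with hN
  have hB : c₁ * (n + 1) + (20 * (k + 1) + (c₂ * (N * (k + 1)) + (40 * (N + 1) +
      c₃ * (N * (k + 1))))) ≤
      (2 * c₁ + 20 + 2 * d * c₂ + 40 * (2 * d + 1) + 2 * d * c₃) * (n * (k + 1)) := by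
    have e0 : n ≤ n * (k + 1) := Nat.le_mul_of_pos_right _ (by omega)
    have e1 : c₁ * (n + 1) ≤ c₁ * (2 * (n * (k + 1))) := Nat.mul_le_mul_left _ (by omega)
    have e2 : k + 1 ≤ n * (k + 1) := Nat.le_mul_of_pos_left _ hn
    have e3 : N * (k + 1) ≤ 2 * d * (n * (k + 1)) := by
      calc N * (k + 1) ≤ (2 * (n * d)) * (k + 1) := Nat.mul_le_mul_right _ hN2
        _ = _ := by ring
    have e4 := Nat.mul_le_mul_left c₂ e3
    have e5 := Nat.mul_le_mul_left c₃ e3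
    have e6 : N ≤ N * (k + 1) := Nat.le_mul_of_pos_right _ (by omega)
    have e7 : N + 1 ≤ (2 * d + 1) * (n * (k + 1)) := by
      have : (2 * d + 1) * (n * (k + 1)) = 2 * d * (n * (k + 1)) + n * (k + 1) := by ring
      omega
    have e8 := Nat.mul_le_mul_left 40 e7
    calc _ ≤ c₁ * (2 * (n * (k + 1))) + (20 * (n * (k + 1)) + (c₂ * (2 * d * (n * (k + 1))) +
          (40 * ((2 * d + 1) * (n * (k + 1))) + c₃ * (2 * d * (n * (k + 1)))))) := by omega
      _ = _ := by ring
  refine Runs.mono ?_ hB (fun s' hf h => ⟨hs.of_frame (p := sortedGaps d) hf (fun a ha => by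
    have := sortedGaps_writesInt ha
    simp only [List.mem_cons, List.not_mem_nil, or_false]; omega)
    (fun a ha => by have := sortedGaps_writesReal ha; omega), h⟩)
  refine (hc₁ s n (coord P) hs.size hs.coords).seq ?_
  intro s₁ hf₁ hload
  have h0₁ : s₁.ints 0 0 = n := by
    rw [hf₁.ints 0 fun h => by have := loadCoords_writesInt h; omega, hs.size]
  refine (roundSize_spec d n s₁ h0₁).seq ?_
  intro s₂ hf₂ h14₂
  have hr₂ : s₂.reals (d + 1) = s₁.reals (d + 1) :=
    hf₂.reals _ (by simp [roundSize, Cmd.WritesReal])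
  refine (hc₂ s₂ k h14₂).seq ?_
  rintro s₃ hf₃ ⟨b₁, hb₁, hsort₁, hcov₁⟩
  have h14₃ : s₃.ints 14 0 = N := by
    rw [hf₃.ints 14 (by simp [mergeSort_writesInt]), h14₂]
  refine (computeGaps_spec d N s₃ h14₃).seq ?_
  intro s₄ hf₄ hgaps
  have h14₄ : s₄.ints 14 0 = (2 ^ k : ℕ) := by
    rw [hf₄.ints 14 (by simp [computeGaps, Cmd.for_writesInt, Cmd.WritesInt]), h14₃]
  refine (hc₃ s₄ k h14₄).mono le_rfl ?_
  rintro s₅ hf₅ ⟨b₂, hb₂, hsort₂, hcov₂⟩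
  refine ⟨b₂, hb₂, ?_, hsort₂, ?_⟩
  · rw [hf₅.ints 14 (by simp [mergeSort_writesInt]), h14₄]
  -- every coordinate occurs in the sorted sequence
  have hocc : ∀ (i : Fin n) (j : Fin d), ∃ u < N, s₃.reals (d + 1) (b₁ + (u : ℕ)) = P i j := by
    intro i j
    have hlt : (i : ℕ) * d + j < N := by
      refine lt_of_lt_of_le ?_ hnd
      calc (i : ℕ) * d + j < i * d + d := Nat.add_lt_add_left j.2 _
        _ = (i + 1) * d := by ring
        _ ≤ n * d := Nat.mul_le_mul_right _ i.2
    obtain ⟨u, hu, he⟩ := hcov₁ _ hlt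
    refine ⟨u, hu, ?_⟩
    rw [he, hr₂, hload i i.2 j j.2, coord_eq]
  obtain ⟨t, htN, h0, hle, hge⟩ := exists_gap_dist (d := d) (N := N)
    (S := fun u => s₃.reals (d + 1) (b₁ + (u : ℕ))) hsort₁ (P p) (P q)
    (hpq ▸ hopt) (hocc p) (hocc q)
  obtain ⟨v, hv, he⟩ := hcov₂ t (by omega)
  refine ⟨v, hv, ?_⟩
  rw [he, hgaps t (by omega), hb₁, hpq]
  exact ⟨h0, hle, hge⟩

/-! ### The search for the radius -/

theorem HasSolution.congr {d n : ℕ} {P : Fin n → EuclideanSpace ℝ (Fin d)} {lam : ℕ} {r : ℝ}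
    {s s' : State} (h : HasSolution P lam r s) (h2 : s'.ints 2 = s.ints 2)
    (h3 : s'.ints 3 = s.ints 3) : HasSolution P lam r s' := by
  rw [HasSolution, h2, h3]
  exact h

/-- The radius `d * N` times the candidate at the address `e`. -/
def candRadius (d : ℕ) (e : IExp) : RExp :=
  .mul (.ofInt (.mul (.const d) (ivar 14))) (.load (d + 2) e)

/-- One step of the binary search: halve the length `ivar 23` of the interval that starts behind the
address `ivar 22`. -/
noncomputable def searchStep (d : ℕ) : Cmd :=
  .seq (.seq (iset 23 (.floor (.div (.ofInt (ivar 23)) (.ofInt (.const 2)))))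
      (rset (d + 3) (candRadius d (.add (ivar 22) (ivar 23)))))
    (.seq (tryRadius d) (.ite (.ile (.const 1) (ivar 12)) .skip
      (iset 22 (.add (ivar 22) (ivar 23)))))

/-- Binary search for a candidate whose radius is successful while the radii of all smaller
candidates are below the optimal price.  At the end, `ivar 22 + 1` is its address. -/
noncomputable def searchGap (d : ℕ) : Cmd :=
  .seq (.seq (iset 22 (.sub (.add (ivar 16) (ivar 14)) (.const 1)))
      (rset (d + 3) (candRadius d (ivar 22))))
    (.seq (tryRadius d) (.seq (.seq (iset 22 (.sub (ivar 16) (.const 1))) (iset 23 (ivar 14)))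
      (.while (.ilt (.const 1) (ivar 23)) (searchStep d))))

theorem searchStep_writesInt {d a : ℕ} (h : (searchStep d).WritesInt a) :
    a ∈ [2, 3, 4, 5, 6, 7, 8, 9, 10, 11, 12, 13, 22, 23] := by
  simp only [searchStep, Cmd.WritesInt, or_false, false_or] at h
  rcases h with h | h | h
  · simp [h]
  · have := tryRadius_writesInt h
    simp only [List.mem_cons, List.not_mem_nil, or_false] at this ⊢; omega
  · simp [h]

theorem searchStep_writesReal {d a : ℕ} (h : (searchStep d).WritesReal a) :
    d + 3 ≤ a ∧ a ≤ d + 7 := by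
  simp only [searchStep, Cmd.WritesReal, or_false, false_or] at h
  rcases h with h | h
  · omega
  · have := tryRadius_writesReal h; omega

theorem searchGap_writesInt {d a : ℕ} (h : (searchGap d).WritesInt a) :
    a ∈ [2, 3, 4, 5, 6, 7, 8, 9, 10, 11, 12, 13, 22, 23] := by
  simp only [searchGap, Cmd.WritesInt, or_false] at h
  rcases h with h | h | (h | h) | h
  · simp [h]
  · have := tryRadius_writesInt h
    simp only [List.mem_cons, List.not_mem_nil, or_false] at this ⊢; omega
  · simp [h]
  · simp [h]
  · exact searchStep_writesInt h

theorem searchGap_writesReal {d a : ℕ} (h : (searchGap d).WritesReal a) :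
    d + 3 ≤ a ∧ a ≤ d + 7 := by
  simp only [searchGap, Cmd.WritesReal, or_self, false_or] at h
  rcases h with h | h | h
  · omega
  · have := tryRadius_writesReal h; omega
  · exact searchStep_writesReal h

/-- The invariant of the binary search among the sorted candidates `G`: the first `A` candidates are
too small, and the candidate number `A + w - 1` is successful. -/
structure SearchInv {d n : ℕ} (P : Fin n → EuclideanSpace ℝ (Fin d)) (lam : ℕ) (M : ℝ) (N : ℕ)
    (b : ℤ) (G : ℕ → ℝ) (w A : ℕ) (s : State) : Prop where
  inst : HasInstance P lam s
  start : s.ints 22 0 = b + A - 1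
  len : s.ints 23 0 = w
  le : A + w ≤ N
  small : ∀ v < A, M * G v < optPrice P lam
  pos : 0 < M * G (A + w - 1)
  sol : HasSolution P lam (M * G (A + w - 1)) s

theorem searchStep_spec (d : ℕ) (hd : 0 < d) : ∃ c, ∀ (n : ℕ)
    (P : Fin n → EuclideanSpace ℝ (Fin d)) (lam N : ℕ) (b : ℤ) (G : ℕ → ℝ) (w A : ℕ) (s : State),
    lam ≤ n → 0 < optPrice P lam → 0 < w → (∀ u v, u ≤ v → v < N → G u ≤ G v) →
    s.ints 14 0 = N → (∀ v : ℕ, s.reals (d + 2) (b + v) = G v) →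
    SearchInv P lam (d * N) N b G (2 * w) A s →
    Runs (searchStep d) s (c * (n + 1))
      (fun s' => ∃ A', SearchInv P lam (d * N) N b G w A' s') := by
  obtain ⟨c, hc⟩ := tryRadius_spec d hd
  let setup : Cmd := .seq (iset 23 (.floor (.div (.ofInt (ivar 23)) (.ofInt (.const 2)))))
      (rset (d + 3) (candRadius d (.add (ivar 22) (ivar 23))))
  refine ⟨setup.maxCost + c + 20, ?_⟩
  intro n P lam N b G w A s hlam hopt hw hG h14 hGs hI
  have hB : setup.maxCost + (c * (n + 1) + (5 + 12)) ≤ (setup.maxCost + c + 20) * (n + 1) := by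
    nlinarith [Nat.zero_le (setup.maxCost * n)]
  have hle := hI.le
  have hfl : ⌊(((2 * w : ℕ) : ℤ) : ℝ) / ((2 : ℤ) : ℝ)⌋ = (w : ℤ) := by
    have : (((2 * w : ℕ) : ℤ) : ℝ) / ((2 : ℤ) : ℝ) = ((w : ℤ) : ℝ) := by push_cast; ring
    rw [this, Int.floor_intCast]
  have hcast : b + A - 1 + w = b + ((A + w - 1 : ℕ) : ℤ) := by
    rw [Nat.cast_sub (by omega)]; push_cast; ring
  refine Runs.mono ?_ hB fun _ _ h => h
  refine (Runs.effect (p := setup) (Q := fun s₁ => HasInstance P lam s₁ ∧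
    s₁.ints 22 0 = b + A - 1 ∧ s₁.ints 23 0 = w ∧ s₁.ints 2 = s.ints 2 ∧
    s₁.ints 3 = s.ints 3 ∧ s₁.reals (d + 3) 0 = d * N * G (A + w - 1))
    (by simp [setup, Cmd.LoopFree]) ?_).seq ?_
  · refine ⟨⟨?_, ?_, ?_, ?_⟩, ?_, ?_, ?_, ?_, ?_⟩
    · simpa [setup, Cmd.effect] using hI.inst.size
    · simpa [setup, Cmd.effect] using hI.inst.bound
    · intro j hj i
      have : ¬ j = d + 2 := by omega
      simpa [setup, Cmd.effect, this] using hI.inst.coords j hj i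
    · intro a
      simpa [setup, Cmd.effect] using hI.inst.fresh a
    · simpa [setup, Cmd.effect] using hI.start
    · simp only [setup, Cmd.effect, State.setReal_ints, State.setInt_ints, IExp.eval, RExp.eval,
        and_self, if_true, hI.len, hfl]
    · funext z; simp [setup, Cmd.effect]
    · funext z; simp [setup, Cmd.effect]
    · rw [Cmd.effect_seq, Cmd.effect_istore, Cmd.effect_rstore]
      simp only [candRadius, State.setReal_reals, State.setInt_ints, State.setInt_reals, IExp.eval,
        RExp.eval, and_self, if_true, hI.len, hfl, hI.start, h14, hcast, hGs, and_true,
        Nat.reduceEqDiff, if_false]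
      push_cast; ring
  rintro s₁ - ⟨hinst, h22, h23, h2, h3, hr⟩
  refine (hc n P lam _ s₁ hlam hopt hinst hr).seq ?_
  rintro s₂ hf₂ ⟨hinst₂, hres⟩
  have g22 : s₂.ints 22 0 = b + A - 1 := by
    rw [hf₂.ints 22 fun h => by have := tryRadius_writesInt h; simp at this, h22]
  have g23 : s₂.ints 23 0 = w := by
    rw [hf₂.ints 23 fun h => by have := tryRadius_writesInt h; simp at this, h23]
  refine (Runs.ite (B := 12) (fun hb => ?_) fun hb => ?_).mono
    (by simp [Test.cost, IExp.cost]) fun _ _ h => h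
  · have hb' : 1 ≤ s₂.ints 12 0 := by simpa [Test.Holds, IExp.eval] using hb
    rcases hres with ⟨-, hpos, hsol⟩ | ⟨h, -⟩
    · exact (Runs.skip ⟨A, hinst₂, g22, g23, by omega, hI.small, hpos, hsol⟩).mono
        (by norm_num) fun _ _ h => h
    · omega
  · have hb' : s₂.ints 12 0 < 1 := by simpa [Test.Holds, IExp.eval] using hb
    rcases hres with ⟨h, -⟩ | ⟨-, hlt, e2, e3⟩
    · omega
    refine (Runs.istore ?_).mono (by simp [IExp.cost]) fun _ _ h => h
    have hAw : A + w + w - 1 = A + 2 * w - 1 := by omega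
    refine ⟨A + w, ⟨by simpa using hinst₂.size, by simpa using hinst₂.bound, hinst₂.coords,
      fun a => by simpa using hinst₂.fresh a⟩, ?_, by simpa using g23, by omega, ?_, ?_, ?_⟩
    · simp [IExp.eval, g22, g23]; ring
    · intro v hv
      refine lt_of_le_of_lt (mul_le_mul_of_nonneg_left (hG v (A + w - 1) (by omega) (by omega))
        (by positivity)) hlt
    · rw [hAw]; exact hI.pos
    · rw [hAw]
      refine hI.sol.congr ?_ ?_
      · rw [State.setInt_ints_of_ne _ _ _ (by decide), e2, h2]
      · rw [State.setInt_ints_of_ne _ _ _ (by decide), e3, h3]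

theorem searchGap_spec (d : ℕ) (hd : 0 < d) : ∃ c, ∀ (n : ℕ)
    (P : Fin n → EuclideanSpace ℝ (Fin d)) (lam k : ℕ) (b : ℤ) (s : State), lam ≤ n →
    0 < optPrice P lam → HasInstance P lam s → s.ints 16 0 = b →
    HasCandidates d (2 ^ k) (optPrice P lam) b s →
    Runs (searchGap d) s (c * ((n + 1) * (k + 1))) (fun s' => HasInstance P lam s' ∧
      ∃ g, s'.reals (d + 2) (s'.ints 22 0 + 1) = g ∧ 0 < g ∧ g ≤ optPrice P lam ∧
        HasSolution P lam (d * (2 ^ k : ℕ) * g) s') := by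
  obtain ⟨c₁, hc₁⟩ := tryRadius_spec d hd
  obtain ⟨c₂, hc₂⟩ := searchStep_spec d hd
  let setup : Cmd := .seq (iset 22 (.sub (.add (ivar 16) (ivar 14)) (.const 1)))
      (rset (d + 3) (candRadius d (ivar 22)))
  refine ⟨setup.maxCost + c₁ + c₂ + 40, ?_⟩
  intro n P lam k b s hlam hopt hs h16 hcand
  set N := 2 ^ k with hN
  have hN0 : 0 < N := by positivity
  have hB : setup.maxCost + (c₁ * (n + 1) + (10 + (k * (6 + c₂ * (n + 1)) + 6))) ≤
      (setup.maxCost + c₁ + c₂ + 40) * ((n + 1) * (k + 1)) := by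
    have e1 : n + 1 ≤ (n + 1) * (k + 1) := Nat.le_mul_of_pos_right _ (by omega)
    have e2 : k + 1 ≤ (n + 1) * (k + 1) := Nat.le_mul_of_pos_left _ (by omega)
    have e3 : 1 ≤ (n + 1) * (k + 1) := Nat.mul_pos (by omega) (by omega)
    have e4 : k * (n + 1) ≤ (n + 1) * (k + 1) := by nlinarith
    have f1 := Nat.mul_le_mul_left c₁ e1
    have f2 := Nat.mul_le_mul_left c₂ e4
    have f3 := Nat.mul_le_mul_left setup.maxCost e3
    have f4 : k * (6 + c₂ * (n + 1)) = 6 * k + c₂ * (k * (n + 1)) := by ring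
    have f5 : (setup.maxCost + c₁ + c₂ + 40) * ((n + 1) * (k + 1)) =
        setup.maxCost * ((n + 1) * (k + 1)) + c₁ * ((n + 1) * (k + 1)) +
        c₂ * ((n + 1) * (k + 1)) + 40 * ((n + 1) * (k + 1)) := by ring
    rw [f4, f5]
    omega
  set G : ℕ → ℝ := fun v => s.reals (d + 2) (b + v) with hGdef
  have hG : ∀ u v, u ≤ v → v < N → G u ≤ G v := hcand.sorted
  obtain ⟨v₀, hv₀, hpos₀, hle₀, hge₀⟩ := hcand.good
  have hM : (0 : ℝ) < d * N := by positivity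
  refine Runs.mono ?_ hB fun _ _ h => h
  have hcast : b + N - 1 = b + ((N - 1 : ℕ) : ℤ) := by
    rw [Nat.cast_sub hN0]; push_cast; ring
  -- the largest candidate is successful, since it is at least the good candidate
  refine (Runs.effect (p := setup) (Q := fun s₁ => HasInstance P lam s₁ ∧
    s₁.reals (d + 3) 0 = d * N * G (N - 1))
    (by simp [setup, Cmd.LoopFree]) ?_).seq ?_
  · refine ⟨⟨?_, ?_, ?_, ?_⟩, ?_⟩
    · simpa [setup, Cmd.effect] using hs.size
    · simpa [setup, Cmd.effect] using hs.bound
    · intro j hj i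
      have : ¬ j = d + 2 := by omega
      simpa [setup, Cmd.effect, this] using hs.coords j hj i
    · intro a
      simpa [setup, Cmd.effect] using hs.fresh a
    · rw [Cmd.effect_seq, Cmd.effect_istore, Cmd.effect_rstore]
      simp only [candRadius, State.setReal_reals, State.setInt_ints, State.setInt_reals, IExp.eval,
        RExp.eval, and_self, if_true, h16, hcand.size, hcast, and_true, hGdef,
        Nat.reduceEqDiff, if_false]
      push_cast; ring
  rintro s₁ hf₁ ⟨hinst₁, hr⟩
  refine (hc₁ n P lam _ s₁ hlam hopt hinst₁ hr).seq ?_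
  rintro s₂ hf₂ ⟨hinst₂, hres⟩
  have hsol : 0 < d * N * G (N - 1) ∧ HasSolution P lam (d * N * G (N - 1)) s₂ := by
    rcases hres with ⟨-, hpos, hsol⟩ | ⟨-, hlt, -⟩
    · exact ⟨hpos, hsol⟩
    · have := mul_le_mul_of_nonneg_left (hG v₀ (N - 1) (by omega) (by omega)) hM.le
      exact absurd (hge₀.trans this) (not_le.2 hlt)
  have hv₂ : ∀ v ∈ [14, 16], s₂.ints v = s.ints v := by
    intro v hv
    rw [hf₂.ints v fun h => by
        have := tryRadius_writesInt h
        simp only [List.mem_cons, List.not_mem_nil, or_false] at hv this; omega,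
      hf₁.ints v fun h => by
        simp only [setup, Cmd.WritesInt, or_false] at h
        simp only [List.mem_cons, List.not_mem_nil, or_false] at hv; omega]
  refine (Runs.effect (p := .seq (iset 22 (.sub (ivar 16) (.const 1))) (iset 23 (ivar 14)))
    (Q := fun s₃ => SearchInv P lam (d * N) N b G N 0 s₃) (by simp [Cmd.LoopFree]) ?_).seq (B₁ := 10) (B₂ := k * (6 + c₂ * (n + 1)) + 6) ?_
  · rw [Cmd.effect_seq, Cmd.effect_istore, Cmd.effect_istore]
    refine ⟨⟨by simpa using hinst₂.size, by simpa using hinst₂.bound, hinst₂.coords,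
      fun a => by simpa using hinst₂.fresh a⟩, ?_, ?_, by omega, fun v hv => by omega, ?_, ?_⟩
    · simp [IExp.eval, hv₂ 16 (by simp), h16]
    · simp [IExp.eval, hv₂ 14 (by simp), hcand.size]
    · simpa using hsol.1
    · simpa using hsol.2.congr (by funext z; simp) (by funext z; simp)
  intro s₃ hf₃ hI₃
  have hfr : ∀ s', Frame (searchGap d) s s' → s'.ints 14 0 = N ∧
      ∀ v : ℕ, s'.reals (d + 2) (b + v) = G v := by
    intro s' hf
    rw [hf.ints 14 fun h => by have := searchGap_writesInt h; simp at this,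
      hf.reals (d + 2) fun h => by have := searchGap_writesReal h; omega]
    exact ⟨hcand.size, fun v => rfl⟩
  have hfr₁₂ : Frame (searchGap d) s₁ s₂ :=
    hf₂.mono (fun a h => Or.inr (Or.inl h)) (fun a h => Or.inr (Or.inl h))
  have hfr₂₃ : Frame (searchGap d) s₂ s₃ :=
    hf₃.mono (fun a h => Or.inr (Or.inr (Or.inl h))) (fun a h => Or.inr (Or.inr (Or.inl h)))
  have hfr₃ : Frame (searchGap d) s s₃ :=
    (hf₁.mono (q := searchGap d) (fun a h => Or.inl h) (fun a h => Or.inl h)).trans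
      (hfr₁₂.trans hfr₂₃)
  have hI₃' : ∃ A, SearchInv P lam (d * N) N b G (2 ^ k) A s₃ := ⟨0, hI₃⟩
  refine (Runs.while (B := c₂ * (n + 1)) (N := k)
    (fun r s' => ∃ A, SearchInv P lam (d * N) N b G (2 ^ r) A s') ?_ ?_ hI₃').mono
    (le_of_eq (by norm_num [Test.cost, IExp.cost])) ?_
  · rintro s' - ⟨A, hI⟩
    simp [Test.Holds, IExp.eval, hI.len]
  · rintro r s' hf ⟨A, hI⟩ -
    obtain ⟨g14, gG⟩ := hfr s' (hfr₃.trans (hf.mono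
      (fun a h => Or.inr (Or.inr (Or.inr h))) (fun a h => Or.inr (Or.inr (Or.inr h)))))
    exact hc₂ n P lam N b G (2 ^ r) A s' hlam hopt (by positivity) hG g14 gG
      (by rwa [pow_succ'] at hI)
  · rintro s' hf ⟨hb, r, hr, A, hI⟩
    have hr0 : r = 0 := by
      by_contra hr0
      have h1 : 2 ^ 1 ≤ 2 ^ r := Nat.pow_le_pow_right (by norm_num) (by omega)
      simp only [Test.Holds, IExp.eval, hI.len, not_not] at hb
      have h2 : (2 ^ r : ℕ) ≤ 1 := by exact_mod_cast hb
      omega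
    subst hr0
    have hA : A + 2 ^ 0 - 1 = A := by simp
    have hAN := hI.le
    obtain ⟨-, gG⟩ := hfr s' (hfr₃.trans (hf.mono
      (fun a h => Or.inr (Or.inr (Or.inr h))) (fun a h => Or.inr (Or.inr (Or.inr h)))))
    have hpos := hI.pos
    have hsolA := hI.sol
    rw [hA] at hpos hsolA
    refine ⟨hI.inst, G A, ?_, ?_, ?_, hsolA⟩
    · rw [hI.start, ← gG A]; congr 1; ring
    · exact pos_of_mul_pos_right hpos hM.le
    · -- the good candidate is not among the smaller ones
      have hAv : A ≤ v₀ := by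
        by_contra! h
        exact absurd (hI.small v₀ h) (not_lt.2 hge₀)
      exact (hG A v₀ hAv hv₀).trans hle₀

/-- One bisection step between the lower bound `rvar (d + 8)` for the optimal price and the
successful radius `rvar (d + 9)`. -/
noncomputable def bisectStep (d : ℕ) : Cmd :=
  .seq (rset (d + 3) (.div (.add (rvar (d + 8)) (rvar (d + 9))) (.ofInt (.const 2))))
    (.seq (tryRadius d) (.ite (.ile (.const 1) (ivar 12)) (rset (d + 9) (rvar (d + 3)))
      (rset (d + 8) (rvar (d + 3)))))

/-- Bisection until the relative error is at most `ε / 4`. -/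
noncomputable def bisect (d : ℕ) : Cmd :=
  .while (.not (.rle (.mul (.ofInt (.const 4)) (.sub (rvar (d + 9)) (rvar (d + 8))))
    (.mul (rvar 0) (rvar (d + 8))))) (bisectStep d)

theorem bisectStep_writesReal {d a : ℕ} (h : (bisectStep d).WritesReal a) :
    d + 3 ≤ a ∧ a ≤ d + 9 := by
  simp only [bisectStep, Cmd.WritesReal] at h
  rcases h with h | h | h | h
  · omega
  · have := tryRadius_writesReal h; omega
  all_goals omega

/-- The invariant of the bisection, with the bound `E` for the error. -/
structure BisectInv {d n : ℕ} (P : Fin n → EuclideanSpace ℝ (Fin d)) (lam : ℕ) (E : ℝ)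
    (s : State) : Prop where
  inst : HasInstance P lam s
  pos : 0 < s.reals (d + 8) 0
  le : s.reals (d + 8) 0 ≤ optPrice P lam
  sol : HasSolution P lam (s.reals (d + 9) 0) s
  error : 4 * (s.reals (d + 9) 0 - s.reals (d + 8) 0) ≤ E * s.reals (d + 8) 0

theorem bisectStep_spec (d : ℕ) (hd : 0 < d) : ∃ c, ∀ (n : ℕ)
    (P : Fin n → EuclideanSpace ℝ (Fin d)) (lam : ℕ) (E : ℝ) (s : State), lam ≤ n → 0 ≤ E →
    BisectInv P lam (2 * E) s → 0 < s.reals (d + 9) 0 - s.reals (d + 8) 0 →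
    Runs (bisectStep d) s (c * (n + 1)) (BisectInv P lam E) := by
  obtain ⟨c, hc⟩ := tryRadius_spec d hd
  refine ⟨c + 40, ?_⟩
  intro n P lam E s hlam hE hI hlt
  have hopt : 0 < optPrice P lam := hI.pos.trans_le hI.le
  set lo := s.reals (d + 8) 0 with hlo
  set hi := s.reals (d + 9) 0 with hhi
  have hlo0 : 0 < lo := hI.pos
  have herr : 4 * (hi - lo) ≤ 2 * E * lo := hI.error
  refine Runs.mono (B := 10 + (c * (n + 1) + (10 + 5))) ?_ (by nlinarith) fun _ _ h => h
  refine ((Runs.rstore (Q := fun s₁ => s₁ = s.setReal (d + 3) 0 ((lo + hi) / 2)) (by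
    simp [IExp.eval, RExp.eval, ← hlo, ← hhi])).mono
    (by simp [IExp.cost, RExp.cost]) fun _ _ h => h).seq ?_
  rintro s₁ hf₁ hs₁
  have hinst₁ : HasInstance P lam s₁ := hI.inst.of_frame hf₁ (by simp [Cmd.WritesInt])
    (by simp [Cmd.WritesReal])
  refine (hc n P lam ((lo + hi) / 2) s₁ hlam hopt hinst₁ (by simp [hs₁])).seq ?_
  rintro s₂ hf₂ ⟨hinst₂, hres⟩
  have g : ∀ v, v = d + 3 ∨ v = d + 8 ∨ v = d + 9 → s₂.reals v = s₁.reals v := by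
    intro v hv
    exact hf₂.reals v fun h => by have := tryRadius_writesReal h; omega
  have g3 : s₂.reals (d + 3) 0 = (lo + hi) / 2 := by rw [g _ (by omega), hs₁]; simp
  have g8 : s₂.reals (d + 8) 0 = lo := by rw [g _ (by omega), hs₁]; simp [hlo]
  have g9 : s₂.reals (d + 9) 0 = hi := by rw [g _ (by omega), hs₁]; simp [hhi]
  refine (Runs.ite (B := 5) (fun hb => ?_) fun hb => ?_).mono
    (by simp [Test.cost, IExp.cost]) fun _ _ h => h
  · have hb' : 1 ≤ s₂.ints 12 0 := by simpa [Test.Holds, IExp.eval] using hb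
    rcases hres with ⟨-, hpos, hsol⟩ | ⟨h, -⟩
    · refine (Runs.rstore ?_).mono (by simp [IExp.cost, RExp.cost]) fun s' hf h => h
      refine ⟨⟨hinst₂.size, hinst₂.bound, fun j hj i => ?_, hinst₂.fresh⟩, ?_, ?_, ?_, ?_⟩
      · rw [State.setReal_reals_of_ne _ _ _ (by omega)]
        exact hinst₂.coords j hj i
      · simpa [g8] using hlo0
      · simpa [g8] using hI.le
      · simp only [IExp.eval, RExp.eval, State.setReal_reals, and_self, if_true, g3]
        exact hsol
      · simp only [IExp.eval, RExp.eval, State.setReal_reals, and_self, if_true, g3, g8,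
          Nat.add_left_cancel_iff, Nat.reduceEqDiff, false_and, if_false]
        linarith
    · omega
  · have hb' : s₂.ints 12 0 < 1 := by simpa [Test.Holds, IExp.eval] using hb
    rcases hres with ⟨h, -⟩ | ⟨-, hlt', e2, e3⟩
    · omega
    refine (Runs.rstore ?_).mono (by simp [IExp.cost, RExp.cost]) fun s' hf h => h
    refine ⟨⟨hinst₂.size, hinst₂.bound, fun j hj i => ?_, hinst₂.fresh⟩, ?_, ?_, ?_, ?_⟩
    · rw [State.setReal_reals_of_ne _ _ _ (by omega)]
      exact hinst₂.coords j hj i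
    · simp only [IExp.eval, RExp.eval, State.setReal_reals, and_self, if_true, g3]
      linarith
    · simp only [IExp.eval, RExp.eval, State.setReal_reals, and_self, if_true, g3]
      exact hlt'.le
    · simp only [IExp.eval, RExp.eval, State.setReal_reals, g9,
          Nat.add_left_cancel_iff, Nat.reduceEqDiff, false_and, if_false]
      refine hI.sol.congr ?_ ?_
      · rw [State.setReal_ints, e2, hs₁]; rfl
      · rw [State.setReal_ints, e3, hs₁]; rfl
    · simp only [IExp.eval, RExp.eval, State.setReal_reals, and_self, if_true, g3, g9,
          Nat.add_left_cancel_iff, Nat.reduceEqDiff, false_and, if_false]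
      nlinarith

theorem bisect_spec (d : ℕ) (hd : 0 < d) : ∃ c, ∀ (n : ℕ)
    (P : Fin n → EuclideanSpace ℝ (Fin d)) (lam : ℕ) (ε : ℝ) (r : ℕ) (s : State), lam ≤ n →
    0 < ε → s.reals 0 0 = ε → BisectInv P lam (2 ^ r * ε) s →
    Runs (bisect d) s (c * ((n + 1) * (r + 1))) (BisectInv P lam ε) := by
  obtain ⟨c, hc⟩ := bisectStep_spec d hd
  refine ⟨c + 20, ?_⟩
  intro n P lam ε r s hlam hε h0 hI
  have hB : r * (16 + c * (n + 1)) + 16 ≤ (c + 20) * ((n + 1) * (r + 1)) := by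
    nlinarith [Nat.zero_le (c * (n + 1)), Nat.zero_le (n * r)]
  have hfr : ∀ s', Frame (bisectStep d) s s' → s'.reals 0 0 = ε := by
    intro s' hf
    rw [hf.reals 0 fun h => by have := bisectStep_writesReal h; omega, h0]
  refine (Runs.while (B := c * (n + 1)) (N := r) (fun r s' => BisectInv P lam (2 ^ r * ε) s')
    ?_ ?_ hI).mono (le_trans (le_of_eq (by norm_num [Test.cost, IExp.cost, RExp.cost])) hB) ?_
  · intro s' hf hI
    have := hI.error
    simp [Test.Holds, IExp.eval, RExp.eval, hfr s' hf]
    simpa using this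
  · intro r s' hf hI hb
    have hb' : ε * s'.reals (d + 8) 0 < 4 * (s'.reals (d + 9) 0 - s'.reals (d + 8) 0) := by
      simpa [Test.Holds, IExp.eval, RExp.eval, hfr s' hf] using hb
    refine hc n P lam (2 ^ r * ε) s' hlam (by positivity) (by rwa [← mul_assoc, ← pow_succ']) ?_
    have := mul_pos hε hI.pos
    linarith
  · rintro s' hf ⟨hb, r, hr, hI⟩
    have g0 : s'.reals 0 0 = ε := by
      rw [Frame.reals (p := bisect d) hf 0 fun h => by have := bisectStep_writesReal h; omega, h0]
    have hb' : 4 * (s'.reals (d + 9) 0 - s'.reals (d + 8) 0) ≤ ε * s'.reals (d + 8) 0 := by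
      simpa [Test.Holds, IExp.eval, RExp.eval, g0] using hb
    exact ⟨hI.inst, hI.pos, hI.le, hI.sol, hb'⟩

/-! ### The program -/

/-- Every point is its own center. -/
def trivialSolution (d : ℕ) : Cmd :=
  .seq (.for 10 (ivar 0) (.seq (.istore 2 (ivar 10) (ivar 10)) (.istore 3 (ivar 10) (.const 1))))
    (rset (d + 1) (.ofInt (.const 0)))

/-- The program for the case that every center has to serve at least two points. -/
noncomputable def generalSolution (d : ℕ) : Cmd :=
  .seq (sortedGaps d) (.seq (searchGap d) (.seq
    (.seq (rset (d + 8) (.load (d + 2) (.add (ivar 22) (.const 1))))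
      (rset (d + 9) (candRadius d (.add (ivar 22) (.const 1)))))
    (.seq (bisect d) (rset (d + 1) (.mul (.ofInt (.const 4)) (rvar (d + 9)))))))

theorem hasInstance_input {d n : ℕ} (P : Fin n → EuclideanSpace ℝ (Fin d)) (lam : ℕ) (ε : ℝ) :
    HasInstance P lam (input P lam ε) := by
  refine ⟨by simp [input], by simp [input], ?_, by simp [input]⟩
  intro j hj i
  simp only [input, coord, Int.toNat_natCast]
  by_cases h : j < d ∧ i < n
  · rw [dif_pos h, dif_pos ⟨h.1, by omega, h.2⟩]
  · rw [dif_neg h, dif_neg fun h' => h ⟨h'.1, h'.2.2⟩]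

/-- The memory contains a solution and a bound `ρ` for its price that is at most `4 + ε` times the
optimal price. -/
def IsApproximation {d n : ℕ} (P : Fin n → EuclideanSpace ℝ (Fin d)) (lam : ℕ) (ε : ℝ)
    (s : State) : Prop :=
  ∃ (C : Finset (Fin n)) (f : Fin n → Fin n) (ρ : ℝ), IsOutput d s C f ρ ∧ IsSolution lam C f ∧
    price P f ≤ ρ ∧ ρ ≤ (4 + ε) * optPrice P lam

theorem trivialSolution_spec (d : ℕ) : ∃ c, ∀ (n : ℕ) (P : Fin n → EuclideanSpace ℝ (Fin d))
    (ε : ℝ), 0 < ε →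
    Runs (trivialSolution d) (input P 1 ε) (c * (n + 1)) (IsApproximation P 1 ε) := by
  let q : Cmd := .seq (.istore 2 (ivar 10) (ivar 10)) (.istore 3 (ivar 10) (.const 1))
  refine ⟨13 + q.maxCost + 10, ?_⟩
  intro n P ε hε
  set s := input P 1 ε with hs
  have key : Runs (.for 10 (ivar 0) q) s (n * (13 + q.maxCost) + 13)
      (fun s' => ∀ i < n, s'.ints 2 (i : ℕ) = (i : ℤ) ∧ s'.ints 3 (i : ℕ) = 1) := by
    refine Runs.for (N := n) (B := q.maxCost)
      (fun m s' => ∀ i < m, s'.ints 2 (i : ℕ) = (i : ℤ) ∧ s'.ints 3 (i : ℕ) = 1) ?_ ?_ ?_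
    · intro i hi; omega
    · intro s' hf
      simp only [IExp.eval]
      rw [hf.ints 0 (by simp [Cmd.for_writesInt, q, Cmd.WritesInt])]
      exact (hasInstance_input P 1 ε).size
    · intro m s₁ hm hf h10 hI
      refine Runs.effect (by simp [q, Cmd.LoopFree]) ?_
      rw [Cmd.effect_seq, Cmd.effect_istore, Cmd.effect_istore]
      refine ⟨by simpa using h10, fun i hi => ?_⟩
      by_cases him : i = m
      · simp [IExp.eval, h10, him]
      · simpa [IExp.eval, h10, him] using hI i (by omega)
  refine (key.seq (B₂ := 4) (Q := IsApproximation P 1 ε) fun s₁ hf₁ h₁ => (Runs.rstore ?_).mono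
    (by simp [IExp.cost, RExp.cost]) fun _ _ h => h).mono (by linarith) fun _ _ h => h
  refine ⟨Finset.univ, id, 0, ⟨?_, ?_, ?_⟩, ⟨by simp, ?_⟩, ?_, ?_⟩
  · intro i; simpa using (h₁ i i.2).1
  · intro i; simpa using (h₁ i i.2).2
  · simp [IExp.eval, RExp.eval]
  · intro c _
    simp [Finset.filter_eq']
  · simp [price]
  · exact mul_nonneg (by linarith) (optPrice_nonneg P 1)

theorem generalSolution_spec (d : ℕ) (hd : 0 < d) : ∃ c, ∀ (n : ℕ)
    (P : Fin n → EuclideanSpace ℝ (Fin d)) (lam : ℕ) (ε : ℝ) (r : ℕ), Function.Injective P →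
    2 ≤ lam → lam ≤ n → 0 < ε → 4 * (d * (2 ^ Nat.clog 2 (n * d) : ℕ)) ≤ 2 ^ r * ε →
    Runs (generalSolution d) (input P lam ε) (c * (n * (Nat.clog 2 (n * d) + r + 1)))
      (IsApproximation P lam ε) := by
  obtain ⟨c₁, hc₁⟩ := sortedGaps_spec d hd
  obtain ⟨c₂, hc₂⟩ := searchGap_spec d hd
  obtain ⟨c₃, hc₃⟩ := bisect_spec d hd
  refine ⟨c₁ + 2 * c₂ + 2 * c₃ + 40, ?_⟩
  intro n P lam ε r hP hlam2 hlam hε hr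
  set s := input P lam ε with hs
  have hinst := hasInstance_input P lam ε
  have hopt := exists_optPrice_eq_dist P hP hlam2 hlam
  set k := Nat.clog 2 (n * d) with hk
  have hB : c₁ * (n * (k + 1)) + (c₂ * ((n + 1) * (k + 1)) + (30 + (c₃ * ((n + 1) * (r + 1)) + 7)))
      ≤ (c₁ + 2 * c₂ + 2 * c₃ + 40) * (n * (k + r + 1)) := by
    have e1 : n * (k + 1) ≤ n * (k + r + 1) := Nat.mul_le_mul_left _ (by omega)
    have e2 : (n + 1) * (k + 1) ≤ 2 * (n * (k + r + 1)) := by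
      rw [← mul_assoc]; exact Nat.mul_le_mul (by omega) (by omega)
    have e3 : (n + 1) * (r + 1) ≤ 2 * (n * (k + r + 1)) := by
      rw [← mul_assoc]; exact Nat.mul_le_mul (by omega) (by omega)
    have e4 : 1 ≤ n * (k + r + 1) := Nat.mul_pos (by omega) (by omega)
    have f1 := Nat.mul_le_mul_left c₁ e1
    have f2 := Nat.mul_le_mul_left c₂ e2
    have f3 := Nat.mul_le_mul_left c₃ e3
    linarith
  refine Runs.mono ?_ hB fun _ _ h => h
  refine (hc₁ n P lam s (by omega) hinst hopt).seq ?_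
  rintro s₁ hf₁ ⟨hinst₁, b, h16, hcand⟩
  have hε₁ : s₁.reals 0 0 = ε := by
    rw [hf₁.reals 0 fun h => by have := sortedGaps_writesReal h; omega]
    simp [hs, input]
  refine (hc₂ n P lam k b s₁ hlam hopt.1 hinst₁ h16 hcand).seq ?_
  rintro s₂ hf₂ ⟨hinst₂, g, hg, hg0, hgle, hsol⟩
  have hε₂ : s₂.reals 0 0 = ε := by
    rw [hf₂.reals 0 fun h => by have := searchGap_writesReal h; omega, hε₁]
  have h14₂ : s₂.ints 14 0 = (2 ^ k : ℕ) := by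
    rw [hf₂.ints 14 fun h => by have := searchGap_writesInt h; simp at this]
    exact hcand.size
  refine (Runs.effect (p := .seq (rset (d + 8) (.load (d + 2) (.add (ivar 22) (.const 1))))
      (rset (d + 9) (candRadius d (.add (ivar 22) (.const 1)))))
    (Q := fun s₃ => s₃.reals 0 0 = ε ∧ BisectInv P lam (2 ^ r * ε) s₃)
    (by simp [Cmd.LoopFree]) ?_).mono (B' := 30)
    (by simp [Cmd.maxCost, candRadius, IExp.cost, RExp.cost]) (fun _ _ h => h) |>.seq ?_
  · rw [Cmd.effect_seq, Cmd.effect_rstore, Cmd.effect_rstore]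
    have h8 : (RExp.load (d + 2) (.add (ivar 22) (.const 1))).eval s₂ = g := by
      simpa [RExp.eval, IExp.eval] using hg
    have h9 : (candRadius d (.add (ivar 22) (.const 1))).eval
        (s₂.setReal (d + 8) ((IExp.const 0).eval s₂)
          ((RExp.load (d + 2) (.add (ivar 22) (.const 1))).eval s₂)) =
        d * (2 ^ k : ℕ) * g := by
      simp [candRadius, RExp.eval, IExp.eval, h14₂, hg]
    rw [h9, h8]
    have hr8 : ((s₂.setReal (d + 8) ((IExp.const 0).eval s₂) g).setReal (d + 9)
        ((IExp.const 0).eval (s₂.setReal (d + 8) ((IExp.const 0).eval s₂) g))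
        (d * (2 ^ k : ℕ) * g)).reals (d + 8) 0 = g := by simp [IExp.eval]
    have hr9 : ((s₂.setReal (d + 8) ((IExp.const 0).eval s₂) g).setReal (d + 9)
        ((IExp.const 0).eval (s₂.setReal (d + 8) ((IExp.const 0).eval s₂) g))
        (d * (2 ^ k : ℕ) * g)).reals (d + 9) 0 = d * (2 ^ k : ℕ) * g := by simp [IExp.eval]
    refine ⟨by simpa using hε₂, ⟨hinst₂.size, hinst₂.bound, fun j hj i => ?_, hinst₂.fresh⟩,
      ?_, ?_, ?_, ?_⟩
    · rw [State.setReal_reals_of_ne _ _ _ (by omega), State.setReal_reals_of_ne _ _ _ (by omega)]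
      exact hinst₂.coords j hj i
    · rw [hr8]; exact hg0
    · rw [hr8]; exact hgle
    · rw [hr9]; exact hsol
    · rw [hr8, hr9]
      have := mul_le_mul_of_nonneg_right hr hg0.le
      linarith
  rintro s₃ - ⟨hε₃, hI₃⟩
  refine (hc₃ n P lam ε r s₃ hlam hε hε₃ hI₃).seq ?_
  rintro s₄ - hI₄
  refine (Runs.rstore ?_).mono (by simp [IExp.cost, RExp.cost]) fun _ _ h => h
  obtain ⟨C, f, h2, h3, hsolCf, hprice⟩ := hI₄.sol
  refine ⟨C, f, 4 * s₄.reals (d + 9) 0, ⟨h2, h3, by simp [IExp.eval, RExp.eval]⟩, hsolCf, hprice,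
    ?_⟩
  have h1 := hI₄.error
  have h4 := mul_le_mul_of_nonneg_left hI₄.le (by linarith : 0 ≤ 4 + ε)
  linarith

/-! ### The running time -/

/-- The numbers of iterations of the two searches are logarithmic. -/
theorem exists_iterations (d : ℕ) (hd : 0 < d) : ∃ A : ℝ, ∀ (n : ℕ) (ε : ℝ), 2 ≤ n → 0 < ε →
    ∃ r : ℕ, 4 * (d * (2 ^ Nat.clog 2 (n * d) : ℕ)) ≤ 2 ^ r * ε ∧
      ((Nat.clog 2 (n * d) + r + 1 : ℕ) : ℝ) ≤ A * Real.log (n / min ε 1) := by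
  have hl2 : 0 < Real.log 2 := Real.log_pos (by norm_num)
  have hd1 : (1 : ℝ) ≤ d := by exact_mod_cast hd
  set D : ℝ := Real.log (8 * d ^ 2) with hD
  have hD0 : 0 ≤ D := Real.log_nonneg (by nlinarith)
  refine ⟨(2 * (D / Real.log 2 + 1) + 2) / Real.log 2, ?_⟩
  intro n ε hn hε
  set e := min ε 1 with he
  have he0 : 0 < e := lt_min hε one_pos
  have he1 : e ≤ 1 := min_le_right _ _
  have hn2 : (2 : ℝ) ≤ n := by exact_mod_cast hn
  set L := Real.log (n / e) with hL
  have hne : (n : ℝ) ≤ n / e := by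
    rw [le_div_iff₀ he0]; nlinarith
  have hL2 : Real.log 2 ≤ L := Real.log_le_log (by norm_num) (hn2.trans hne)
  have hL0 : 0 ≤ L := hl2.le.trans hL2
  set k := Nat.clog 2 (n * d) with hk
  have hN2 : ((2 : ℝ) ^ k) ≤ 2 * (n * d) := by
    have h4 := two_pow_clog_le (Nat.mul_pos (by omega : 0 < n) hd)
    exact_mod_cast h4
  have hpos : 0 < 8 * (d : ℝ) ^ 2 * (n / e) := by positivity
  have hlogprod : Real.log (8 * (d : ℝ) ^ 2 * (n / e)) = D + L :=
    Real.log_mul (by positivity) (by positivity)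
  have hkL : k * Real.log 2 ≤ D + L := by
    rw [← Real.log_pow, ← hlogprod]
    refine Real.log_le_log (by positivity) (hN2.trans ?_)
    have h1 : (d : ℝ) ≤ d ^ 2 := by nlinarith
    have : 2 * (n * (d : ℝ)) ≤ 8 * (d : ℝ) ^ 2 * n := by
      nlinarith [mul_le_mul_of_nonneg_left h1 (by linarith : (0 : ℝ) ≤ n)]
    exact this.trans (mul_le_mul_of_nonneg_left hne (by positivity))
  set r := ⌈(D + L) / Real.log 2⌉₊ with hr
  have hrle : (r : ℝ) ≤ (D + L) / Real.log 2 + 1 :=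
    (Nat.ceil_lt_add_one (by positivity)).le
  refine ⟨r, ?_, ?_⟩
  · have h1 : D + L ≤ r * Real.log 2 := by
      rw [← div_le_iff₀ hl2]; exact Nat.le_ceil _
    rw [← hlogprod, ← Real.log_pow] at h1
    have h2 := (Real.log_le_log_iff hpos (by positivity)).1 h1
    push_cast
    calc 4 * ((d : ℝ) * 2 ^ k) ≤ 4 * (d * (2 * (n * d))) := by gcongr
      _ = 8 * d ^ 2 * (n / e) * e := by field_simp; ring
      _ ≤ 2 ^ r * e := mul_le_mul_of_nonneg_right h2 he0.le
      _ ≤ 2 ^ r * ε := mul_le_mul_of_nonneg_left (min_le_left _ _) (by positivity)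
  · have h1 : (k : ℝ) ≤ (D + L) / Real.log 2 := by rwa [le_div_iff₀ hl2]
    have h2 : 1 ≤ L / Real.log 2 := by rwa [le_div_iff₀ hl2, one_mul]
    have h3 : D / Real.log 2 ≤ D / Real.log 2 * (L / Real.log 2) :=
      le_mul_of_one_le_right (by positivity) h2
    have h4 : (D + L) / Real.log 2 = D / Real.log 2 + L / Real.log 2 := add_div _ _ _
    have h5 : (2 * (D / Real.log 2 + 1) + 2) / Real.log 2 * L =
        2 * (D / Real.log 2 * (L / Real.log 2)) + 4 * (L / Real.log 2) := by ring
    push_cast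
    rw [h5]
    rw [h4] at h1 hrle
    linarith

end RealRAM

theorem mainTheorem3 (d : ℕ) :
    ∃ (prog : RealRAM.Cmd) (K : ℝ),
      ∀ (n lam : ℕ) (P : Fin n → EuclideanSpace ℝ (Fin d)) (ε : ℝ),
        Function.Injective P → 1 ≤ lam → lam ≤ n → 0 < ε →
        ∃ (t : ℕ) (s : RealRAM.State) (C : Finset (Fin n)) (f : Fin n → Fin n) (ρ : ℝ),
          RealRAM.Exec prog (LBC.input P lam ε) t s ∧
          (t : ℝ) ≤ K * (1 + n * Real.log (n / min ε 1)) ∧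
          LBC.IsOutput d s C f ρ ∧
          LBC.IsSolution lam C f ∧
          LBC.price P f ≤ ρ ∧
          ρ ≤ (4 + ε) * LBC.optPrice P lam := by
  obtain ⟨c₁, hc₁⟩ := RealRAM.trivialSolution_spec d
  obtain ⟨c₂, A, hc₂⟩ : ∃ (c : ℕ) (A : ℝ), ∀ (n : ℕ) (P : Fin n → EuclideanSpace ℝ (Fin d))
      (lam : ℕ) (ε : ℝ), Function.Injective P → 2 ≤ lam → lam ≤ n → 0 < ε →
      ∃ m : ℕ, (m : ℝ) ≤ A * Real.log (n / min ε 1) ∧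
        RealRAM.Runs (RealRAM.generalSolution d) (LBC.input P lam ε) (c * (n * m))
          (RealRAM.IsApproximation P lam ε) := by
    rcases Nat.eq_zero_or_pos d with rfl | hd
    · -- there is only one point in dimension `0`
      refine ⟨0, 0, fun n P lam ε hP h2 hn _ => ?_⟩
      have h01 : (⟨0, by omega⟩ : Fin n) = ⟨1, by omega⟩ := hP (Subsingleton.elim _ _)
      simp at h01
    · obtain ⟨c, hc⟩ := RealRAM.generalSolution_spec d hd
      obtain ⟨A, hA⟩ := RealRAM.exists_iterations d hd
      refine ⟨c, A, fun n P lam ε hP h2 hn hε => ?_⟩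
      obtain ⟨r, hr, hle⟩ := hA n ε (by omega) hε
      exact ⟨_, hle, hc n P lam ε r hP h2 hn hε hr⟩
  have hl2 : 1 / 2 ≤ Real.log 2 := by linarith [Real.log_two_gt_d9]
  refine ⟨.ite (.ile (RealRAM.ivar 1) (.const 1)) (RealRAM.trivialSolution d)
    (RealRAM.generalSolution d), 5 + 3 * c₁ + c₂ * |A|, ?_⟩
  intro n lam P ε hP h1 hn hε
  set L := Real.log (n / min ε 1) with hL
  have hn1 : (1 : ℝ) ≤ n := by exact_mod_cast h1.trans hn
  have he0 : 0 < min ε 1 := lt_min hε one_pos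
  have hne : (n : ℝ) ≤ n / min ε 1 := by
    rw [le_div_iff₀ he0]; nlinarith [min_le_right ε 1]
  have hL0 : 0 ≤ L := Real.log_nonneg (hn1.trans hne)
  -- for `n = 1` the logarithm may vanish, and the number of steps is bounded by a constant
  have hnL : (n : ℝ) + 1 ≤ 3 * (1 + n * L) := by
    rcases Nat.lt_or_ge n 2 with h | h
    · have hn' : (n : ℝ) ≤ 1 := by exact_mod_cast Nat.lt_succ_iff.1 h
      nlinarith
    · have h2 : (2 : ℝ) ≤ n := by exact_mod_cast h
      have : 1 / 2 ≤ L := hl2.trans (Real.log_le_log (by norm_num) (h2.trans hne))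
      nlinarith
  have hnL0 : 0 ≤ n * L := by positivity
  suffices H : ∃ B : ℕ, (B : ℝ) ≤ (5 + 3 * c₁ + c₂ * |A|) * (1 + n * L) ∧
      RealRAM.Runs (.ite (.ile (RealRAM.ivar 1) (.const 1)) (RealRAM.trivialSolution d)
        (RealRAM.generalSolution d)) (LBC.input P lam ε) B (RealRAM.IsApproximation P lam ε) by
    obtain ⟨B, hB, t, s, hexec, ht, C, f, ρ, hout, hsol, hprice, hρ⟩ := H
    exact ⟨t, s, C, f, ρ, hexec, le_trans (by exact_mod_cast ht) hB, hout, hsol, hprice, hρ⟩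
  have hcA : 0 ≤ (c₂ : ℝ) * |A| := by positivity
  have hcA' : 0 ≤ (c₂ : ℝ) * |A| * (n * L) := by positivity
  have hc₁n : 0 ≤ (c₁ : ℝ) * (n * L) := by positivity
  have hlam : (LBC.input P lam ε).ints 1 0 = lam := (RealRAM.hasInstance_input P lam ε).bound
  rcases Nat.lt_or_ge lam 2 with h | h
  · obtain rfl : lam = 1 := by omega
    refine ⟨_, ?_, RealRAM.Runs.ite (fun _ => hc₁ n P ε hε) fun hb => ?_⟩
    · have := mul_le_mul_of_nonneg_left hnL (Nat.cast_nonneg (α := ℝ) c₁)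
      simp only [RealRAM.Test.cost, RealRAM.IExp.cost]
      push_cast
      nlinarith
    · simp [RealRAM.Test.Holds, RealRAM.IExp.eval, hlam] at hb
  · obtain ⟨m, hm, hrun⟩ := hc₂ n P lam ε hP h hn hε
    refine ⟨_, ?_, RealRAM.Runs.ite (fun hb => ?_) fun _ => hrun⟩
    · have h2 : (m : ℝ) ≤ |A| * L := hm.trans (mul_le_mul_of_nonneg_right (le_abs_self A) hL0)
      have h3 : (c₂ : ℝ) * (n * m) ≤ c₂ * (n * (|A| * L)) := by gcongr
      have h4 : (c₂ : ℝ) * (n * (|A| * L)) = c₂ * |A| * (n * L) := by ring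
      simp only [RealRAM.Test.cost, RealRAM.IExp.cost]
      push_cast
      have h5 : (0 : ℝ) ≤ c₁ := Nat.cast_nonneg _
      linarith
    · simp only [RealRAM.Test.Holds, RealRAM.IExp.eval, hlam] at hb
      omega
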